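/- Let $\mathbb{F}=\mathbb{Z}/2$ and $R=\mathbb{F}[u]$. All complexes are bigraded (homological and quantum grading), differentials have bidegree $(1,0)$, and $u$, $Q$, $\tau$ have bidegrees $(0,-2)$, $(1,0)$, $(0,0)$. *Reduced Borel complex.* Let $D$ be an oriented transvergent diagram of an involutive link $(L,\tau)$, i.e. a planar diagram preserved by the rotation by $\pi$ about an axis in the plane of projection, the axis being transverse to the diagram. Let $n_\pm$ be the numbers of positive and negative crossings. For a vertex $v$ of the cube of resolutions, let $Z(D_v)$ be the set of circles of the resolution $D_v$ and $|v|$ the number of $1$-resolutions, and put $A_v=R[x_c : c\in Z(D_v)]/(x_c^2=u\,x_c)$. Along an edge $v\to w$ of the cube use the algebra map $A_v\to A_w$ induced by relabeling of circles if two circles merge; if a circle splits into $\beta$ and $\gamma$, relabel (using either of $\beta$, $\gamma$ for the split circle) and multiply by $x_\beta+x_\gamma+u$. The sum of these maps is the Bar-Natan differential $\partial$ on $\bigoplus_v A_v$. The reduced complex $\mathit{Kcr}^-(D)\subset\bigoplus_v A_v$ is the subcomplex $\bigoplus_v A_v'$, where $A_v'\subset A_v$ is the $R$-subalgebra generated by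 all sums $x_c+x_{c'}$. An element $u^a x_{c_1}\cdots x_{c_\ell}$ at $v$ has homological degree $|v|-n_-$ and quantum degree $|Z(D_v)|-2(a+\ell)+|v|+n_+-2n_--1$ (normalized so that for the unknot $1$ has bidegree $(0,0)$). The symmetry of $D$ permutes resolutions and their circles and so induces an involution $\tau$ of the bigraded complex $\mathit{Kcr}^-(D)$. The reduced Borel complex is the complex over $R[Q]=\mathbb{F}[u,Q]$ $$\mathit{Kcr}^-_Q(D)=\bigl(\mathit{Kcr}^-(D)\otimes_R R[Q],\ \partial_Q=\partial+Q(1+\tau)\bigr).$$ *Koszul functors.* Let $T=R[\tau]/(\tau^2+1)$. Define bimodules-with-differential over $T$ and $R[Q]$ by $$\mathcal{B}=T\otimes_R R[Q],\quad \partial(a\otimes b)=(1+\tau)a\otimes Qb,\qquad \mathcal{H}=\mathrm{Hom}_R(T,R[Q]),\quad (\partial F)(x)=Q\,F((1+\tau)x),$$ and for complexes $X$ over $T$ and $Y$ over $R[Q]$ put $\mathrm{Br}(X)=X\otimes_T\mathcal{B}$ and $\mathrm{Hh}(Y)=Y\otimes_{R[Q]}\mathcal{H}$. For complexes $X_1,X_2$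 over $T$, let $X_1\otimes X_2$ be $X_1\otimes_R X_2$ with the diagonal action $\tau\otimes\tau$. For complexes $Y_1,Y_2$ over $R[Q]$ define $$Y_1\otimes_{\mathrm{Br}}Y_2=\mathrm{Br}\bigl(\mathrm{Hh}(Y_1)\otimes\mathrm{Hh}(Y_2)\bigr).$$ **Theorem.** Let $D_1$ and $D_2$ be transvergent diagrams of involutive links $(L_1,\tau_1)$ and $(L_2,\tau_2)$, each with a chosen equivariant basepoint, i.e. a point in which an edge of the diagram crosses the axis and is mapped to itself by the symmetry (for instance, strongly invertible knots). Let $D_1\#D_2$ be an equivariant connected sum of $D_1$ and $D_2$ at these basepoints: the diagrams are placed along a common axis, the two edges through the basepoints are cut there, and the ends on the same side of the axis are joined (if necessary, the orientation of the second link is reversed). Then, however the equivariant connected sum is formed, there is a homotopy equivalence of bigraded complexes over $\mathbb{F}[u,Q]$ $$\mathit{Kcr}^-_Q(D_1\#D_2)\ \simeq\ \mathit{Kcr}^-_Q(D_1)\otimes_{\mathrm{Br}}\mathit{Kcr}^-_Q(D_2),$$ that is, there are $\mathbb{F}[u,Q]$-linear chain maps of bidegree $(0,0)$ in both directions that are mutually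 inverse up to $\mathbb{F}[u,Q]$-linear chain homotopies of bidegree $(-1,0)$. -/

import Mathlib

open scoped TensorProduct

noncomputable section

namespace KoszulBorel

/-! ### Internal gradings -/

theorem isInternal_of_proj {ι M : Type} [DecidableEq ι] [AddCommGroup M]
    (G : ι → AddSubgroup M) (p : ι → M →+ M)
    (h1 : ∀ i, ∀ m ∈ G i, p i m = m) (h2 : ∀ i j, ∀ m ∈ G i, j ≠ i → p j m = 0)
    (h3 : ∀ m, m ∈ ⨆ i, G i) : DirectSum.IsInternal G := by
  constructor
  · rw [injective_iff_map_eq_zero]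
    intro x hx
    ext j
    have key : ∀ y : DirectSum ι (fun i => G i),
        p j (DirectSum.coeAddMonoidHom G y) = (y j : M) := by
      intro y
      induction y using DirectSum.induction_on with
      | zero => simp
      | of i m =>
        rw [DirectSum.coeAddMonoidHom_of]
        by_cases hij : j = i
        · subst hij
          rw [h1 _ _ m.2, DirectSum.of_eq_same]
        · rw [h2 i j _ m.2 hij, DirectSum.of_eq_of_ne _ _ _ hij]; rfl
      | add a b ha hb => rw [map_add, map_add, ha, hb, DirectSum.add_apply]; rfl
    have := key x
    rw [hx, map_zero] at this
    simpa using this.symm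
  · intro m
    have : (⨆ i, G i) ≤ (DirectSum.coeAddMonoidHom G).range := by
      apply iSup_le
      intro i x hx
      exact ⟨DirectSum.of (fun i => G i) i ⟨x, hx⟩, by rw [DirectSum.coeAddMonoidHom_of]⟩
    exact this (h3 m)

theorem isInternal_mem_iSup {ι M : Type} [DecidableEq ι] [AddCommGroup M]
    {G : ι → AddSubgroup M} (h : DirectSum.IsInternal G) (m : M) : m ∈ ⨆ i, G i := by
  obtain ⟨x, rfl⟩ := h.2 m
  induction x using DirectSum.induction_on with
  | zero => simp
  | of i m => rw [DirectSum.coeAddMonoidHom_of]; exact AddSubgroup.mem_iSup_of_mem i m.2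
  | add a b ha hb => rw [map_add]; exact add_mem ha hb

theorem exists_delta {ι M : Type} [DecidableEq ι] [AddCommGroup M]
    {G : ι → AddSubgroup M} (h : DirectSum.IsInternal G) :
    ∃ D : M →+ (ι →₀ M), ∀ i, ∀ m ∈ G i, D m = Finsupp.single i m := by
  let e : DirectSum ι (fun i => G i) ≃+ M := AddEquiv.ofBijective _ h
  let φ : DirectSum ι (fun i => G i) →+ (ι →₀ M) :=
    DirectSum.toAddMonoid (fun i => (Finsupp.singleAddHom i).comp (G i).subtype)
  refine ⟨φ.comp e.symm.toAddMonoidHom, fun i m hm => ?_⟩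
  have : e.symm m = DirectSum.of (fun i => G i) i ⟨m, hm⟩ := by
    rw [AddEquiv.symm_apply_eq]
    exact (DirectSum.coeAddMonoidHom_of G i ⟨m, hm⟩).symm
  simp [this, φ]

/-- The grading of a tensor product `M ⊗[A] N` of graded modules: the piece of degree `n` is
spanned by the `x ⊗ y` with `x`, `y` homogeneous and `deg x + deg y = n`. -/
def tensorGr {ι A M N : Type} [Add ι] [CommRing A] [AddCommGroup M] [AddCommGroup N]
    [Module A M] [Module A N] (G : ι → AddSubgroup M) (H : ι → AddSubgroup N) (n : ι) :
    AddSubgroup (M ⊗[A] N) :=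
  AddSubgroup.closure {z | ∃ i j, i + j = n ∧ ∃ x ∈ G i, ∃ y ∈ H j, z = x ⊗ₜ[A] y}

theorem tmul_mem_tensorGr {ι A M N : Type} [Add ι] [CommRing A] [AddCommGroup M] [AddCommGroup N]
    [Module A M] [Module A N] {G : ι → AddSubgroup M} {H : ι → AddSubgroup N} {i j n : ι}
    (h : i + j = n) {x : M} (hx : x ∈ G i) {y : N} (hy : y ∈ H j) :
    x ⊗ₜ[A] y ∈ tensorGr (A := A) G H n :=
  AddSubgroup.subset_closure ⟨i, j, h, x, hx, y, hy, rfl⟩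

/-- An additive map that has the right effect on homogeneous pure tensors is homogeneous. -/
theorem tensorGr_map_mem {ι A M N P : Type} [Add ι] [CommRing A] [AddCommGroup M] [AddCommGroup N]
    [AddCommGroup P] [Module A M] [Module A N] {G : ι → AddSubgroup M} {H : ι → AddSubgroup N}
    {n : ι} {K : AddSubgroup P} (f : M ⊗[A] N →+ P)
    (hf : ∀ i j, i + j = n → ∀ x ∈ G i, ∀ y ∈ H j, f (x ⊗ₜ[A] y) ∈ K)
    {z : M ⊗[A] N} (hz : z ∈ tensorGr (A := A) G H n) : f z ∈ K := by
  have : tensorGr (A := A) G H n ≤ K.comap f := by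
    refine (AddSubgroup.closure_le _).2 ?_
    rintro _ ⟨i, j, h, x, hx, y, hy, rfl⟩
    exact hf i j h x hx y hy
  exact this hz

theorem tensorGr_isInternal {A M N : Type} [CommRing A]
    [AddCommGroup M] [AddCommGroup N] [Module A M] [Module A N]
    {G : ℤ × ℤ → AddSubgroup M} {H : ℤ × ℤ → AddSubgroup N}
    (hG : DirectSum.IsInternal G) (hH : DirectSum.IsInternal H)
    (hA : ∀ a : A, a ∈ AddSubgroup.closure {a : A | ∃ k : ℤ × ℤ,
      (∀ n, ∀ m ∈ G n, a • m ∈ G (n + k)) ∧ (∀ n, ∀ m ∈ H n, a • m ∈ H (n + k))}) :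
    DirectSum.IsInternal (tensorGr (A := A) G H) := by
  obtain ⟨DG, hDG⟩ := exists_delta hG
  obtain ⟨DH, hDH⟩ := exists_delta hH
  -- the biadditive map `(x, y) ↦ ∑ single (i + j) (x_i ⊗ y_j)`
  let β : (ℤ × ℤ →₀ M) →+ (ℤ × ℤ →₀ N) →+ (ℤ × ℤ →₀ M ⊗[A] N) :=
    Finsupp.liftAddHom fun i => AddMonoidHom.flip (Finsupp.liftAddHom fun j =>
      AddMonoidHom.flip ((AddMonoidHom.compHom (Finsupp.singleAddHom (i + j))).comp
        (LinearMap.toAddMonoidHom'.comp (TensorProduct.mk A M N).toAddMonoidHom)))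
  have hβ : ∀ i j x y, β (Finsupp.single i x) (Finsupp.single j y)
      = Finsupp.single (i + j) (x ⊗ₜ[A] y) := by
    intro i j x y
    simp [β]
  let γ : M →+ N →+ (ℤ × ℤ →₀ M ⊗[A] N) :=
    (β.compl₂ DH).comp DG
  have hγ : ∀ x y, γ x y = β (DG x) (DH y) := fun x y => rfl
  have hγh : ∀ i j, ∀ x ∈ G i, ∀ y ∈ H j, γ x y = Finsupp.single (i + j) (x ⊗ₜ[A] y) := by
    intro i j x hx y hy
    rw [hγ, hDG _ _ hx, hDH _ _ hy, hβ]
  have hbal : ∀ (a : A) (x : M) (y : N), γ (a • x) y = γ x (a • y) := by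
    intro a x y
    induction hA a using AddSubgroup.closure_induction with
    | zero => simp
    | add a b _ _ ha hb => simp only [add_smul, map_add, AddMonoidHom.add_apply, ha, hb]
    | neg a _ ha => simp only [neg_smul, map_neg, AddMonoidHom.neg_apply, ha]
    | mem a ha =>
      obtain ⟨k, hk1, hk2⟩ := ha
      induction isInternal_mem_iSup hG x using AddSubgroup.iSup_induction' with
      | h1 => simp
      | hadd x x' _ _ h h' => simp only [smul_add, map_add, AddMonoidHom.add_apply, h, h']
      | hp i x hx =>
        induction isInternal_mem_iSup hH y using AddSubgroup.iSup_induction' with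
        | h1 => simp
        | hadd y y' _ _ h h' => simp only [smul_add, map_add, h, h']
        | hp j y hy =>
          rw [hγh _ _ _ (hk1 _ _ hx) _ hy, hγh _ _ _ hx _ (hk2 _ _ hy),
            TensorProduct.smul_tmul]
          congr 1
          abel
  let δ : M ⊗[A] N →+ (ℤ × ℤ →₀ M ⊗[A] N) := TensorProduct.liftAddHom γ hbal
  have hδ : ∀ n, ∀ z ∈ tensorGr (A := A) G H n, δ z = Finsupp.single n z := by
    intro n z hz
    induction hz using AddSubgroup.closure_induction with
    | zero => simp
    | add a b _ _ ha hb => rw [map_add, ha, hb, Finsupp.single_add]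
    | neg a _ ha => rw [map_neg, ha, Finsupp.single_neg]
    | mem z hz =>
      obtain ⟨i, j, rfl, x, hx, y, hy, rfl⟩ := hz
      exact hγh i j x hx y hy
  refine isInternal_of_proj _ (fun n => (Finsupp.applyAddHom n).comp δ) ?_ ?_ ?_
  · intro i m hm
    simp [hδ _ _ hm]
  · intro i j m hm hij
    simp [hδ _ _ hm, Finsupp.single_eq_of_ne hij]
  · intro m
    induction m using TensorProduct.induction_on with
    | zero => exact zero_mem _
    | add a b ha hb => exact add_mem ha hb
    | tmul x y =>
      induction isInternal_mem_iSup hG x using AddSubgroup.iSup_induction' with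
      | h1 => simp
      | hadd x x' _ _ h h' => rw [TensorProduct.add_tmul]; exact add_mem h h'
      | hp i x hx =>
        induction isInternal_mem_iSup hH y using AddSubgroup.iSup_induction' with
        | h1 => simp
        | hadd y y' _ _ h h' => rw [TensorProduct.tmul_add]; exact add_mem h h'
        | hp j y hy =>
          exact AddSubgroup.mem_iSup_of_mem (i + j) (tmul_mem_tensorGr rfl hx hy)

/-! ### Coefficient rings -/

/-- The ground ring `R = 𝔽[u]`, where `𝔽 = ℤ/2`. -/
abbrev Base : Type := Polynomial (ZMod 2)

/-- The variable `u`, of bidegree `(0, -2)`. -/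
abbrev u : Base := Polynomial.X

/-- The ring `R[τ]/(τ² + 1)`, that is `R[τ]/(τ² = 1)`. -/
abbrev TauRing : Type := QuadraticAlgebra Base 1 0

/-- The element `τ`, of bidegree `(0, 0)`. -/
def tau : TauRing := ⟨0, 1⟩

/-- The ring `R[Q] = 𝔽[u, Q]`. -/
abbrev QRing : Type := Polynomial Base

/-- The variable `Q`, of bidegree `(1, 0)`. -/
abbrev Q : QRing := Polynomial.X

theorem tau_mul_tau : tau * tau = 1 := by
  ext <;> simp [tau, QuadraticAlgebra.re_one, QuadraticAlgebra.im_one]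

theorem tauRing_eq (z : TauRing) :
    z = algebraMap Base TauRing z.re + algebraMap Base TauRing z.im * tau := by
  ext <;> simp [tau, QuadraticAlgebra.algebraMap_eq]

theorem adjoin_tau : Algebra.adjoin Base {tau} = ⊤ := by
  refine top_unique fun z _ => ?_
  rw [tauRing_eq z]
  exact add_mem (algebraMap_mem _ _)
    (mul_mem (algebraMap_mem _ _) (Algebra.self_mem_adjoin_singleton _ _))

theorem adjoin_Q : Algebra.adjoin Base {Q} = ⊤ := Polynomial.adjoin_X

theorem adjoin_one : Algebra.adjoin Base {(1 : Base)} = ⊤ :=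
  top_unique fun z _ => algebraMap_mem (Algebra.adjoin Base {(1 : Base)}) z

theorem add_self_eq_zero {M : Type} [AddCommGroup M] [Module Base M] (m : M) : m + m = 0 := by
  have h : (2 : Base) = 0 := CharTwo.two_eq_zero
  rw [← two_smul Base m, h, zero_smul]

/-- The ring elements that act homogeneously on two graded modules span, as soon as `u` and the
extra variable act homogeneously. -/
theorem mem_closure_homogeneous {A M N : Type} [CommRing A] [Algebra Base A] {a : A}
    (ha : Algebra.adjoin Base {a} = ⊤) {δ : ℤ × ℤ}
    [AddCommGroup M] [Module Base M] [Module A M] [IsScalarTower Base A M]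
    [AddCommGroup N] [Module Base N] [Module A N] [IsScalarTower Base A N]
    {G : ℤ × ℤ → AddSubgroup M} {H : ℤ × ℤ → AddSubgroup N}
    (hGu : ∀ n, ∀ m ∈ G n, u • m ∈ G (n + (0, -2)))
    (hHu : ∀ n, ∀ m ∈ H n, u • m ∈ H (n + (0, -2)))
    (hGa : ∀ n, ∀ m ∈ G n, a • m ∈ G (n + δ))
    (hHa : ∀ n, ∀ m ∈ H n, a • m ∈ H (n + δ)) (x : A) :
    x ∈ AddSubgroup.closure {a : A | ∃ k : ℤ × ℤ,
      (∀ n, ∀ m ∈ G n, a • m ∈ G (n + k)) ∧ (∀ n, ∀ m ∈ H n, a • m ∈ H (n + k))} := by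
  let S : Submonoid A :=
    { carrier := {a : A | ∃ k : ℤ × ℤ,
        (∀ n, ∀ m ∈ G n, a • m ∈ G (n + k)) ∧ (∀ n, ∀ m ∈ H n, a • m ∈ H (n + k))}
      one_mem' := ⟨0, by simp, by simp⟩
      mul_mem' := by
        rintro x y ⟨k, hk, hk'⟩ ⟨l, hl, hl'⟩
        refine ⟨k + l, fun n m hm => ?_, fun n m hm => ?_⟩
        · rw [mul_smul, add_comm k, ← add_assoc]; exact hk _ _ (hl _ _ hm)
        · rw [mul_smul, add_comm k, ← add_assoc]; exact hk' _ _ (hl' _ _ hm) }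
  have hcl : AddSubgroup.closure (S : Set A) = (Subring.closure (S : Set A)).toAddSubgroup := by
    apply le_antisymm
    · exact (AddSubgroup.closure_le _).2 Subring.subset_closure
    · intro y hy
      rw [Subring.mem_toAddSubgroup, Subring.mem_closure_iff] at hy
      rwa [Submonoid.closure_eq] at hy
  change x ∈ AddSubgroup.closure (S : Set A)
  rw [hcl, Subring.mem_toAddSubgroup]
  have hx : x ∈ Algebra.adjoin Base {a} := ha ▸ trivial
  induction hx using Algebra.adjoin_induction with
  | mem y hy =>
    rw [Set.mem_singleton_iff] at hy
    subst hy
    exact Subring.subset_closure ⟨δ, hGa, hHa⟩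
  | add y z _ _ hy hz => exact add_mem hy hz
  | mul y z _ _ hy hz => exact mul_mem hy hz
  | algebraMap r =>
    induction r using Polynomial.induction_on' with
    | add p q hp hq => rw [map_add]; exact add_mem hp hq
    | monomial n c =>
      rw [← Polynomial.C_mul_X_pow_eq_monomial, map_mul, map_pow]
      have hu : algebraMap Base A u ∈ Subring.closure (S : Set A) := by
        refine Subring.subset_closure ⟨(0, -2), ?_, ?_⟩
        · intro n m hm; rw [algebraMap_smul]; exact hGu n m hm
        · intro n m hm; rw [algebraMap_smul]; exact hHu n m hm
      refine mul_mem ?_ (pow_mem hu n)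
      · have : c = ((c.val : ℕ) : ZMod 2) := by simp
        rw [this, map_natCast, map_natCast]
        exact natCast_mem _ _

/-! ### Bigraded complexes -/

/-- A bigraded chain complex over an `R`-algebra `S` with a distinguished homogeneous element `s`
of bidegree `δ` (in addition to `u`, of bidegree `(0, -2)`). The first grading is the homological
one, the second the quantum one; the differential has bidegree `(1, 0)`. -/
structure BigradedComplex (S : Type) [CommRing S] [Algebra Base S] (s : S) (δ : ℤ × ℤ) where
  carrier : Type
  [addCommGroup : AddCommGroup carrier]
  [moduleBase : Module Base carrier]
  [module : Module S carrier]
  [tower : IsScalarTower Base S carrier]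
  gr : ℤ × ℤ → AddSubgroup carrier
  isInternal : DirectSum.IsInternal gr
  u_smul_mem : ∀ n, ∀ m ∈ gr n, u • m ∈ gr (n + (0, -2))
  s_smul_mem : ∀ n, ∀ m ∈ gr n, s • m ∈ gr (n + δ)
  d : carrier →ₗ[S] carrier
  d_mem : ∀ n, ∀ m ∈ gr n, d m ∈ gr (n + (1, 0))
  d_d : ∀ m, d (d m) = 0

attribute [instance] BigradedComplex.addCommGroup BigradedComplex.moduleBase
  BigradedComplex.module BigradedComplex.tower

/-- Bigraded complexes over `R[τ]/(τ² + 1)`. -/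
abbrev KomTau : Type 1 := BigradedComplex TauRing tau (0, 0)

/-- Bigraded complexes over `R[Q]`. -/
abbrev KomQ : Type 1 := BigradedComplex QRing Q (1, 0)

/-- Homotopy equivalence of bigraded complexes over `S`: there are `S`-linear chain maps of bidegree
`(0, 0)` in both directions, mutually inverse up to `S`-linear chain homotopies of bidegree
`(-1, 0)`. -/
def HomotopyEquivalent {S : Type} [CommRing S] [Algebra Base S] {s : S} {δ : ℤ × ℤ}
    (A B : BigradedComplex S s δ) : Prop :=
  ∃ (f : A.carrier →ₗ[S] B.carrier) (g : B.carrier →ₗ[S] A.carrier)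
    (h : A.carrier →ₗ[S] A.carrier) (k : B.carrier →ₗ[S] B.carrier),
    (∀ n, ∀ x ∈ A.gr n, f x ∈ B.gr n) ∧ (∀ n, ∀ y ∈ B.gr n, g y ∈ A.gr n) ∧
    (∀ n, ∀ x ∈ A.gr n, h x ∈ A.gr (n + (-1, 0))) ∧
    (∀ n, ∀ y ∈ B.gr n, k y ∈ B.gr (n + (-1, 0))) ∧
    (∀ x, f (A.d x) = B.d (f x)) ∧ (∀ y, g (B.d y) = A.d (g y)) ∧
    (∀ x, g (f x) - x = A.d (h x) + h (A.d x)) ∧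
    (∀ y, f (g y) - y = B.d (k y) + k (B.d y))

/-- A bigraded bimodule-with-differential over two `R`-algebras `A` and `S`, with distinguished
homogeneous elements `a` and `s` of bidegrees `δa` and `δs`. -/
structure BigradedBimodule (A : Type) [CommRing A] [Algebra Base A] (a : A) (δa : ℤ × ℤ)
    (S : Type) [CommRing S] [Algebra Base S] (s : S) (δs : ℤ × ℤ) where
  carrier : Type
  [addCommGroup : AddCommGroup carrier]
  [moduleBase : Module Base carrier]
  [moduleLeft : Module A carrier]
  [moduleRight : Module S carrier]
  [towerLeft : IsScalarTower Base A carrier]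
  [towerRight : IsScalarTower Base S carrier]
  [smulComm : SMulCommClass A S carrier]
  gr : ℤ × ℤ → AddSubgroup carrier
  isInternal : DirectSum.IsInternal gr
  u_smul_mem : ∀ n, ∀ m ∈ gr n, u • m ∈ gr (n + (0, -2))
  a_smul_mem : ∀ n, ∀ m ∈ gr n, a • m ∈ gr (n + δa)
  s_smul_mem : ∀ n, ∀ m ∈ gr n, s • m ∈ gr (n + δs)
  d : carrier →ₗ[A] carrier
  d_smul : ∀ (t : S) m, d (t • m) = t • d m
  d_mem : ∀ n, ∀ m ∈ gr n, d m ∈ gr (n + (1, 0))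
  d_d : ∀ m, d (d m) = 0

attribute [instance] BigradedBimodule.addCommGroup BigradedBimodule.moduleBase
  BigradedBimodule.moduleLeft BigradedBimodule.moduleRight BigradedBimodule.towerLeft
  BigradedBimodule.towerRight BigradedBimodule.smulComm

section TensorBimodule

variable {A : Type} [CommRing A] [Algebra Base A] {a : A} {δa : ℤ × ℤ}
    {S : Type} [CommRing S] [Algebra Base S] {s : S} {δs : ℤ × ℤ}

instance (B : BigradedBimodule A a δa S s δs) : SMulCommClass A Base B.carrier :=
  IsScalarTower.to_smulCommClass' 

/-- The underlying map of the differential `∂_B ⊗ 1 + 1 ⊗ ∂_X` on `B ⊗[A] X`. -/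
def tensorD (B : BigradedBimodule A a δa S s δs) (X : BigradedComplex A a δa) :
    B.carrier ⊗[A] X.carrier →ₗ[A] B.carrier ⊗[A] X.carrier :=
  TensorProduct.map B.d LinearMap.id + TensorProduct.map LinearMap.id X.d

theorem tensorD_tmul (B : BigradedBimodule A a δa S s δs) (X : BigradedComplex A a δa)
    (b : B.carrier) (x : X.carrier) :
    tensorD B X (b ⊗ₜ x) = B.d b ⊗ₜ x + b ⊗ₜ X.d x := rfl

/-- The tensor product over `A` of a complex `X` over `A` with an `(A, S)`-bimodule-with-differential
`B`: a complex over `S`. (All rings are commutative, so left and right actions need not be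
distinguished, and the order of the factors is immaterial.) -/
def tensorBimodule (hA : Algebra.adjoin Base {a} = ⊤) (B : BigradedBimodule A a δa S s δs)
    (X : BigradedComplex A a δa) : BigradedComplex S s δs where
  carrier := B.carrier ⊗[A] X.carrier
  gr := tensorGr B.gr X.gr
  isInternal := tensorGr_isInternal B.isInternal X.isInternal
    (mem_closure_homogeneous hA B.u_smul_mem X.u_smul_mem B.a_smul_mem X.s_smul_mem)
  u_smul_mem n m hm := by
    refine tensorGr_map_mem (DistribSMul.toAddMonoidHom _ u) ?_ hm
    rintro i j rfl x hx y hy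
    exact tmul_mem_tensorGr (by abel) (B.u_smul_mem _ _ hx) hy
  s_smul_mem n m hm := by
    refine tensorGr_map_mem (DistribSMul.toAddMonoidHom _ s) ?_ hm
    rintro i j rfl x hx y hy
    exact tmul_mem_tensorGr (by abel) (B.s_smul_mem _ _ hx) hy
  d :=
    { toFun := tensorD B X
      map_add' := map_add _
      map_smul' := by
        intro t m
        induction m using TensorProduct.induction_on with
        | zero => simp
        | add x y hx hy => simp only [smul_add, map_add, hx, hy]
        | tmul b x =>
          simp only [RingHom.id_apply, TensorProduct.smul_tmul', tensorD_tmul, B.d_smul, smul_add] }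
  d_mem n m hm := by
    refine tensorGr_map_mem (tensorD B X).toAddMonoidHom ?_ hm
    rintro i j rfl x hx y hy
    exact add_mem (tmul_mem_tensorGr (by abel) (B.d_mem _ _ hx) hy)
      (tmul_mem_tensorGr (by abel) hx (X.d_mem _ _ hy))
  d_d m := by
    change tensorD B X (tensorD B X m) = 0
    induction m using TensorProduct.induction_on with
    | zero => simp
    | add x y hx hy => simp only [map_add, hx, hy, add_zero]
    | tmul b x =>
      simp only [tensorD_tmul, map_add, B.d_d, X.d_d, TensorProduct.zero_tmul,
        TensorProduct.tmul_zero, zero_add, add_zero]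
      exact add_self_eq_zero _

end TensorBimodule

/-! ### The graded rings `R[τ]/(τ² + 1)` and `R[Q]` -/

/-- The part of bidegree `n` of `R[Q]`: combinations of the `u ^ k * Q ^ a` with `(a, -2 k) = n`. -/
def qGr (n : ℤ × ℤ) : AddSubgroup QRing where
  carrier := {p | ∀ a k : ℕ, (p.coeff a).coeff k ≠ 0 → ((a : ℤ), -2 * (k : ℤ)) = n}
  zero_mem' := by simp
  add_mem' := by
    intro p q hp hq a k h
    by_cases h' : (p.coeff a).coeff k = 0
    · exact hq a k (by simpa [h'] using h)
    · exact hp a k h'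
  neg_mem' := by
    intro p hp a k h
    exact hp a k (by simpa using h)

/-- The part of bidegree `n` of `R[τ]/(τ² + 1)`: combinations of `u ^ k` and `u ^ k * τ` with
`(0, -2 k) = n`. -/
def tauGr (n : ℤ × ℤ) : AddSubgroup TauRing where
  carrier := {z | ∀ k : ℕ, (z.re.coeff k ≠ 0 ∨ z.im.coeff k ≠ 0) → (0, -2 * (k : ℤ)) = n}
  zero_mem' := by simp
  add_mem' := by
    intro p q hp hq k h
    by_cases h' : p.re.coeff k ≠ 0 ∨ p.im.coeff k ≠ 0
    · exact hp k h'
    · push Not at h'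
      exact hq k (by simpa [h'.1, h'.2] using h)
  neg_mem' := by
    intro p hp k h
    exact hp k (by simpa using h)

/-- The homogeneous component of bidegree `n` of an element of `R[Q]`. -/
def qProj (n : ℤ × ℤ) : QRing →+ QRing where
  toFun p := if ((n.1.toNat : ℤ), -2 * ((-n.2 / 2).toNat : ℤ)) = n then
    Polynomial.monomial n.1.toNat
      (Polynomial.monomial (-n.2 / 2).toNat ((p.coeff n.1.toNat).coeff (-n.2 / 2).toNat)) else 0
  map_zero' := by simp
  map_add' p q := by split_ifs <;> simp

theorem qProj_coeff (n : ℤ × ℤ) (p : QRing) (a k : ℕ) :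
    ((qProj n p).coeff a).coeff k =
      if ((a : ℤ), -2 * (k : ℤ)) = n then (p.coeff a).coeff k else 0 := by
  simp only [qProj, AddMonoidHom.coe_mk, ZeroHom.coe_mk]
  by_cases h : ((a : ℤ), -2 * (k : ℤ)) = n
  · subst h
    have h1 : ((a : ℤ)).toNat = a := by simp
    have h2 : (-(-2 * (k : ℤ)) / 2).toNat = k := by omega
    simp only [h1, h2]
    simp
  · rw [if_neg h]
    split_ifs with h'
    · rw [Polynomial.coeff_monomial]
      split_ifs with h1
      · rw [Polynomial.coeff_monomial]
        rw [if_neg]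
        rintro rfl
        subst h1
        exact h h'
      · simp
    · simp

theorem qProj_of_mem {n : ℤ × ℤ} {p : QRing} (hp : p ∈ qGr n) : qProj n p = p := by
  ext a k
  rw [qProj_coeff]
  split_ifs with h
  · rfl
  · by_contra h'
    exact h (hp a k (Ne.symm h'))

theorem qProj_of_ne {n m : ℤ × ℤ} {p : QRing} (hp : p ∈ qGr n) (h : m ≠ n) : qProj m p = 0 := by
  ext a k
  rw [qProj_coeff]
  split_ifs with h'
  · by_contra h''
    exact h (h' ▸ hp a k h'')
  · simp

theorem qProj_mem (n : ℤ × ℤ) (p : QRing) : qProj n p ∈ qGr n := by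
  intro a k h
  rw [qProj_coeff] at h
  by_contra h'
  exact h (if_neg h')

theorem qGr_iSup (p : QRing) : p ∈ ⨆ n, qGr n := by
  induction p using Polynomial.induction_on' with
  | add p q hp hq => exact add_mem hp hq
  | monomial a c =>
    induction c using Polynomial.induction_on' with
    | add p q hp hq => rw [map_add]; exact add_mem hp hq
    | monomial k c =>
      refine AddSubgroup.mem_iSup_of_mem ((a : ℤ), -2 * (k : ℤ)) ?_
      intro b l h
      rw [Polynomial.coeff_monomial] at h
      split_ifs at h with h1
      · rw [Polynomial.coeff_monomial] at h
        split_ifs at h with h2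
        · rw [h1, h2]
        · exact absurd rfl h
      · simp at h

theorem qGr_isInternal : DirectSum.IsInternal qGr :=
  isInternal_of_proj qGr qProj (fun _ _ h => qProj_of_mem h) (fun _ _ _ h h' => qProj_of_ne h h')
    qGr_iSup

theorem u_smul_mem_qGr (n : ℤ × ℤ) (p : QRing) (hp : p ∈ qGr n) : u • p ∈ qGr (n + (0, -2)) := by
  intro a k h
  rw [Polynomial.coeff_smul, smul_eq_mul] at h
  cases k with
  | zero => simp at h
  | succ k =>
    rw [Polynomial.coeff_X_mul] at h
    rw [← hp a k h]
    ext <;> simp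
    ring

theorem Q_mul_mem_qGr (n : ℤ × ℤ) (p : QRing) (hp : p ∈ qGr n) : Q * p ∈ qGr (n + (1, 0)) := by
  intro a k h
  cases a with
  | zero => simp at h
  | succ a =>
    rw [Polynomial.coeff_X_mul] at h
    rw [← hp a k h]
    ext <;> simp

/-- The homogeneous component of bidegree `n` of an element of `R[τ]/(τ² + 1)`. -/
def tauProj (n : ℤ × ℤ) : TauRing →+ TauRing where
  toFun z := ⟨(qProj n (Polynomial.C z.re)).coeff 0, (qProj n (Polynomial.C z.im)).coeff 0⟩
  map_zero' := by ext <;> simp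
  map_add' p q := by ext <;> simp

theorem tauProj_re (n : ℤ × ℤ) (z : TauRing) (k : ℕ) : (tauProj n z).re.coeff k =
    if (0, -2 * (k : ℤ)) = n then z.re.coeff k else 0 := by
  simp [tauProj, qProj_coeff]

theorem tauProj_im (n : ℤ × ℤ) (z : TauRing) (k : ℕ) : (tauProj n z).im.coeff k =
    if (0, -2 * (k : ℤ)) = n then z.im.coeff k else 0 := by
  simp [tauProj, qProj_coeff]

theorem tauGr_isInternal : DirectSum.IsInternal tauGr := by
  refine isInternal_of_proj tauGr tauProj ?_ ?_ ?_
  · intro n z hz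
    ext k
    · rw [tauProj_re, ite_eq_left_iff]
      intro h
      by_contra h'
      exact h (hz k (Or.inl (Ne.symm h')))
    · rw [tauProj_im, ite_eq_left_iff]
      intro h
      by_contra h'
      exact h (hz k (Or.inr (Ne.symm h')))
  · intro n m z hz hne
    ext k
    · rw [tauProj_re, QuadraticAlgebra.re_zero, Polynomial.coeff_zero, ite_eq_right_iff]
      intro h
      by_contra h'
      exact hne (h ▸ hz k (Or.inl h'))
    · rw [tauProj_im, QuadraticAlgebra.im_zero, Polynomial.coeff_zero, ite_eq_right_iff]
      intro h
      by_contra h'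
      exact hne (h ▸ hz k (Or.inr h'))
  · intro z
    have key : ∀ p : Base, (⟨p, 0⟩ : TauRing) ∈ ⨆ n, tauGr n ∧
        (⟨0, p⟩ : TauRing) ∈ ⨆ n, tauGr n := by
      intro p
      induction p using Polynomial.induction_on' with
      | add p q hp hq =>
        have h1 : (⟨p + q, 0⟩ : TauRing) = ⟨p, 0⟩ + ⟨q, 0⟩ := by ext <;> simp
        have h2 : (⟨0, p + q⟩ : TauRing) = ⟨0, p⟩ + ⟨0, q⟩ := by ext <;> simp
        rw [h1, h2]
        exact ⟨add_mem hp.1 hq.1, add_mem hp.2 hq.2⟩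
      | monomial k c =>
        constructor <;>
        · refine AddSubgroup.mem_iSup_of_mem (0, -2 * (k : ℤ)) ?_
          intro l h
          simp only [Polynomial.coeff_monomial, Polynomial.coeff_zero, ne_eq, not_true_eq_false,
            false_or, or_false, ite_eq_right_iff, Classical.not_imp] at h
          rw [h.1]
    have : z = ⟨z.re, 0⟩ + ⟨0, z.im⟩ := by ext <;> simp
    rw [this]
    exact add_mem (key _).1 (key _).2

theorem u_smul_mem_tauGr (n : ℤ × ℤ) (z : TauRing) (hz : z ∈ tauGr n) :
    u • z ∈ tauGr (n + (0, -2)) := by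
  intro k h
  rw [QuadraticAlgebra.re_smul, QuadraticAlgebra.im_smul, smul_eq_mul, smul_eq_mul] at h
  cases k with
  | zero => simp at h
  | succ k =>
    rw [Polynomial.coeff_X_mul, Polynomial.coeff_X_mul] at h
    rw [← hz k h]
    ext <;> simp
    ring

theorem tau_mul_mem_tauGr (n : ℤ × ℤ) (z : TauRing) (hz : z ∈ tauGr n) :
    tau * z ∈ tauGr (n + (0, 0)) := by
  intro k h
  have := hz k
  rw [Prod.mk_zero_zero, add_zero]
  simp [tau] at h this ⊢
  exact this h.symm

/-! ### The Koszul bimodules -/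

/-- The underlying module of the bimodule `Br`: the tensor product `R[τ]/(τ² + 1) ⊗[R] R[Q]`. -/
abbrev BrCarrier : Type := TauRing ⊗[Base] QRing

theorem br_mul_left_comm (x y z : BrCarrier) : x * (y * z) = y * (x * z) := mul_left_comm x y z

/-- `R[Q]` acts on `R[τ]/(τ² + 1) ⊗[R] R[Q]` through the second factor. -/
instance brModuleRight : Module QRing BrCarrier :=
  Module.compHom BrCarrier
    (Algebra.TensorProduct.includeRight : QRing →ₐ[Base] TauRing ⊗[Base] QRing).toRingHom

theorem br_smul_def (q : QRing) (z : BrCarrier) :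
    q • z = ((1 : TauRing) ⊗ₜ[Base] q : BrCarrier) * z := rfl

theorem br_smul_tmul (q : QRing) (x : TauRing) (y : QRing) :
    q • (x ⊗ₜ[Base] y : BrCarrier) = x ⊗ₜ[Base] (q * y) := by
  rw [br_smul_def, Algebra.TensorProduct.tmul_mul_tmul, one_mul]

theorem br_tau_smul_def (t : TauRing) (z : BrCarrier) :
    t • z = (t ⊗ₜ[Base] (1 : QRing) : BrCarrier) * z := by
  induction z using TensorProduct.induction_on with
  | zero => simp
  | add x y hx hy => rw [smul_add, mul_add, hx, hy]
  | tmul x y =>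
    rw [TensorProduct.smul_tmul', Algebra.TensorProduct.tmul_mul_tmul, one_mul, smul_eq_mul]

instance : SMulCommClass TauRing QRing BrCarrier where
  smul_comm t q z := by
    rw [br_tau_smul_def, br_tau_smul_def, br_smul_def, br_smul_def]
    exact br_mul_left_comm _ _ _

instance : IsScalarTower Base QRing BrCarrier where
  smul_assoc r q z := by
    rw [br_smul_def, br_smul_def, TensorProduct.tmul_smul, smul_mul_assoc]

/-- The bimodule `Br = R[τ]/(τ² + 1) ⊗[R] R[Q]` with `∂ (a ⊗ b) = (1 + τ) a ⊗ Q b`. -/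
def brBimodule : BigradedBimodule TauRing tau (0, 0) QRing Q (1, 0) where
  carrier := BrCarrier
  moduleRight := brModuleRight
  gr := tensorGr tauGr qGr
  isInternal := tensorGr_isInternal tauGr_isInternal qGr_isInternal
    (mem_closure_homogeneous (δ := (0, 0)) adjoin_one u_smul_mem_tauGr u_smul_mem_qGr
      (by simp) (by simp))
  u_smul_mem n m hm := by
    refine tensorGr_map_mem (DistribSMul.toAddMonoidHom _ u) ?_ hm
    rintro i j rfl x hx y hy
    exact tmul_mem_tensorGr (by abel) (u_smul_mem_tauGr _ _ hx) hy
  a_smul_mem n m hm := by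
    refine tensorGr_map_mem (DistribSMul.toAddMonoidHom _ tau) ?_ hm
    rintro i j rfl x hx y hy
    exact tmul_mem_tensorGr (by abel) (tau_mul_mem_tauGr _ _ hx) hy
  s_smul_mem n m hm := by
    refine tensorGr_map_mem (DistribSMul.toAddMonoidHom _ Q) ?_ hm
    rintro i j rfl x hx y hy
    rw [DistribSMul.toAddMonoidHom_apply, br_smul_tmul]
    exact tmul_mem_tensorGr (by abel) hx (Q_mul_mem_qGr _ _ hy)
  d := LinearMap.mulLeft TauRing (((1 + tau) ⊗ₜ[Base] Q : BrCarrier))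
  d_smul q m := by
    simp only [LinearMap.mulLeft_apply, br_smul_def]
    exact br_mul_left_comm _ _ _
  d_mem n m hm := by
    refine tensorGr_map_mem (LinearMap.mulLeft TauRing (((1 + tau) ⊗ₜ[Base] Q : BrCarrier))).toAddMonoidHom ?_ hm
    rintro i j rfl x hx y hy
    change ((1 + tau) ⊗ₜ[Base] Q : BrCarrier) * (x ⊗ₜ y) ∈ _
    rw [Algebra.TensorProduct.tmul_mul_tmul]
    refine tmul_mem_tensorGr (i := i) (by abel) ?_ (Q_mul_mem_qGr _ _ hy)
    rw [add_mul, one_mul]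
    refine add_mem hx ?_
    have := tau_mul_mem_tauGr _ _ hx
    rwa [Prod.mk_zero_zero, add_zero] at this
  d_d m := by
    simp only [LinearMap.mulLeft_apply, ← mul_assoc, Algebra.TensorProduct.tmul_mul_tmul]
    have : (1 + tau) * (1 + tau) = 0 := by
      have h := add_self_eq_zero (M := TauRing) (1 + tau)
      calc (1 + tau) * (1 + tau) = 1 + tau + (tau + tau * tau) := by ring
        _ = (1 + tau) + (1 + tau) := by rw [tau_mul_tau]; ring
        _ = 0 := h
    rw [this, TensorProduct.zero_tmul, zero_mul]

theorem brBimodule_d_tmul (a : TauRing) (b : QRing) :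
    brBimodule.d (a ⊗ₜ[Base] b : BrCarrier) = ((1 + tau) * a) ⊗ₜ[Base] (Q * b) :=
  Algebra.TensorProduct.tmul_mul_tmul _ _ _ _

/-- The underlying module of the bimodule `Hh`: the `R`-linear maps `R[τ]/(τ² + 1) → R[Q]`. -/
abbrev HhCarrier : Type := TauRing →ₗ[Base] QRing

/-- `R[τ]/(τ² + 1)` acts on `Hom_R(R[τ]/(τ² + 1), R[Q])` by `(t • F) x = F (t x)`. -/
instance hhModuleTau : Module TauRing HhCarrier where
  smul t F := F.comp (LinearMap.mulLeft Base t)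
  one_smul F := LinearMap.ext fun x => congrArg F (one_mul x)
  mul_smul s t F := LinearMap.ext fun x => congrArg F (by
    change s * t * x = t * (s * x)
    ring)
  smul_zero t := rfl
  smul_add t F G := rfl
  add_smul s t F := LinearMap.ext fun x => by
    change F ((s + t) * x) = F (s * x) + F (t * x)
    rw [add_mul, map_add]
  zero_smul F := LinearMap.ext fun x => by
    change F (0 * x) = 0
    rw [zero_mul, map_zero]

theorem hh_tau_smul_apply (t : TauRing) (F : HhCarrier) (x : TauRing) : (t • F) x = F (t * x) := rfl

instance : IsScalarTower Base TauRing HhCarrier where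
  smul_assoc r t F := LinearMap.ext fun x => by
    rw [hh_tau_smul_apply, smul_mul_assoc, map_smul]; rfl

instance : SMulCommClass QRing TauRing HhCarrier where
  smul_comm _ _ _ := rfl

/-- The part of bidegree `n` of `Hom_R(R[τ]/(τ² + 1), R[Q])`: the maps that raise the bidegree
by `n`. -/
def hhGr (n : ℤ × ℤ) : AddSubgroup HhCarrier where
  carrier := {F | ∀ k, ∀ x ∈ tauGr k, F x ∈ qGr (k + n)}
  zero_mem' := fun _ _ _ => zero_mem _
  add_mem' hF hG k x hx := add_mem (hF k x hx) (hG k x hx)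
  neg_mem' hF k x hx := neg_mem (hF k x hx)

/-- The `R`-linear map `R[τ]/(τ² + 1) → R[Q]` with given values at `1` and `τ`. -/
def hhMk (p q : QRing) : HhCarrier where
  toFun z := z.re • p + z.im • q
  map_add' x y := by simp only [QuadraticAlgebra.re_add, QuadraticAlgebra.im_add, add_smul]; abel
  map_smul' r x := by simp [mul_smul, smul_add]

theorem hh_apply (F : HhCarrier) (z : TauRing) : F z = z.re • F 1 + z.im • F tau := by
  conv_lhs => rw [tauRing_eq z]
  rw [map_add, ← Algebra.smul_def, map_smul, Algebra.algebraMap_eq_smul_one, map_smul]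

theorem hh_ext {F G : HhCarrier} (h1 : F 1 = G 1) (h2 : F tau = G tau) : F = G :=
  LinearMap.ext fun z => by rw [hh_apply, hh_apply G, h1, h2]

theorem hhMk_one (p q : QRing) : hhMk p q 1 = p := by
  simp [hhMk, QuadraticAlgebra.re_one, QuadraticAlgebra.im_one]

theorem hhMk_tau (p q : QRing) : hhMk p q tau = q := by
  simp [hhMk, tau]

theorem one_mem_tauGr : (1 : TauRing) ∈ tauGr 0 := by
  intro k h
  simp only [QuadraticAlgebra.re_one, QuadraticAlgebra.im_one, Polynomial.coeff_one,
    Polynomial.coeff_zero, ne_eq, not_true_eq_false, or_false, ite_eq_right_iff,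
    Classical.not_imp] at h
  rw [h.1]
  rfl

theorem tau_mem_tauGr : tau ∈ tauGr 0 := by
  have := tau_mul_mem_tauGr 0 1 one_mem_tauGr
  rwa [mul_one, Prod.mk_zero_zero, add_zero] at this

theorem smul_mem_qGr {n : ℤ × ℤ} {p : QRing} (hp : p ∈ qGr n) (k : ℕ) (c : Base)
    (hc : ∀ l, c.coeff l ≠ 0 → l = k) : c • p ∈ qGr (n + (0, -2 * (k : ℤ))) := by
  intro a m h
  rw [Polynomial.coeff_smul, smul_eq_mul, Polynomial.coeff_mul] at h
  obtain ⟨⟨i, j⟩, hij, h⟩ := Finset.exists_ne_zero_of_sum_ne_zero h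
  replace hij := Finset.HasAntidiagonal.mem_antidiagonal.1 hij
  have h1 := hc i (left_ne_zero_of_mul h)
  have h2 := hp a j (right_ne_zero_of_mul h)
  rw [← h2]
  simp only at hij
  subst h1
  ext
  · simp
  · simp only [Prod.snd_add]
    omega

theorem mem_hhGr_iff (n : ℤ × ℤ) (F : HhCarrier) :
    F ∈ hhGr n ↔ F 1 ∈ qGr n ∧ F tau ∈ qGr n := by
  constructor
  · intro h
    have h1 := h 0 1 one_mem_tauGr
    have h2 := h 0 tau tau_mem_tauGr
    rw [zero_add] at h1 h2
    exact ⟨h1, h2⟩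
  · rintro ⟨h1, h2⟩ m z hz
    rw [hh_apply]
    by_cases hz0 : z = 0
    · simp only [hz0, QuadraticAlgebra.re_zero, QuadraticAlgebra.im_zero, zero_smul, add_zero]
      exact zero_mem _
    · obtain ⟨k, hk⟩ : ∃ k : ℕ, (0, -2 * (k : ℤ)) = m := by
        by_contra hne
        push Not at hne
        apply hz0
        ext k
        · by_contra h'; exact hne k (hz k (Or.inl h'))
        · by_contra h'; exact hne k (hz k (Or.inr h'))
      have hzk : ∀ l, (z.re.coeff l ≠ 0 ∨ z.im.coeff l ≠ 0) → l = k := by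
        intro l hl
        have := congrArg Prod.snd ((hz l hl).trans hk.symm)
        simp only at this
        omega
      rw [add_comm m, ← hk]
      exact add_mem (smul_mem_qGr h1 k _ fun l hl => hzk l (Or.inl hl))
        (smul_mem_qGr h2 k _ fun l hl => hzk l (Or.inr hl))

theorem hhGr_isInternal : DirectSum.IsInternal hhGr := by
  refine isInternal_of_proj hhGr (fun n =>
    { toFun := fun F => hhMk (qProj n (F 1)) (qProj n (F tau))
      map_zero' := by apply hh_ext <;> simp [hhMk_one, hhMk_tau]
      map_add' := fun F G => by apply hh_ext <;> simp [hhMk_one, hhMk_tau] }) ?_ ?_ ?_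
  · intro n F hF
    rw [mem_hhGr_iff] at hF
    apply hh_ext
    · simp [hhMk_one, qProj_of_mem hF.1]
    · simp [hhMk_tau, qProj_of_mem hF.2]
  · intro n m F hF hne
    rw [mem_hhGr_iff] at hF
    apply hh_ext
    · simp [hhMk_one, qProj_of_ne hF.1 hne]
    · simp [hhMk_tau, qProj_of_ne hF.2 hne]
  · intro F
    have key : ∀ p : QRing, hhMk p 0 ∈ ⨆ n, hhGr n ∧ hhMk 0 p ∈ ⨆ n, hhGr n := by
      intro p
      induction qGr_iSup p using AddSubgroup.iSup_induction' with
      | hp n p hp =>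
        constructor
        · refine AddSubgroup.mem_iSup_of_mem n ((mem_hhGr_iff _ _).2 ?_)
          rw [hhMk_one, hhMk_tau]
          exact ⟨hp, zero_mem _⟩
        · refine AddSubgroup.mem_iSup_of_mem n ((mem_hhGr_iff _ _).2 ?_)
          rw [hhMk_one, hhMk_tau]
          exact ⟨zero_mem _, hp⟩
      | h1 =>
        have : hhMk 0 0 = 0 := by apply hh_ext <;> simp [hhMk_one, hhMk_tau]
        rw [this]
        exact ⟨zero_mem _, zero_mem _⟩
      | hadd p q _ _ hp hq =>
        have h1 : hhMk (p + q) 0 = hhMk p 0 + hhMk q 0 := by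
          apply hh_ext <;> simp [hhMk_one, hhMk_tau]
        have h2 : hhMk 0 (p + q) = hhMk 0 p + hhMk 0 q := by
          apply hh_ext <;> simp [hhMk_one, hhMk_tau]
        rw [h1, h2]
        exact ⟨add_mem hp.1 hq.1, add_mem hp.2 hq.2⟩
    have : F = hhMk (F 1) 0 + hhMk 0 (F tau) := by
      apply hh_ext <;> simp [hhMk_one, hhMk_tau]
    rw [this]
    exact add_mem (key _).1 (key _).2

/-- The differential `(∂ F) x = Q F ((1 + τ) x)`. -/
def hhD : HhCarrier →ₗ[QRing] HhCarrier where
  toFun F := Q • ((1 + tau) • F)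
  map_add' F G := by rw [smul_add, smul_add]
  map_smul' q F := by rw [RingHom.id_apply, ← smul_comm q (1 + tau) F, smul_comm Q q]

theorem hhD_apply (F : HhCarrier) (x : TauRing) : hhD F x = Q * F ((1 + tau) * x) := rfl

/-- The bimodule `Hh = Hom_R(R[τ]/(τ² + 1), R[Q])` with `(∂ F) x = Q F ((1 + τ) x)`. -/
def hhBimodule : BigradedBimodule QRing Q (1, 0) TauRing tau (0, 0) where
  carrier := HhCarrier
  moduleRight := hhModuleTau
  gr := hhGr
  isInternal := hhGr_isInternal
  u_smul_mem n F hF := by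
    rw [mem_hhGr_iff] at hF ⊢
    exact ⟨u_smul_mem_qGr _ _ hF.1, u_smul_mem_qGr _ _ hF.2⟩
  a_smul_mem n F hF := by
    rw [mem_hhGr_iff] at hF ⊢
    exact ⟨Q_mul_mem_qGr _ _ hF.1, Q_mul_mem_qGr _ _ hF.2⟩
  s_smul_mem n F hF := by
    rw [Prod.mk_zero_zero, add_zero]
    rw [mem_hhGr_iff] at hF ⊢
    rw [hh_tau_smul_apply, hh_tau_smul_apply, mul_one, tau_mul_tau]
    exact ⟨hF.2, hF.1⟩
  d := hhD
  d_smul t F := by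
    apply LinearMap.ext
    intro x
    rw [hhD_apply, hh_tau_smul_apply, hh_tau_smul_apply, hhD_apply, mul_left_comm]
  d_mem n F hF := by
    rw [mem_hhGr_iff] at hF ⊢
    rw [hhD_apply, hhD_apply, mul_one, add_mul, one_mul, tau_mul_tau, map_add, map_add]
    exact ⟨Q_mul_mem_qGr _ _ (add_mem hF.1 hF.2), Q_mul_mem_qGr _ _ (add_mem hF.2 hF.1)⟩
  d_d F := by
    have h : (1 + tau) * (1 + tau) = 0 := by
      calc (1 + tau) * (1 + tau) = 1 + tau + (tau + tau * tau) := by ring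
        _ = (1 + tau) + (1 + tau) := by rw [tau_mul_tau]; ring
        _ = 0 := add_self_eq_zero (M := TauRing) (1 + tau)
    apply LinearMap.ext
    intro x
    rw [hhD_apply, hhD_apply, ← mul_assoc (1 + tau), h, zero_mul, map_zero, mul_zero, mul_zero]
    rfl

/-! ### The Koszul functors, tensor products, and the Borel construction -/

/-- The Koszul functor `Br`, on objects: tensoring over `R[τ]/(τ² + 1)` with the bimodule `Br`. -/
def Br (X : KomTau) : KomQ := tensorBimodule adjoin_tau brBimodule X

/-- The Koszul functor `Hh`, on objects: tensoring over `R[Q]` with the bimodule `Hh`. -/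
def Hh (Y : KomQ) : KomTau := tensorBimodule adjoin_Q hhBimodule Y

/-- An `R`-linear involution `t` on `M` makes `M` an `R[τ]/(τ² + 1)`-module. -/
abbrev involutionModule {M : Type} [AddCommGroup M] [Module Base M] (t : M →ₗ[Base] M)
    (ht : ∀ m, t (t m) = m) : Module TauRing M where
  smul z m := z.re • m + z.im • t m
  one_smul m := by
    change (1 : TauRing).re • m + (1 : TauRing).im • t m = m
    simp [QuadraticAlgebra.re_one, QuadraticAlgebra.im_one]
  mul_smul x y m := by
    change (x * y).re • m + (x * y).im • t m =
      x.re • (y.re • m + y.im • t m) + x.im • t (y.re • m + y.im • t m)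
    simp only [QuadraticAlgebra.re_mul, QuadraticAlgebra.im_mul, map_add, map_smul, ht, smul_add,
      smul_smul, add_smul]
    simp only [zero_mul, zero_smul, one_mul]
    abel
  smul_zero x := by
    change x.re • (0 : M) + x.im • t 0 = 0
    simp
  smul_add x m n := by
    change x.re • (m + n) + x.im • t (m + n) = x.re • m + x.im • t m + (x.re • n + x.im • t n)
    simp only [map_add, smul_add]
    abel
  add_smul x y m := by
    change (x + y).re • m + (x + y).im • t m = x.re • m + x.im • t m + (y.re • m + y.im • t m)
    simp only [QuadraticAlgebra.re_add, QuadraticAlgebra.im_add, add_smul]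
    abel
  zero_smul m := by
    change (0 : TauRing).re • m + (0 : TauRing).im • t m = 0
    simp

/-- A bigraded complex over `R` with an involution `t`, regarded as a complex over
`R[τ]/(τ² + 1)` by letting `τ` act by `t`. -/
def ofInvolution (M : Type) [AddCommGroup M] [Module Base M] (gr : ℤ × ℤ → AddSubgroup M)
    (isInternal : DirectSum.IsInternal gr)
    (u_smul_mem : ∀ n, ∀ m ∈ gr n, u • m ∈ gr (n + (0, -2)))
    (d : M →ₗ[Base] M) (d_mem : ∀ n, ∀ m ∈ gr n, d m ∈ gr (n + (1, 0)))
    (d_d : ∀ m, d (d m) = 0)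
    (t : M →ₗ[Base] M) (t_t : ∀ m, t (t m) = m) (t_mem : ∀ n, ∀ m ∈ gr n, t m ∈ gr n)
    (d_t : ∀ m, d (t m) = t (d m)) : KomTau :=
  letI : Module TauRing M := involutionModule t t_t
  { carrier := M
    tower := ⟨fun r z m => by
      change (r • z).re • m + (r • z).im • t m = r • (z.re • m + z.im • t m)
      simp [mul_smul, smul_add]⟩
    gr := gr
    isInternal := isInternal
    u_smul_mem := u_smul_mem
    s_smul_mem := fun n m hm => by
      rw [Prod.mk_zero_zero, add_zero]
      change (0 : Base) • m + (1 : Base) • t m ∈ gr n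
      rw [zero_smul, one_smul, zero_add]
      exact t_mem n m hm
    d :=
      { toFun := d
        map_add' := map_add d
        map_smul' := fun z m => by
          change d (z.re • m + z.im • t m) = z.re • d m + z.im • t (d m)
          rw [map_add, map_smul, map_smul, d_t] }
    d_mem := d_mem
    d_d := d_d }

/-- The action of `τ` on a complex over `R[τ]/(τ² + 1)`, as an `R`-linear map. -/
def KomTau.tauMap (X : KomTau) : X.carrier →ₗ[Base] X.carrier where
  toFun x := tau • x
  map_add' := smul_add tau
  map_smul' r x := by
    rw [RingHom.id_apply, ← algebraMap_smul TauRing r, ← algebraMap_smul TauRing r, smul_smul,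
      smul_smul, mul_comm]

theorem KomTau.tauMap_tauMap (X : KomTau) (x : X.carrier) : X.tauMap (X.tauMap x) = x := by
  change tau • tau • x = x
  rw [smul_smul, tau_mul_tau, one_smul]

theorem KomTau.tauMap_mem (X : KomTau) (n : ℤ × ℤ) (x : X.carrier) (hx : x ∈ X.gr n) :
    X.tauMap x ∈ X.gr n := by
  have h := X.s_smul_mem n x hx
  have e : n + ((0 : ℤ), (0 : ℤ)) = n := add_zero n
  rw [e] at h
  exact h

/-- The differential of a complex over `R[τ]/(τ² + 1)`, as an `R`-linear map. -/
def KomTau.dBase (X : KomTau) : X.carrier →ₗ[Base] X.carrier := X.d.restrictScalars Base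

theorem KomTau.dBase_tauMap (X : KomTau) (x : X.carrier) :
    X.dBase (X.tauMap x) = X.tauMap (X.dBase x) := X.d.map_smul tau x

/-- The tensor product `X₁ ⊗[R] X₂` of two complexes over `R[τ]/(τ² + 1)`, with `τ` acting
diagonally, by `τ ⊗ τ`. -/
def KomTau.tensor (X₁ X₂ : KomTau) : KomTau :=
  ofInvolution (X₁.carrier ⊗[Base] X₂.carrier) (tensorGr X₁.gr X₂.gr)
    (tensorGr_isInternal X₁.isInternal X₂.isInternal
      (mem_closure_homogeneous (δ := (0, 0)) adjoin_one X₁.u_smul_mem X₂.u_smul_mem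
        (by simp) (by simp)))
    (fun n m hm => by
      refine tensorGr_map_mem (DistribSMul.toAddMonoidHom _ u) ?_ hm
      rintro i j rfl x hx y hy
      exact tmul_mem_tensorGr (by abel) (X₁.u_smul_mem _ _ hx) hy)
    (TensorProduct.map X₁.dBase LinearMap.id + TensorProduct.map LinearMap.id X₂.dBase)
    (fun n m hm => by
      refine tensorGr_map_mem (TensorProduct.map X₁.dBase LinearMap.id +
        TensorProduct.map LinearMap.id X₂.dBase).toAddMonoidHom ?_ hm
      rintro i j rfl x hx y hy
      exact add_mem (tmul_mem_tensorGr (by abel) (X₁.d_mem _ _ hx) hy)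
        (tmul_mem_tensorGr (by abel) hx (X₂.d_mem _ _ hy)))
    (fun m => by
      induction m using TensorProduct.induction_on with
      | zero => simp
      | add x y hx hy => simp only [map_add, hx, hy, add_zero]
      | tmul x y =>
        have h1 : X₁.dBase (X₁.dBase x) = 0 := X₁.d_d x
        have h2 : X₂.dBase (X₂.dBase y) = 0 := X₂.d_d y
        simp only [LinearMap.add_apply, TensorProduct.map_tmul, LinearMap.id_apply, map_add, h1, h2,
          TensorProduct.zero_tmul, TensorProduct.tmul_zero, zero_add, add_zero]
        exact add_self_eq_zero _)
    (TensorProduct.map X₁.tauMap X₂.tauMap)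
    (fun m => by
      induction m using TensorProduct.induction_on with
      | zero => simp
      | add x y hx hy => simp only [map_add, hx, hy]
      | tmul x y => simp only [TensorProduct.map_tmul, KomTau.tauMap_tauMap])
    (fun n m hm => by
      refine tensorGr_map_mem (TensorProduct.map X₁.tauMap X₂.tauMap).toAddMonoidHom ?_ hm
      rintro i j rfl x hx y hy
      exact tmul_mem_tensorGr rfl (X₁.tauMap_mem _ _ hx) (X₂.tauMap_mem _ _ hy))
    (fun m => by
      induction m using TensorProduct.induction_on with
      | zero => simp
      | add x y hx hy => simp only [map_add, hx, hy]
      | tmul x y =>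
        simp only [LinearMap.add_apply, TensorProduct.map_tmul, LinearMap.id_apply, map_add,
          KomTau.dBase_tauMap])

/-- The tensor product of complexes over `R[Q]`: `Y₁ ⊗_Br Y₂ = Br (Hh Y₁ ⊗ Hh Y₂)`. -/
def brTensor (Y₁ Y₂ : KomQ) : KomQ := Br ((Hh Y₁).tensor (Hh Y₂))

/-- The underlying map of the Borel differential `∂_Q = ∂ + Q (1 + τ)` on `C[Q] = R[Q] ⊗[R] C`. -/
def borelD (C : KomTau) : QRing ⊗[Base] C.carrier →ₗ[QRing] QRing ⊗[Base] C.carrier :=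
  C.dBase.baseChange QRing + Q • (LinearMap.id + C.tauMap).baseChange QRing

theorem borelD_tmul (C : KomTau) (q : QRing) (x : C.carrier) :
    borelD C (q ⊗ₜ[Base] x) = q ⊗ₜ[Base] C.dBase x + (Q * q) ⊗ₜ[Base] (x + C.tauMap x) := rfl

/-- The Borel construction: the complex `C_Q = C[Q]` over `R[Q]` with `∂_Q = ∂ + Q (1 + τ)`. -/
def borel (C : KomTau) : KomQ where
  carrier := QRing ⊗[Base] C.carrier
  gr := tensorGr qGr C.gr
  isInternal := tensorGr_isInternal qGr_isInternal C.isInternal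
    (mem_closure_homogeneous (δ := (0, 0)) adjoin_one u_smul_mem_qGr C.u_smul_mem
      (by simp) (by simp))
  u_smul_mem n m hm := by
    refine tensorGr_map_mem (DistribSMul.toAddMonoidHom _ u) ?_ hm
    rintro i j rfl x hx y hy
    exact tmul_mem_tensorGr (by abel) (u_smul_mem_qGr _ _ hx) hy
  s_smul_mem n m hm := by
    refine tensorGr_map_mem (DistribSMul.toAddMonoidHom _ Q) ?_ hm
    rintro i j rfl x hx y hy
    exact tmul_mem_tensorGr (by abel) (Q_mul_mem_qGr _ _ hx) hy
  d := borelD C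
  d_mem n m hm := by
    refine tensorGr_map_mem (P := QRing ⊗[Base] C.carrier)
      ((borelD C).restrictScalars Base).toAddMonoidHom ?_ hm
    rintro i j rfl x hx y hy
    exact add_mem (tmul_mem_tensorGr (by abel) hx (C.d_mem _ _ hy))
      (tmul_mem_tensorGr (by abel) (Q_mul_mem_qGr _ _ hx) (add_mem hy (C.tauMap_mem _ _ hy)))
  d_d m := by
    induction m using TensorProduct.induction_on with
    | zero => simp
    | add x y hx hy => simp only [map_add, hx, hy, add_zero]
    | tmul q x =>
      have h1 : C.dBase (C.dBase x) = 0 := C.d_d x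
      rw [borelD_tmul, map_add, borelD_tmul, borelD_tmul, h1, map_add, map_add, C.dBase_tauMap,
        C.tauMap_tauMap, add_comm (C.tauMap x) x, add_self_eq_zero (x + C.tauMap x),
        TensorProduct.tmul_zero, TensorProduct.tmul_zero, zero_add, add_zero]
      exact add_self_eq_zero (M := QRing ⊗[Base] C.carrier) _

/-! ### Link diagrams -/

/-- The half-edges of a diagram with crossings `C` and two-valent marked points `P`: four at each
crossing and two at each marked point, in counterclockwise order. At a crossing, the half-edges
`0`, `2` belong to the under-strand and `1`, `3` to the over-strand. -/
abbrev Dart (C P : Type) : Type := C × ZMod 4 ⊕ P × ZMod 2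

/-- The preceding half-edge in the counterclockwise order around a vertex. -/
def Dart.prev {C P : Type} : Dart C P → Dart C P
  | .inl (c, i) => .inl (c, i - 1)
  | .inr (p, i) => .inr (p, i - 1)

/-- A planar diagram of an oriented link, given combinatorially: a four-valent plane graph with
crossing data. Two-valent marked points may be placed on the strands (they are needed on components
without crossings, and are irrelevant otherwise).

* `e` glues half-edges into edges.
* `o` is the orientation: `o x = 1` if the strand leaves the vertex along the half-edge `x`.
* `planar`: gluing in the faces (a face is a cycle of `x ↦ prev (e x)`, the half-edge `x` standing
  for the corner to the left of `x`) gives a closed surface in which every mod 2 cycle `z` in the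
  graph is the boundary of a union `g` of faces, so that the surface consists of spheres. -/
structure LinkDiagram where
  C : Type
  P : Type
  [fintypeC : Fintype C]
  [fintypeP : Fintype P]
  [decEqC : DecidableEq C]
  [decEqP : DecidableEq P]
  e : Dart C P → Dart C P
  e_e : ∀ x, e (e x) = x
  e_ne : ∀ x, e x ≠ x
  o : Dart C P → ZMod 2
  o_e : ∀ x, o (e x) = o x + 1
  o_crossing : ∀ c i, o (.inl (c, i + 2)) = o (.inl (c, i)) + 1
  o_point : ∀ p i, o (.inr (p, i + 1)) = o (.inr (p, i)) + 1
  planar : ∀ z : Dart C P → ZMod 2, (∀ x, z (e x) = z x) →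
    (∀ c, ∑ i : ZMod 4, z (.inl (c, i)) = 0) → (∀ p, ∑ i : ZMod 2, z (.inr (p, i)) = 0) →
    ∃ g : Dart C P → ZMod 2, (∀ x, g (Dart.prev (e x)) = g x) ∧ ∀ x, z x = g x + g (Dart.prev x)

attribute [instance] LinkDiagram.fintypeC LinkDiagram.fintypeP LinkDiagram.decEqC
  LinkDiagram.decEqP

namespace LinkDiagram

variable (D : LinkDiagram)

/-- The half-edges of the diagram. -/
abbrev Darts : Type := Dart D.C D.P

/-- The number of positive crossings. -/
def nPlus : ℕ := Nat.card {c : D.C // D.o (.inl (c, 0)) = D.o (.inl (c, 3))}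

/-- The number of negative crossings. -/
def nMinus : ℕ := Nat.card {c : D.C // D.o (.inl (c, 0)) = D.o (.inl (c, 1))}

/-- The vertices of the cube of resolutions. -/
abbrev Vertex : Type := D.C → Bool

/-- The number of `1`-resolutions. -/
def weight (v : D.Vertex) : ℕ := Nat.card {c : D.C // v c = true}

/-- The way in which the resolution `D_v` joins half-edges at the vertices of the diagram: the
`0`-resolution joins `0` with `1` and `2` with `3`, the `1`-resolution joins `0` with `3` and `1`
with `2`. -/
def res (v : D.Vertex) : D.Darts → D.Darts
  | .inl (c, i) => .inl (c, (if v c then 3 else 1) - i)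
  | .inr (p, i) => .inr (p, 1 - i)

/-- Two half-edges are joined in `D_v` along an edge, or at a vertex of the diagram. -/
def Joined (v : D.Vertex) (x y : D.Darts) : Prop := y = D.e x ∨ y = D.res v x

/-- The circles `Z(D_v)` of the resolution `D_v`. -/
def Circle (v : D.Vertex) : Type := Quot (D.Joined v)

/-- The circle of `D_v` through a half-edge. -/
def circle (v : D.Vertex) (x : D.Darts) : D.Circle v := Quot.mk _ x

/-- The number of circles of `D_v`. -/
def numCircles (v : D.Vertex) : ℕ := Nat.card (D.Circle v)

/-- The polynomial ring over `R = 𝔽[u]` with one variable for each half-edge. -/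
abbrev Poly : Type := MvPolynomial D.Darts Base

/-- The relations of the algebra of `D_v`: `x ^ 2 = u x`, and variables of half-edges on the same
circle are equal. -/
def ideal (v : D.Vertex) : Ideal D.Poly :=
  Ideal.span ({z | ∃ x, z = MvPolynomial.X x ^ 2 - MvPolynomial.C u * MvPolynomial.X x} ∪
    {z | ∃ x y, D.circle v x = D.circle v y ∧ z = MvPolynomial.X x - MvPolynomial.X y})

/-- The algebra `Kc'(D_v) = R[x_c : c ∈ Z(D_v)] / (x_c ^ 2 = u x_c)`, with the variable of a circle
written as the variable of any half-edge on it. -/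
abbrev Alg (v : D.Vertex) : Type := D.Poly ⧸ D.ideal v

open Classical in
/-- The factor in the edge map at the crossing `c` with target `D_w`: `1` for a merge (the two arcs
at `c` in `D_w` lie on one circle) and `x_β + x_γ + u` for a split (they lie on two circles `β`,
`γ`). -/
def theta (w : D.Vertex) (c : D.C) : D.Poly :=
  if D.circle w (.inl (c, 0)) = D.circle w (.inl (c, 1)) then 1
  else MvPolynomial.X (.inl (c, 0)) + MvPolynomial.X (.inl (c, 1)) + MvPolynomial.C u

theorem X_sub_X_mem {v : D.Vertex} {x y : D.Darts} (h : D.circle v x = D.circle v y) :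
    (MvPolynomial.X x - MvPolynomial.X y : D.Poly) ∈ D.ideal v :=
  Ideal.subset_span (Or.inr ⟨x, y, h, rfl⟩)

theorem sq_sub_mem (v : D.Vertex) (x : D.Darts) :
    (MvPolynomial.X x ^ 2 - MvPolynomial.C u * MvPolynomial.X x : D.Poly) ∈ D.ideal v :=
  Ideal.subset_span (Or.inl ⟨x, rfl⟩)

theorem mk_X_eq {v : D.Vertex} {x y : D.Darts} (h : D.circle v x = D.circle v y) :
    (Ideal.Quotient.mk (D.ideal v) (MvPolynomial.X x)) =
      Ideal.Quotient.mk (D.ideal v) (MvPolynomial.X y) :=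
  Ideal.Quotient.eq.2 (D.X_sub_X_mem h)

theorem mk_X_sq (v : D.Vertex) (x : D.Darts) :
    (Ideal.Quotient.mk (D.ideal v) (MvPolynomial.X x)) *
      (Ideal.Quotient.mk (D.ideal v) (MvPolynomial.X x)) =
      Ideal.Quotient.mk (D.ideal v) (MvPolynomial.C u) *
        Ideal.Quotient.mk (D.ideal v) (MvPolynomial.X x) := by
  rw [← map_mul, ← map_mul, ← pow_two]
  exact Ideal.Quotient.eq.2 (D.sq_sub_mem v x)

theorem alg_add_self {v : D.Vertex} (z : D.Alg v) : z + z = 0 := add_self_eq_zero z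

theorem circle_e (v : D.Vertex) (x : D.Darts) : D.circle v (D.e x) = D.circle v x :=
  (Quot.sound (r := D.Joined v) (Or.inl rfl)).symm

theorem circle_res (v : D.Vertex) (x : D.Darts) : D.circle v (D.res v x) = D.circle v x :=
  (Quot.sound (r := D.Joined v) (Or.inr rfl)).symm

/-- Induction principle: an equivalence relation containing the gluings contains "same circle". -/
theorem circle_rec {v : D.Vertex} {r : D.Darts → D.Darts → Prop} (hr : Equivalence r)
    (he : ∀ x, r x (D.e x)) (hres : ∀ x, r x (D.res v x)) {x y : D.Darts}
    (h : D.circle v x = D.circle v y) : r x y := by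
  have h' := Quot.eqvGen_exact h
  clear h
  induction h' with
  | rel x y h =>
    rcases h with rfl | rfl
    · exact he x
    · exact hres x
  | refl x => exact hr.refl x
  | symm x y _ ih => exact hr.symm ih
  | trans x y z _ _ ih1 ih2 =>
    exact hr.trans ih1 ih2

theorem circle_one_res {w : D.Vertex} {c : D.C} (hw : w c = true) (i : ZMod 4) :
    D.circle w (.inl (c, 3 - i)) = D.circle w (.inl (c, i)) := by
  have := D.circle_res w (.inl (c, i))
  simpa [res, hw] using this

theorem circle_zero_res {w : D.Vertex} {c : D.C} (hw : w c = false) (i : ZMod 4) :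
    D.circle w (.inl (c, 1 - i)) = D.circle w (.inl (c, i)) := by
  have := D.circle_res w (.inl (c, i))
  simpa [res, hw] using this

theorem circle_30 {w : D.Vertex} {c : D.C} (hw : w c = true) :
    D.circle w (.inl (c, 3)) = D.circle w (.inl (c, 0)) := D.circle_one_res hw 0

theorem circle_21 {w : D.Vertex} {c : D.C} (hw : w c = true) :
    D.circle w (.inl (c, 2)) = D.circle w (.inl (c, 1)) := D.circle_one_res hw 1

/-- Comparison of the circles before and after changing the resolution at a crossing. -/
theorem circle_edge {v : D.Vertex} {c : D.C} {x y : D.Darts}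
    (h : D.circle v x = D.circle v y) :
    let w := Function.update v c true
    D.circle w x = D.circle w y ∨
      ((D.circle w x = D.circle w (.inl (c, 0)) ∨ D.circle w x = D.circle w (.inl (c, 1))) ∧
       (D.circle w y = D.circle w (.inl (c, 0)) ∨ D.circle w y = D.circle w (.inl (c, 1)))) := by
  intro w
  have hw : w c = true := by simp [w]
  refine D.circle_rec (r := fun x y => D.circle w x = D.circle w y ∨
      ((D.circle w x = D.circle w (.inl (c, 0)) ∨ D.circle w x = D.circle w (.inl (c, 1))) ∧
       (D.circle w y = D.circle w (.inl (c, 0)) ∨ D.circle w y = D.circle w (.inl (c, 1)))))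
    ⟨fun x => Or.inl rfl, ?_, ?_⟩ ?_ ?_ h
  · rintro x y (h | h)
    · exact Or.inl h.symm
    · exact Or.inr h.symm
  · rintro x y z (h | h) (h' | h')
    · exact Or.inl (h.trans h')
    · rw [← h] at h'; exact Or.inr h'
    · rw [h'] at h; exact Or.inr h
    · exact Or.inr ⟨h.1, h'.2⟩
  · intro x
    exact Or.inl (D.circle_e w x).symm
  · rintro (⟨a, i⟩ | ⟨p, i⟩)
    · by_cases hac : a = c
      · subst hac
        have key : ∀ j : ZMod 4, D.circle w (.inl (a, j)) = D.circle w (.inl (a, 0)) ∨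
            D.circle w (.inl (a, j)) = D.circle w (.inl (a, 1)) := by
          intro j
          fin_cases j
          · exact Or.inl rfl
          · exact Or.inr rfl
          · exact Or.inr (D.circle_21 hw)
          · exact Or.inl (D.circle_30 hw)
        exact Or.inr ⟨key _, key _⟩
      · left
        have : D.res v (.inl (a, i)) = D.res w (.inl (a, i)) := by simp [res, w, hac]
        rw [this, D.circle_res]
    · left
      have : D.res v (.inr (p, i)) = D.res w (.inr (p, i)) := rfl
      rw [this, D.circle_res]

/-- Multiplication by the factor of an edge respects the relations. -/
theorem theta_mul_mem (v : D.Vertex) (c : D.C) {F : D.Poly} (hF : F ∈ D.ideal v) :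
    D.theta (Function.update v c true) c * F ∈ D.ideal (Function.update v c true) := by
  set w := Function.update v c true with hw
  suffices h : D.ideal v ≤ Submodule.comap (LinearMap.mulLeft D.Poly (D.theta w c)) (D.ideal w) from h hF
  refine Ideal.span_le.2 ?_
  rintro _ (⟨x, rfl⟩ | ⟨x, y, hxy, rfl⟩)
  · exact Ideal.mul_mem_left _ _ (D.sq_sub_mem w x)
  · change D.theta w c * _ ∈ D.ideal w
    by_cases hs : D.circle w (.inl (c, 0)) = D.circle w (.inl (c, 1))
    · refine Ideal.mul_mem_left _ _ (D.X_sub_X_mem ?_)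
      rcases D.circle_edge (c := c) hxy with h | ⟨h | h, h' | h'⟩ <;> rw [← hw] at *
      · exact h
      · rw [h, h']
      · rw [h, h', hs]
      · rw [h, h', hs]
      · rw [h, h']
    · rw [theta, if_neg hs]
      have hpq : ∀ z : D.Alg w, z = Ideal.Quotient.mk _ (MvPolynomial.X (.inl (c, 0))) ∨
          z = Ideal.Quotient.mk _ (MvPolynomial.X (.inl (c, 1))) →
          (Ideal.Quotient.mk _ (MvPolynomial.X (.inl (c, 0))) +
            Ideal.Quotient.mk _ (MvPolynomial.X (.inl (c, 1))) +
            Ideal.Quotient.mk (D.ideal w) (MvPolynomial.C u)) * z =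
          Ideal.Quotient.mk _ (MvPolynomial.X (.inl (c, 0))) *
            Ideal.Quotient.mk _ (MvPolynomial.X (.inl (c, 1))) := by
        rintro z (rfl | rfl)
        · rw [add_mul, add_mul, mk_X_sq]
          linear_combination D.alg_add_self (Ideal.Quotient.mk (D.ideal w) (MvPolynomial.C u) *
            Ideal.Quotient.mk _ (MvPolynomial.X (.inl (c, 0))))
        · rw [add_mul, add_mul, mk_X_sq]
          linear_combination D.alg_add_self (Ideal.Quotient.mk (D.ideal w) (MvPolynomial.C u) *
            Ideal.Quotient.mk _ (MvPolynomial.X (.inl (c, 1))))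
      rw [mul_sub]
      refine Ideal.Quotient.eq.1 ?_
      simp only [map_mul, map_add]
      rcases D.circle_edge (c := c) hxy with h | ⟨h, h'⟩ <;> rw [← hw] at *
      · rw [D.mk_X_eq h]
      · rw [hpq _ (h.imp D.mk_X_eq D.mk_X_eq), hpq _ (h'.imp D.mk_X_eq D.mk_X_eq)]

open Classical in
/-- The map `Kc'(D_v) → Kc'(D_w)` of the cube of resolutions for the edge from `v` to `w` that
changes the resolution of the crossing `c` from `0` to `1` (and `0` if there is no such edge).
For a merge it is the algebra map given by the relabeling of circles; for a split it is relabeling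
followed by multiplication by `x_β + x_γ + u`. -/
def edgeMap (v w : D.Vertex) (c : D.C) : D.Alg v →ₗ[D.Poly] D.Alg w :=
  if h : v c = false ∧ w = Function.update v c true then
    Submodule.mapQ (D.ideal v) (D.ideal w) (LinearMap.mulLeft D.Poly (D.theta w c))
      (fun F hF => by obtain ⟨_, rfl⟩ := h; exact D.theta_mul_mem v c hF)
  else 0

theorem edgeMap_mk {v w : D.Vertex} {c : D.C} (h : v c = false ∧ w = Function.update v c true)
    (F : D.Poly) : D.edgeMap v w c (Ideal.Quotient.mk _ F) =
      Ideal.Quotient.mk _ (D.theta w c * F) := by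
  rw [edgeMap, dif_pos h]
  rfl

/-- The Bar-Natan complex `Kc'(D)`: the sum over the cube of resolutions. -/
abbrev Kc : Type := (v : D.Vertex) → D.Alg v

/-- The differential of the Bar-Natan complex: the sum of the edge maps. -/
def kcD : D.Kc →ₗ[D.Poly] D.Kc :=
  LinearMap.pi fun w => ∑ v : D.Vertex, ∑ c : D.C, (D.edgeMap v w c).comp (LinearMap.proj v)

theorem kcD_apply (f : D.Kc) (w : D.Vertex) :
    D.kcD f w = ∑ v : D.Vertex, ∑ c : D.C, D.edgeMap v w c (f v) := by
  simp [kcD, LinearMap.sum_apply]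

end LinkDiagram

/-! ### The number of circles changes by one along an edge of the cube -/

theorem sameCycle_of_not_sameCycle {X : Type} [Finite X] {H : X → Prop} {a b : X}
    (σ σ' : Equiv.Perm X) (ha : H a) (hσ : ∀ x, H x → H (σ x))
    (h1 : ∀ x, H x → σ x = a → σ' x = b)
    (h3 : ∀ x, H x → σ x ≠ a → σ x ≠ b → σ' x = σ x) (h : ¬ σ.SameCycle a b) :
    σ'.SameCycle a b := by
  classical
  have hex : ∃ n : ℕ, 0 < n ∧ (σ ^ n) a = a := ⟨orderOf σ, orderOf_pos σ, by simp [pow_orderOf_eq_one]⟩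
  have hH : ∀ j : ℕ, H ((σ ^ j) a) := by
    intro j
    induction j with
    | zero => simpa using ha
    | succ j ih => rw [pow_succ', Equiv.Perm.mul_apply]; exact hσ _ ih
  obtain ⟨hn0, hn⟩ := Nat.find_spec hex
  set n := Nat.find hex with hndef
  have key : ∀ j : ℕ, j < n → (σ' ^ j) a = (σ ^ j) a := by
    intro j hj
    induction j with
    | zero => simp
    | succ j ih =>
      rw [pow_succ', Equiv.Perm.mul_apply, ih (by omega), pow_succ', Equiv.Perm.mul_apply]
      apply h3 _ (hH j)
      · intro he
        exact Nat.find_min hex hj ⟨by omega, by rw [pow_succ', Equiv.Perm.mul_apply, he]⟩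
      · intro he
        exact h ⟨(j + 1 : ℕ), by rw [zpow_natCast, pow_succ', Equiv.Perm.mul_apply, he]⟩
  obtain ⟨m, hm⟩ : ∃ m, n = m + 1 := ⟨n - 1, by omega⟩
  refine ⟨(n : ℤ), ?_⟩
  rw [zpow_natCast, hm, pow_succ', Equiv.Perm.mul_apply, key m (by omega)]
  apply h1 _ (hH m)
  rw [← Equiv.Perm.mul_apply, ← pow_succ', ← hm, hn]

theorem not_sameCycle_of_sameCycle {X : Type} [Finite X] {H : X → Prop} {a b : X} (hab : a ≠ b)
    (σ σ' : Equiv.Perm X) (ha : H a) (hσ : ∀ x, H x → H (σ x))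
    (h2 : ∀ x, H x → σ x = b → σ' x = a)
    (h3 : ∀ x, H x → σ x ≠ a → σ x ≠ b → σ' x = σ x) (h : σ.SameCycle a b) :
    ¬ σ'.SameCycle a b := by
  classical
  have hex : ∃ n : ℕ, (σ ^ n) a = b := by
    obtain ⟨i, -, hi⟩ := h.exists_pow_eq'
    exact ⟨i, hi⟩
  have hH : ∀ j : ℕ, H ((σ ^ j) a) := by
    intro j
    induction j with
    | zero => simpa using ha
    | succ j ih => rw [pow_succ', Equiv.Perm.mul_apply]; exact hσ _ ih
  have hn := Nat.find_spec hex
  set n := Nat.find hex with hndef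
  have key : ∀ j : ℕ, j < n → (σ' ^ j) a = (σ ^ j) a := by
    intro j hj
    induction j with
    | zero => simp
    | succ j ih =>
      rw [pow_succ', Equiv.Perm.mul_apply, ih (by omega), pow_succ', Equiv.Perm.mul_apply]
      apply h3 _ (hH j)
      · intro he
        refine Nat.find_min hex (m := n - (j + 1)) (by omega) ?_
        have h4 : (σ ^ (j + 1)) a = a := by rw [pow_succ', Equiv.Perm.mul_apply, he]
        have h5 : n = n - (j + 1) + (j + 1) := by omega
        conv_rhs => rw [← hn, h5, pow_add, Equiv.Perm.mul_apply, h4]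
      · intro he
        exact Nat.find_min hex hj (by rw [pow_succ', Equiv.Perm.mul_apply, he])
  have hn0 : n ≠ 0 := by
    intro h0
    rw [h0] at hn
    exact hab (by simpa using hn)
  obtain ⟨m, hm⟩ : ∃ m, n = m + 1 := ⟨n - 1, by omega⟩
  have hper : (σ' ^ n) a = a := by
    rw [hm, pow_succ', Equiv.Perm.mul_apply, key m (by omega)]
    apply h2 _ (hH m)
    rw [← Equiv.Perm.mul_apply, ← pow_succ', ← hm, hn]
  intro h'
  obtain ⟨k, -, hk⟩ := h'.exists_pow_eq'
  have hmul : ∀ q : ℕ, (σ' ^ (n * q)) a = a := by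
    intro q
    induction q with
    | zero => simp
    | succ q ih => rw [Nat.mul_succ, pow_add, Equiv.Perm.mul_apply, hper, ih]
  have h6 : (σ' ^ (k % n)) a = b := by
    rw [← hk]
    conv_rhs => rw [← Nat.mod_add_div k n, pow_add, Equiv.Perm.mul_apply, hmul]
  have hlt := Nat.mod_lt k (Nat.pos_of_ne_zero hn0)
  rw [key _ hlt] at h6
  exact Nat.find_min hex hlt h6

/-- Identifying two points of a quotient lowers the number of classes by one, unless they are
already identified. -/
theorem card_quot_identify {X : Type} [Finite X] {r r' : X → X → Prop} {a b : X}
    (h1 : ∀ x y, r x y → Quot.mk r' x = Quot.mk r' y) (h2 : Quot.mk r' a = Quot.mk r' b)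
    (h3 : ∀ x y, r' x y → Quot.mk r x = Quot.mk r y ∨
      ((Quot.mk r x = Quot.mk r a ∨ Quot.mk r x = Quot.mk r b) ∧
       (Quot.mk r y = Quot.mk r a ∨ Quot.mk r y = Quot.mk r b))) :
    (Quot.mk r a = Quot.mk r b → Nat.card (Quot r) = Nat.card (Quot r')) ∧
    (Quot.mk r a ≠ Quot.mk r b → Nat.card (Quot r) = Nat.card (Quot r') + 1) := by
  classical
  have := Fintype.ofFinite (Quot r)
  let p : Quot r → Quot r' := Quot.lift (Quot.mk r') h1
  constructor
  · intro hab
    refine Nat.card_congr ⟨p, Quot.lift (Quot.mk r) ?_, ?_, ?_⟩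
    · intro x y hxy
      rcases h3 x y hxy with h | ⟨h | h, h' | h'⟩
      · exact h
      all_goals simp [h, h', hab]
    · rintro ⟨x⟩; rfl
    · rintro ⟨x⟩; rfl
  · intro hab
    let q : Quot r → {z : Quot r // z ≠ Quot.mk r b} := fun z =>
      if h : z = Quot.mk r b then ⟨Quot.mk r a, hab⟩ else ⟨z, h⟩
    have hqb : q (Quot.mk r b) = ⟨Quot.mk r a, hab⟩ := by simp [q]
    have hqa : q (Quot.mk r a) = ⟨Quot.mk r a, hab⟩ := by simp [q, hab]
    have e : Quot r' ≃ {z : Quot r // z ≠ Quot.mk r b} :=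
      { toFun := Quot.lift (fun x => q (Quot.mk r x)) (by
          intro x y hxy
          rcases h3 x y hxy with h | ⟨h | h, h' | h'⟩
          · rw [h]
          all_goals simp only [h, h', hqa, hqb])
        invFun := fun z => p z.1
        left_inv := by
          rintro ⟨x⟩
          change p (q (Quot.mk r x)).1 = Quot.mk r' x
          by_cases h : Quot.mk r x = Quot.mk r b
          · rw [h, hqb]
            change Quot.mk r' a = _
            rw [h2]
            exact (congrArg p h).symm
          · simp only [q, dif_neg h]
            rfl
        right_inv := by
          rintro ⟨⟨x⟩, hx⟩
          change q (Quot.mk r x) = _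
          exact dif_neg hx }
    rw [Nat.card_congr e, Nat.card_eq_fintype_card, Nat.card_eq_fintype_card,
      Fintype.card_subtype_compl, Fintype.card_subtype_eq]
    have : 0 < Fintype.card (Quot r) := Fintype.card_pos_iff.2 ⟨Quot.mk r a⟩
    omega

namespace LinkDiagram

variable (D : LinkDiagram)

theorem res_res (v : D.Vertex) (x : D.Darts) : D.res v (D.res v x) = x := by
  rcases x with ⟨c, i⟩ | ⟨p, i⟩ <;> simp [res]

/-- The permutation whose cycles are the oriented circles of `D_v`. -/
def walk (v : D.Vertex) : Equiv.Perm D.Darts where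
  toFun x := D.res v (D.e x)
  invFun x := D.e (D.res v x)
  left_inv x := by simp only [res_res, D.e_e]
  right_inv x := by simp only [D.e_e, res_res]

theorem walk_apply (v : D.Vertex) (x : D.Darts) : D.walk v x = D.res v (D.e x) := rfl

theorem walk_inv_apply (v : D.Vertex) (x : D.Darts) : (D.walk v)⁻¹ x = D.e (D.res v x) := rfl

theorem sameCycle_e {v : D.Vertex} {x y : D.Darts} (h : (D.walk v).SameCycle x y) :
    (D.walk v).SameCycle (D.e x) (D.e y) := by
  obtain ⟨i, hi⟩ := h
  refine ⟨-i, ?_⟩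
  have key : ∀ (n : ℕ) (z : D.Darts), ((D.walk v)⁻¹ ^ n) (D.e z) = D.e ((D.walk v ^ n) z) := by
    intro n
    induction n with
    | zero => intro z; simp
    | succ n ih =>
      intro z
      rw [pow_succ', Equiv.Perm.mul_apply, ih, pow_succ', Equiv.Perm.mul_apply, walk_inv_apply,
        walk_apply]
  obtain ⟨n, rfl | rfl⟩ := i.eq_nat_or_neg
  · rw [zpow_neg, ← inv_zpow, zpow_natCast, key]
    rw [zpow_natCast] at hi
    rw [hi]
  · rw [neg_neg, zpow_natCast]
    rw [zpow_neg, zpow_natCast] at hi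
    have hi' : x = (D.walk v ^ n) y := by rw [← hi]; simp
    rw [hi', ← key, inv_pow]
    simp

theorem circle_eq_of_sameCycle {v : D.Vertex} {x y : D.Darts} (h : (D.walk v).SameCycle x y) :
    D.circle v x = D.circle v y := by
  obtain ⟨i, -, hi⟩ := h.exists_pow_eq'
  rw [← hi]
  clear hi
  induction i with
  | zero => rfl
  | succ i ih =>
    rw [pow_succ', Equiv.Perm.mul_apply, walk_apply, D.circle_res, D.circle_e, ih]

/-- A checkerboard colouring. -/
theorem exists_colouring : ∃ g : D.Darts → ZMod 2, (∀ x, g (D.e x) = g x + 1) ∧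
    ∀ v x, g (D.res v x) = g x + 1 := by
  obtain ⟨g, hg1, hg2⟩ := D.planar (fun _ => 1) (fun _ => rfl)
    (fun _ => by decide) (fun _ => by decide)
  have flip : ∀ a b : ZMod 2, 1 = a + b → b = a + 1 := by decide
  have flip' : ∀ a b : ZMod 2, 1 = a + b → a = b + 1 := by decide
  have hC : ∀ c (i : ZMod 4), g (.inl (c, i - 1)) = g (.inl (c, i)) + 1 := by
    intro c i
    exact flip _ _ (hg2 (.inl (c, i)))
  have hP : ∀ p (i : ZMod 2), g (.inr (p, i - 1)) = g (.inr (p, i)) + 1 := by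
    intro p i
    exact flip _ _ (hg2 (.inr (p, i)))
  have two : ∀ a : ZMod 2, a + 1 + 1 = a := by decide
  refine ⟨g, fun x => ?_, ?_⟩
  · have h1 := hg1 x
    have h2 := hg2 (D.e x)
    rw [h1] at h2
    exact flip' _ _ h2
  · rintro v (⟨c, i⟩ | ⟨p, i⟩)
    · have h0 := hC c 0
      have h1 := hC c 1
      have h2 := hC c 2
      have h3 := hC c 3
      have e0 : (0 : ZMod 4) - 1 = 3 := by decide
      have e1 : (1 : ZMod 4) - 1 = 0 := by decide
      have e2 : (2 : ZMod 4) - 1 = 1 := by decide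
      have e3 : (3 : ZMod 4) - 1 = 2 := by decide
      rw [e0] at h0
      rw [e1] at h1
      rw [e2] at h2
      rw [e3] at h3
      have E : ∀ k : ZMod 4, k = 1 ∨ k = 3 → ∀ i : ZMod 4,
          g (.inl (c, k - i)) = g (.inl (c, i)) + 1 := by
        have s0 : (3 : ZMod 4) - 0 = 3 := by decide
        have s1 : (3 : ZMod 4) - 1 = 2 := by decide
        have s2 : (3 : ZMod 4) - 2 = 1 := by decide
        have s3 : (3 : ZMod 4) - 3 = 0 := by decide
        have t0 : (1 : ZMod 4) - 0 = 1 := by decide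
        have t1 : (1 : ZMod 4) - 1 = 0 := by decide
        have t2 : (1 : ZMod 4) - 2 = 3 := by decide
        have t3 : (1 : ZMod 4) - 3 = 2 := by decide
        have all : ∀ i : ZMod 4, i = 0 ∨ i = 1 ∨ i = 2 ∨ i = 3 := by decide
        rintro k (rfl | rfl) i <;> rcases all i with rfl | rfl | rfl | rfl
        · rw [t0, h1, two]
        · rw [t1, h1]
        · rw [t2, h0, h1, h2, two]
        · rw [t3, h3]
        · rw [s0, h0]
        · rw [s1, h2, two]
        · rw [s2, h2]
        · rw [s3, h0, two]
      simp only [res]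
      split_ifs
      · exact E 3 (Or.inr rfl) i
      · exact E 1 (Or.inl rfl) i
    · simp only [res]
      rw [← hP]
      congr 3
      revert i
      decide

theorem res_false {v : D.Vertex} {c : D.C} (h : v c = false) (i : ZMod 4) :
    D.res v (.inl (c, i)) = .inl (c, 1 - i) := by
  simp only [res, h]
  rfl

theorem res_true {v : D.Vertex} {c : D.C} (h : v c = true) (i : ZMod 4) :
    D.res v (.inl (c, i)) = .inl (c, 3 - i) := by
  simp only [res, h]
  rfl

theorem sameCycle_of_circle_eq {v : D.Vertex} {x y : D.Darts} (h : D.circle v x = D.circle v y) :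
    (D.walk v).SameCycle x y ∨ (D.walk v).SameCycle x (D.e y) := by
  have ee : ∀ {x y : D.Darts}, (D.walk v).SameCycle x (D.e y) → (D.walk v).SameCycle (D.e x) y := by
    intro x y h
    have := D.sameCycle_e h
    rwa [D.e_e] at this
  have ee' : ∀ {x y : D.Darts}, (D.walk v).SameCycle (D.e x) y → (D.walk v).SameCycle x (D.e y) := by
    intro x y h
    have := D.sameCycle_e h
    rwa [D.e_e] at this
  refine D.circle_rec (r := fun x y => (D.walk v).SameCycle x y ∨ (D.walk v).SameCycle x (D.e y))
    ⟨fun x => Or.inl (Equiv.Perm.SameCycle.refl _ _), ?_, ?_⟩ ?_ ?_ h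
  · rintro x y (h | h)
    · exact Or.inl h.symm
    · exact Or.inr (ee h).symm
  · rintro x y z (h | h) (h' | h')
    · exact Or.inl (h.trans h')
    · exact Or.inr (h.trans h')
    · exact Or.inr (h.trans (D.sameCycle_e h'))
    · exact Or.inl (h.trans (ee h'))
  · intro x
    right
    rw [D.e_e]
  · intro x
    right
    rw [← walk_inv_apply]
    exact ⟨-1, by rw [zpow_neg_one]⟩

/-- Changing the resolution at a crossing joins or separates two opposite half-edges. -/
theorem circle_flip {v : D.Vertex} {c : D.C} (hv : v c = false) :
    (D.circle v (.inl (c, 0)) = D.circle v (.inl (c, 2)) ↔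
      ¬ D.circle (Function.update v c true) (.inl (c, 0)) =
        D.circle (Function.update v c true) (.inl (c, 2))) := by
  set w := Function.update v c true with hw
  have hwc : w c = true := by simp [w]
  obtain ⟨g, ge, gres⟩ := D.exists_colouring
  have two : ∀ a : ZMod 2, a + 1 + 1 = a := by decide
  have ne1 : ∀ a : ZMod 2, a ≠ a + 1 := by decide
  have gwalk : ∀ v' x, g (D.walk v' x) = g x := by
    intro v' x
    rw [walk_apply, gres, ge, two]
  have g02 : g (.inl (c, 2)) = g (.inl (c, 0)) := by
    have h1 := gres v (.inl (c, 3))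
    have h2 := gres w (.inl (c, 3))
    rw [D.res_false hv] at h1
    rw [D.res_true hwc] at h2
    change g (.inl (c, 2)) = _ at h1
    change g (.inl (c, 0)) = _ at h2
    rw [h1, h2]
  have gsame : ∀ {v' x y}, (D.walk v').SameCycle x y → g y = g x := by
    intro v' x y h
    obtain ⟨i, -, rfl⟩ := h.exists_pow_eq'
    clear h
    induction i with
    | zero => rfl
    | succ i ih => rw [pow_succ', Equiv.Perm.mul_apply, gwalk, ih]
  have key : ∀ v' : D.Vertex, D.circle v' (.inl (c, 0)) = D.circle v' (.inl (c, 2)) ↔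
      (D.walk v').SameCycle (.inl (c, 0)) (.inl (c, 2)) := by
    intro v'
    refine ⟨fun h => ?_, D.circle_eq_of_sameCycle⟩
    rcases D.sameCycle_of_circle_eq h with h | h
    · exact h
    · have := gsame h
      rw [ge, g02] at this
      exact absurd this.symm (ne1 _)
  rw [key, key]
  have g1 : g (.inl (c, 1)) = g (.inl (c, 0)) + 1 := by
    have := gres v (.inl (c, 0))
    rwa [D.res_false hv] at this
  have g3 : g (.inl (c, 3)) = g (.inl (c, 0)) + 1 := by
    have := gres w (.inl (c, 0))
    rwa [D.res_true hwc] at this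
  have hdiff : ∀ x, D.res v x ≠ .inl (c, 0) → D.res v x ≠ .inl (c, 2) →
      g (D.res v x) = g (.inl (c, 0)) → D.res w x = D.res v x := by
    rintro (⟨b, i⟩ | ⟨p, i⟩) h0 h2 hg
    · by_cases hbc : b = c
      · subst hbc
        exfalso
        rw [D.res_false hv] at h0 h2 hg
        generalize (1 : ZMod 4) - i = j at h0 h2 hg
        have all : ∀ i : ZMod 4, i = 0 ∨ i = 1 ∨ i = 2 ∨ i = 3 := by decide
        rcases all j with rfl | rfl | rfl | rfl
        · exact h0 rfl
        · rw [g1] at hg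
          exact ne1 _ hg.symm
        · exact h2 rfl
        · rw [g3] at hg
          exact ne1 _ hg.symm
      · simp [res, w, hbc]
    · rfl
  have hto : ∀ x, D.res v x = .inl (c, 0) → D.res w x = .inl (c, 2) := by
    intro x hx
    rw [← D.res_res v x, hx, D.res_false hv, D.res_true hwc]
    rfl
  have hto' : ∀ x, D.res v x = .inl (c, 2) → D.res w x = .inl (c, 0) := by
    intro x hx
    rw [← D.res_res v x, hx, D.res_false hv, D.res_true hwc]
    rfl
  have h02 : (Sum.inl (c, 0) : D.Darts) ≠ .inl (c, 2) := by
    intro h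
    have : (0 : ZMod 4) = 2 := congrArg Prod.snd (Sum.inl.inj h)
    exact absurd this (by decide)
  have h3 : ∀ x, g x = g (.inl (c, 0)) → D.walk v x ≠ .inl (c, 0) → D.walk v x ≠ .inl (c, 2) →
      D.walk w x = D.walk v x := by
    intro x hx h0 h2
    refine hdiff (D.e x) h0 h2 ?_
    rw [gres, ge, two, hx]
  constructor
  · exact not_sameCycle_of_sameCycle h02 (D.walk v) (D.walk w) (H := fun x => g x = g (.inl (c, 0)))
      rfl (fun x hx => by rw [gwalk, hx]) (fun x _ => hto' _) h3
  · intro h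
    by_contra h'
    exact h (sameCycle_of_not_sameCycle (D.walk v) (D.walk w)
      (H := fun x => g x = g (.inl (c, 0)))
      rfl (fun x hx => by rw [gwalk, hx]) (fun x _ => hto _) h3 h')

/-- Along an edge of the cube, two circles merge into one or one circle splits into two. -/
theorem numCircles_edge {v : D.Vertex} {c : D.C} (hv : v c = false) :
    let w := Function.update v c true
    (D.circle w (.inl (c, 0)) = D.circle w (.inl (c, 1)) → D.numCircles v = D.numCircles w + 1) ∧
    (D.circle w (.inl (c, 0)) ≠ D.circle w (.inl (c, 1)) → D.numCircles w = D.numCircles v + 1) := by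
  intro w
  have hw : w c = true := by simp [w]
  have hflip := D.circle_flip hv
  change _ ↔ ¬ D.circle w _ = D.circle w _ at hflip
  rw [D.circle_21 hw] at hflip
  let J : D.Darts → D.Darts → Prop := fun x y =>
    D.Joined v x y ∨ D.Joined w x y ∨ (x = .inl (c, 0) ∧ y = .inl (c, 2))
  have hJ02 : Quot.mk J (.inl (c, 0)) = Quot.mk J (.inl (c, 2)) :=
    Quot.sound (Or.inr (Or.inr ⟨rfl, rfl⟩))
  have off : ∀ x, D.res v x = D.res w x ∨ ∃ i, x = .inl (c, i) := by
    rintro (⟨b, i⟩ | ⟨p, i⟩)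
    · by_cases hbc : b = c
      · subst hbc
        exact Or.inr ⟨i, rfl⟩
      · left
        simp [res, w, hbc]
    · exact Or.inl rfl
  have all : ∀ i : ZMod 4, i = 0 ∨ i = 1 ∨ i = 2 ∨ i = 3 := by decide
  have Cv : ∀ i, D.circle v (.inl (c, i)) = D.circle v (.inl (c, 0)) ∨
      D.circle v (.inl (c, i)) = D.circle v (.inl (c, 2)) := by
    intro i
    rcases all i with rfl | rfl | rfl | rfl
    · exact Or.inl rfl
    · exact Or.inl (D.circle_zero_res hv 0)
    · exact Or.inr rfl
    · exact Or.inr (D.circle_zero_res hv 2)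
  have Cw : ∀ i, D.circle w (.inl (c, i)) = D.circle w (.inl (c, 0)) ∨
      D.circle w (.inl (c, i)) = D.circle w (.inl (c, 2)) := by
    intro i
    rcases all i with rfl | rfl | rfl | rfl
    · exact Or.inl rfl
    · exact Or.inr (D.circle_21 hw).symm
    · exact Or.inr rfl
    · exact Or.inl (D.circle_30 hw)
  have sv := card_quot_identify (r := D.Joined v) (r' := J) (a := .inl (c, 0)) (b := .inl (c, 2))
    (fun x y h => Quot.sound (Or.inl h)) hJ02 (by
      rintro x y (h | (rfl | rfl) | ⟨rfl, rfl⟩)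
      · exact Or.inl (Quot.sound h)
      · exact Or.inl (D.circle_e v x).symm
      · rcases off x with h | ⟨i, rfl⟩
        · rw [← h]
          exact Or.inl (D.circle_res v x).symm
        · exact Or.inr ⟨Cv _, Cv _⟩
      · exact Or.inr ⟨Or.inl rfl, Or.inr rfl⟩)
  have sw := card_quot_identify (r := D.Joined w) (r' := J) (a := .inl (c, 0)) (b := .inl (c, 2))
    (fun x y h => Quot.sound (Or.inr (Or.inl h))) hJ02 (by
      rintro x y ((rfl | rfl) | h | ⟨rfl, rfl⟩)
      · exact Or.inl (D.circle_e w x).symm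
      · rcases off x with h | ⟨i, rfl⟩
        · rw [h]
          exact Or.inl (D.circle_res w x).symm
        · exact Or.inr ⟨Cw _, Cw _⟩
      · exact Or.inl (Quot.sound h)
      · exact Or.inr ⟨Or.inl rfl, Or.inr rfl⟩)
  change (D.circle v _ = D.circle v _ → D.numCircles v = _) ∧
    (D.circle v _ ≠ D.circle v _ → D.numCircles v = _) at sv
  change (D.circle w _ = D.circle w _ → D.numCircles w = _) ∧
    (D.circle w _ ≠ D.circle w _ → D.numCircles w = _) at sw
  rw [D.circle_21 hw] at sw
  constructor
  · intro h
    rw [sw.1 h, sv.2 (fun h' => hflip.1 h' h)]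
  · intro h
    rw [sw.2 h, sv.1 (hflip.2 h)]

end LinkDiagram

/-! ### The Bar-Natan complex is a complex -/

namespace LinkDiagram

variable (D : LinkDiagram)

theorem theta_pos {w : D.Vertex} {c : D.C}
    (h : D.circle w (.inl (c, 0)) = D.circle w (.inl (c, 1))) : D.theta w c = 1 := if_pos h

theorem theta_neg {w : D.Vertex} {c : D.C}
    (h : ¬ D.circle w (.inl (c, 0)) = D.circle w (.inl (c, 1))) : D.theta w c =
      MvPolynomial.X (.inl (c, 0)) + MvPolynomial.X (.inl (c, 1)) + MvPolynomial.C u := if_neg h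

/-- The square of the cube at two different crossings commutes. -/
theorem theta_square {v : D.Vertex} {c c' : D.C} (hne : c ≠ c') (hc : v c = false)
    (hc' : v c' = false) (F : D.Poly) :
    let w := Function.update v c true
    let w' := Function.update v c' true
    let z := Function.update w c' true
    Ideal.Quotient.mk (D.ideal z) (D.theta z c' * (D.theta w c * F)) =
      Ideal.Quotient.mk (D.ideal z) (D.theta z c * (D.theta w' c' * F)) := by
  intro w w' z
  have hz : z = Function.update w' c true := Function.update_comm hne _ _ _
  have hwc' : w c' = false := by simp [w, hne.symm, hc']
  have hwc : w' c = false := by simp [w', hne, hc]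
  have n1 := D.numCircles_edge hc
  have n2 := D.numCircles_edge hc'
  have n3 := D.numCircles_edge hwc'
  have n4 := D.numCircles_edge hwc
  rw [← hz] at n4
  change (D.circle w _ = D.circle w _ → D.numCircles v = D.numCircles w + 1) ∧
    (D.circle w _ ≠ D.circle w _ → D.numCircles w = D.numCircles v + 1) at n1
  change (D.circle w' _ = D.circle w' _ → D.numCircles v = D.numCircles w' + 1) ∧
    (D.circle w' _ ≠ D.circle w' _ → D.numCircles w' = D.numCircles v + 1) at n2
  change (D.circle z _ = D.circle z _ → D.numCircles w = D.numCircles z + 1) ∧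
    (D.circle z _ ≠ D.circle z _ → D.numCircles z = D.numCircles w + 1) at n3
  change (D.circle z _ = D.circle z _ → D.numCircles w' = D.numCircles z + 1) ∧
    (D.circle z _ ≠ D.circle z _ → D.numCircles z = D.numCircles w' + 1) at n4
  simp only [map_mul]
  by_cases A1 : D.circle w (.inl (c, 0)) = D.circle w (.inl (c, 1)) <;>
  by_cases B2 : D.circle z (.inl (c, 0)) = D.circle z (.inl (c, 1)) <;>
  by_cases A2 : D.circle z (.inl (c', 0)) = D.circle z (.inl (c', 1)) <;>
  by_cases B1 : D.circle w' (.inl (c', 0)) = D.circle w' (.inl (c', 1)) <;>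
  first
  | (exfalso
     have m1 := n1.1
     have m1' := n1.2
     have m2 := n2.1
     have m2' := n2.2
     have m3 := n3.1
     have m3' := n3.2
     have m4 := n4.1
     have m4' := n4.2
     simp only [A1, A2, B1, B2, ne_eq, not_true_eq_false, not_false_eq_true, forall_const,
       false_implies] at m1 m1' m2 m2' m3 m3' m4 m4'
     omega)
  | ((first | rw [D.theta_pos A1] | rw [D.theta_neg A1])
     (first | rw [D.theta_pos A2] | rw [D.theta_neg A2])
     (first | rw [D.theta_pos B1] | rw [D.theta_neg B1])
     (first | rw [D.theta_pos B2] | rw [D.theta_neg B2])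
     done)
  | ((first | rw [D.theta_pos A1] | rw [D.theta_neg A1])
     (first | rw [D.theta_pos A2] | rw [D.theta_neg A2])
     (first | rw [D.theta_pos B1] | rw [D.theta_neg B1])
     (first | rw [D.theta_pos B2] | rw [D.theta_neg B2])
     ring
     done)
  | skip
  · have hedge := D.circle_edge (c := c') A1
    change D.circle z _ = D.circle z _ ∨ (D.circle z _ = D.circle z _ ∨ D.circle z _ = D.circle z _) ∧
      (D.circle z _ = D.circle z _ ∨ D.circle z _ = D.circle z _) at hedge
    simp only [D.theta_pos A1, D.theta_neg A2, D.theta_pos B1, D.theta_neg B2, map_one, one_mul, map_add]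
    rcases hedge with h | ⟨h | h, h' | h'⟩
    · exact absurd h B2
    · exact absurd (h.trans h'.symm) B2
    · rw [D.mk_X_eq h, D.mk_X_eq h']
    · rw [D.mk_X_eq h, D.mk_X_eq h']
      ring
    · exact absurd (h.trans h'.symm) B2
  · simp only [D.theta_neg A1, D.theta_pos A2, D.theta_neg B1, D.theta_pos B2, map_one, one_mul, map_add]
    rw [D.mk_X_eq A2, D.mk_X_eq B2, alg_add_self, alg_add_self]

theorem kcD_kcD (f : D.Kc) : D.kcD (D.kcD f) = 0 := by
  funext z
  rw [kcD_apply]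
  simp only [kcD_apply, map_sum]
  have key : ∀ (v : D.Vertex), ∑ w : D.Vertex, ∑ c' : D.C, ∑ c : D.C,
      D.edgeMap w z c' (D.edgeMap v w c (f v)) = 0 := by
    intro v
    obtain ⟨F, hF⟩ := Ideal.Quotient.mk_surjective (f v)
    rw [← hF]
    let T : D.C × D.C → D.Alg z := fun p =>
      D.edgeMap (Function.update v p.2 true) z p.1 (D.edgeMap v (Function.update v p.2 true) p.2
        (Ideal.Quotient.mk _ F))
    have e1 : ∀ c' c : D.C, ∑ w : D.Vertex,
        D.edgeMap w z c' (D.edgeMap v w c (Ideal.Quotient.mk _ F)) = T (c', c) := by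
      intro c' c
      refine Finset.sum_eq_single (Function.update v c true) ?_ (by simp)
      intro w _ hw
      have : D.edgeMap v w c = 0 := dif_neg (fun h => hw h.2)
      rw [this, LinearMap.zero_apply, map_zero]
    have hT : ∀ c' c, ¬ (c ≠ c' ∧ v c = false ∧ v c' = false ∧
        z = Function.update (Function.update v c true) c' true) → T (c', c) = 0 := by
      intro c' c h
      by_cases hc : v c = false
      · have : D.edgeMap (Function.update v c true) z c' = 0 := by
          refine dif_neg fun h' => h ?_
          have hne : c ≠ c' := by
            rintro rfl
            simpa using h'.1
          refine ⟨hne, hc, ?_, h'.2⟩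
          simpa [hne.symm] using h'.1
        simp only [T, this, LinearMap.zero_apply]
      · have : D.edgeMap v (Function.update v c true) c = 0 := dif_neg (fun h => hc h.1)
        simp only [T, this, LinearMap.zero_apply, map_zero]
    have hsymm : ∀ c' c, T (c', c) = T (c, c') := by
      intro c' c
      by_cases h : c ≠ c' ∧ v c = false ∧ v c' = false ∧
        z = Function.update (Function.update v c true) c' true
      · obtain ⟨hne, hc, hc', rfl⟩ := h
        simp only [T]
        rw [D.edgeMap_mk ⟨hc, rfl⟩, D.edgeMap_mk ⟨hc', rfl⟩,
          D.edgeMap_mk ⟨by simp [hne.symm, hc'], rfl⟩,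
          D.edgeMap_mk (c := c) ⟨by simp [hne, hc], Function.update_comm hne _ _ _⟩]
        exact D.theta_square hne hc hc' F
      · rw [hT _ _ h, hT c c']
        rintro ⟨h1, h2, h3, h4⟩
        exact h ⟨h1.symm, h3, h2, h4.trans (Function.update_comm h1 _ _ _)⟩
    have e2 : ∑ w : D.Vertex, ∑ c' : D.C, ∑ c : D.C,
        D.edgeMap w z c' (D.edgeMap v w c (Ideal.Quotient.mk _ F)) = ∑ p : D.C × D.C, T p := by
      rw [Finset.sum_comm, Fintype.sum_prod_type]
      refine Finset.sum_congr rfl fun c' _ => ?_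
      rw [Finset.sum_comm]
      exact Finset.sum_congr rfl fun c _ => e1 c' c
    rw [e2]
    refine Finset.sum_involution (fun p _ => p.swap) ?_ ?_ (fun _ _ => Finset.mem_univ _)
      (fun p _ => p.swap_swap)
    · rintro ⟨c', c⟩ _
      change T (c', c) + T (c, c') = 0
      rw [hsymm]
      exact D.alg_add_self _
    · rintro ⟨c', c⟩ _ h0 h
      have : c = c' := congrArg Prod.fst h
      exact h0 (hT _ _ (fun h => h.1 this))
  have e3 : ∑ w : D.Vertex, ∑ c' : D.C, ∑ v : D.Vertex, ∑ c : D.C,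
      D.edgeMap w z c' (D.edgeMap v w c (f v)) = ∑ v : D.Vertex, ∑ w : D.Vertex, ∑ c' : D.C,
        ∑ c : D.C, D.edgeMap w z c' (D.edgeMap v w c (f v)) := by
    rw [Finset.sum_comm]
    rw [Finset.sum_congr rfl fun c' _ => Finset.sum_comm]
    rw [Finset.sum_comm]
    refine Finset.sum_congr rfl fun v _ => ?_
    rw [Finset.sum_comm]
  rw [e3]
  exact Finset.sum_eq_zero fun v _ => key v

end LinkDiagram

set_option maxSynthPendingDepth 3

/-! ### The reduced complex and its bigrading -/

namespace LinkDiagram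

variable (D : LinkDiagram)

/-- The reduced algebra of `D_v`: the `R`-subalgebra of `Kc'(D_v)` generated by the sums
`x_i + x_j` of two variables. -/
def redAlg (v : D.Vertex) : Subalgebra Base (D.Alg v) :=
  Algebra.adjoin Base {z | ∃ x y, z = Ideal.Quotient.mk (D.ideal v)
    (MvPolynomial.X x + MvPolynomial.X y)}

/-- The (unpointed) reduced complex `Kcr(D)`, as a submodule of `Kc'(D)`. -/
def kcrSub : Submodule Base D.Kc := Submodule.pi Set.univ fun v => (D.redAlg v).toSubmodule

theorem mem_kcrSub {f : D.Kc} : f ∈ D.kcrSub ↔ ∀ v, f v ∈ D.redAlg v := by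
  simp [kcrSub, Submodule.mem_pi]

theorem mk_C_mem_redAlg (v : D.Vertex) (r : Base) :
    Ideal.Quotient.mk (D.ideal v) (MvPolynomial.C r) ∈ D.redAlg v :=
  (D.redAlg v).algebraMap_mem r

theorem theta_mem_redAlg (w : D.Vertex) (c : D.C) :
    Ideal.Quotient.mk (D.ideal w) (D.theta w c) ∈ D.redAlg w := by
  by_cases h : D.circle w (.inl (c, 0)) = D.circle w (.inl (c, 1))
  · rw [D.theta_pos h, map_one]
    exact one_mem _
  · rw [D.theta_neg h, map_add]
    exact add_mem (Algebra.subset_adjoin ⟨_, _, rfl⟩) (D.mk_C_mem_redAlg w _)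

/-- Relabeling of circles maps the reduced algebra to the reduced algebra. -/
theorem exists_lift_redAlg {v : D.Vertex} {z : D.Alg v} (hz : z ∈ D.redAlg v) :
    ∃ F : D.Poly, Ideal.Quotient.mk _ F = z ∧ ∀ w, Ideal.Quotient.mk (D.ideal w) F ∈ D.redAlg w := by
  induction hz using Algebra.adjoin_induction with
  | mem z hz =>
    obtain ⟨x, y, rfl⟩ := hz
    exact ⟨_, rfl, fun w => Algebra.subset_adjoin ⟨x, y, rfl⟩⟩
  | algebraMap r => exact ⟨MvPolynomial.C r, rfl, fun w => D.mk_C_mem_redAlg w r⟩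
  | add z z' _ _ h h' =>
    obtain ⟨F, rfl, hF⟩ := h
    obtain ⟨F', rfl, hF'⟩ := h'
    exact ⟨F + F', rfl, fun w => by rw [map_add]; exact add_mem (hF w) (hF' w)⟩
  | mul z z' _ _ h h' =>
    obtain ⟨F, rfl, hF⟩ := h
    obtain ⟨F', rfl, hF'⟩ := h'
    exact ⟨F * F', rfl, fun w => by rw [map_mul]; exact mul_mem (hF w) (hF' w)⟩

theorem edgeMap_mem_redAlg (v w : D.Vertex) (c : D.C) {z : D.Alg v} (hz : z ∈ D.redAlg v) :
    D.edgeMap v w c z ∈ D.redAlg w := by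
  by_cases h : v c = false ∧ w = Function.update v c true
  · obtain ⟨F, rfl, hF⟩ := D.exists_lift_redAlg hz
    rw [D.edgeMap_mk h, map_mul]
    exact mul_mem (D.theta_mem_redAlg w c) (hF w)
  · rw [edgeMap, dif_neg h]
    exact zero_mem _

theorem kcD_mem_kcrSub {f : D.Kc} (hf : f ∈ D.kcrSub) : D.kcD f ∈ D.kcrSub := by
  rw [mem_kcrSub] at hf ⊢
  intro w
  rw [kcD_apply]
  exact sum_mem fun v _ => sum_mem fun c _ => D.edgeMap_mem_redAlg v w c (hf v)

/-- A monomial `u ^ a * ∏ x ^ (m x)` in `Kc'(D_v)`. -/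
def mono (v : D.Vertex) (a : ℕ) (m : D.Darts →₀ ℕ) : D.Alg v :=
  Ideal.Quotient.mk (D.ideal v) (MvPolynomial.monomial m (u ^ a))

/-- The homological degree at the vertex `v` of the cube. -/
def hDeg (v : D.Vertex) : ℤ := (D.weight v : ℤ) - D.nMinus

/-- The quantum degree of `u ^ a * x_{c_1} ⋯ x_{c_l}` in `Kc'(D_v)`, where `a + l = n`. -/
def qDeg (v : D.Vertex) (n : ℕ) : ℤ :=
  (D.numCircles v : ℤ) - 2 * n + D.weight v + D.nPlus - 2 * D.nMinus

/-- The part of bidegree `k` of the summand `Kc'(D_v)` of `Kc'(D)`. -/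
def vertexGr (v : D.Vertex) (k : ℤ × ℤ) : AddSubgroup (D.Alg v) :=
  AddSubgroup.closure {z | ∃ a m, (D.hDeg v, D.qDeg v (a + m.degree)) = k ∧ z = D.mono v a m}

/-- The bigrading of the reduced complex. The quantum degree is shifted by one, so that for the
unknot the generator `1` has bidegree `(0, 0)`. -/
def kcrGr (k : ℤ × ℤ) : AddSubgroup D.kcrSub where
  carrier := {f | ∀ v, f.1 v ∈ D.vertexGr v (k + (0, 1))}
  zero_mem' _ := zero_mem _
  add_mem' hf hg v := add_mem (hf v) (hg v)
  neg_mem' hf v := neg_mem (hf v)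

/-- The map that multiplies the part of degree `n` by `T ^ n`. -/
def spread (v : D.Vertex) : D.Alg v →+* Polynomial (D.Alg v) :=
  Ideal.Quotient.lift (D.ideal v)
    (MvPolynomial.eval₂Hom
      (Polynomial.eval₂RingHom (algebraMap (ZMod 2) (Polynomial (D.Alg v)))
        (Polynomial.C (Ideal.Quotient.mk (D.ideal v) (MvPolynomial.C u)) * Polynomial.X))
      fun x => Polynomial.C (Ideal.Quotient.mk (D.ideal v) (MvPolynomial.X x)) * Polynomial.X)
    (fun F hF => by
      rw [← RingHom.mem_ker]
      refine (Ideal.span_le (I := RingHom.ker _)).2 ?_ hF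
      rintro _ (⟨x, rfl⟩ | ⟨x, y, hxy, rfl⟩)
      · change MvPolynomial.eval₂Hom _ _ _ = 0
        simp only [map_sub, map_mul, map_pow, MvPolynomial.coe_eval₂Hom, MvPolynomial.eval₂_X,
          MvPolynomial.eval₂_C, Polynomial.coe_eval₂RingHom, Polynomial.eval₂_X]
        have := D.mk_X_sq v x
        rw [mul_mul_mul_comm, ← Polynomial.C_mul, ← this, Polynomial.C_mul]
        ring
      · change MvPolynomial.eval₂Hom _ _ _ = 0
        simp only [map_sub, MvPolynomial.coe_eval₂Hom, MvPolynomial.eval₂_X, D.mk_X_eq hxy,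
          sub_self])

theorem spread_X (v : D.Vertex) (x : D.Darts) :
    D.spread v (Ideal.Quotient.mk _ (MvPolynomial.X x)) =
      Polynomial.monomial 1 (Ideal.Quotient.mk (D.ideal v) (MvPolynomial.X x)) := by
  rw [spread, Ideal.Quotient.lift_mk, MvPolynomial.coe_eval₂Hom, MvPolynomial.eval₂_X,
    Polynomial.C_mul_X_eq_monomial]

theorem spread_u (v : D.Vertex) :
    D.spread v (Ideal.Quotient.mk _ (MvPolynomial.C u)) =
      Polynomial.monomial 1 (Ideal.Quotient.mk (D.ideal v) (MvPolynomial.C u)) := by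
  rw [spread, Ideal.Quotient.lift_mk, MvPolynomial.coe_eval₂Hom, MvPolynomial.eval₂_C,
    Polynomial.coe_eval₂RingHom, Polynomial.eval₂_X, Polynomial.C_mul_X_eq_monomial]

theorem mono_eq (v : D.Vertex) (a : ℕ) (m : D.Darts →₀ ℕ) :
    D.mono v a m = Ideal.Quotient.mk (D.ideal v) (MvPolynomial.C u) ^ a *
      m.prod fun x k => Ideal.Quotient.mk (D.ideal v) (MvPolynomial.X x) ^ k := by
  rw [mono, MvPolynomial.monomial_eq, map_mul, MvPolynomial.C_pow, map_pow, Finsupp.prod, map_prod]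
  simp only [map_pow]
  rfl

theorem mono_mul_mono (v : D.Vertex) (a b : ℕ) (m n : D.Darts →₀ ℕ) :
    D.mono v a m * D.mono v b n = D.mono v (a + b) (m + n) := by
  rw [mono, mono, mono, ← map_mul, MvPolynomial.monomial_mul, pow_add]

theorem mk_u_eq_mono (v : D.Vertex) :
    Ideal.Quotient.mk (D.ideal v) (MvPolynomial.C u) = D.mono v 1 0 := by
  rw [mono, pow_one]
  rfl

theorem mk_X_eq_mono (v : D.Vertex) (x : D.Darts) :
    Ideal.Quotient.mk (D.ideal v) (MvPolynomial.X x) = D.mono v 0 (Finsupp.single x 1) := by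
  rw [mono, pow_zero]
  rfl

theorem spread_mono (v : D.Vertex) (a : ℕ) (m : D.Darts →₀ ℕ) :
    D.spread v (D.mono v a m) = Polynomial.monomial (a + m.degree) (D.mono v a m) := by
  have key : ∀ m : D.Darts →₀ ℕ, D.spread v (D.mono v 0 m) =
      Polynomial.monomial m.degree (D.mono v 0 m) := by
    intro m
    induction m using Finsupp.induction_linear with
    | zero =>
      have : D.mono v 0 0 = 1 := by rw [mono_eq, pow_zero, Finsupp.prod_zero_index, mul_one]
      rw [this, map_one, map_zero]
      rfl
    | add m n hm hn =>
      have : D.mono v 0 (m + n) = D.mono v 0 m * D.mono v 0 n := by rw [mono_mul_mono]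
      rw [this, map_mul, hm, hn, Polynomial.monomial_mul_monomial, map_add]
    | single x k =>
      have : D.mono v 0 (Finsupp.single x k) =
          Ideal.Quotient.mk (D.ideal v) (MvPolynomial.X x) ^ k := by
        rw [mono_eq, pow_zero, one_mul, Finsupp.prod_single_index (h := fun x k => Ideal.Quotient.mk (D.ideal v) (MvPolynomial.X x) ^ k)
          (pow_zero _)]
      rw [this, map_pow, spread_X, Polynomial.monomial_pow, one_mul, Finsupp.degree_single]
  have : D.mono v a m = D.mono v 1 0 ^ a * D.mono v 0 m := by
    rw [← mk_u_eq_mono, mono_eq, mono_eq, pow_zero, one_mul]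
  rw [this, map_mul, map_pow, key, ← mk_u_eq_mono, spread_u, Polynomial.monomial_pow, one_mul,
    Polynomial.monomial_mul_monomial]

/-- A polynomial over `R` reduces to a sum of monomials. -/
theorem poly_induction {v : D.Vertex} {P : D.Alg v → Prop} (h : ∀ a m, P (D.mono v a m))
    (hadd : ∀ z z', P z → P z' → P (z + z')) (h0 : P 0) (z : D.Alg v) : P z := by
  obtain ⟨F, rfl⟩ := Ideal.Quotient.mk_surjective z
  induction F using MvPolynomial.induction_on' with
  | monomial m r =>
    induction r using Polynomial.induction_on' with
    | add p q hp hq => rw [map_add, map_add]; exact hadd _ _ hp hq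
    | monomial n c =>
      have hc : c = 0 ∨ c = 1 := by
        revert c
        decide
      rcases hc with rfl | rfl
      · rw [map_zero, map_zero, map_zero]
        exact h0
      · rw [← Polynomial.X_pow_eq_monomial]
        exact h n m
  | add p q hp hq => rw [map_add]; exact hadd _ _ hp hq

/-- The projection to the part of degree `n`. -/
def algProj (v : D.Vertex) (n : ℕ) : D.Alg v →+ D.Alg v where
  toFun z := (D.spread v z).coeff n
  map_zero' := by rw [map_zero, Polynomial.coeff_zero]
  map_add' z z' := by rw [map_add, Polynomial.coeff_add]

theorem algProj_apply (v : D.Vertex) (n : ℕ) (z : D.Alg v) :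
    D.algProj v n z = (D.spread v z).coeff n := rfl

theorem algProj_mono (v : D.Vertex) (n a : ℕ) (m : D.Darts →₀ ℕ) :
    D.algProj v n (D.mono v a m) = if a + m.degree = n then D.mono v a m else 0 := by
  rw [algProj_apply, spread_mono, Polynomial.coeff_monomial]

theorem algProj_mem_vertexGr (v : D.Vertex) (n : ℕ) (z : D.Alg v) :
    D.algProj v n z ∈ D.vertexGr v (D.hDeg v, D.qDeg v n) := by
  refine D.poly_induction (P := fun z => D.algProj v n z ∈ D.vertexGr v (D.hDeg v, D.qDeg v n))
    ?_ ?_ ?_ z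
  · intro a m
    rw [algProj_mono]
    split_ifs with h
    · exact AddSubgroup.subset_closure ⟨a, m, by rw [h], rfl⟩
    · exact zero_mem _
  · intro z z' h h'
    rw [map_add]
    exact add_mem h h'
  · rw [map_zero]
    exact zero_mem _

theorem algProj_mem_redAlg (v : D.Vertex) (n : ℕ) {z : D.Alg v} (hz : z ∈ D.redAlg v) :
    D.algProj v n z ∈ D.redAlg v := by
  rw [algProj_apply]
  induction hz using Algebra.adjoin_induction generalizing n with
  | mem z hz =>
    obtain ⟨x, y, rfl⟩ := hz
    rw [map_add, map_add, spread_X, spread_X, ← map_add (Polynomial.monomial 1), ← map_add,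
      Polynomial.coeff_monomial]
    split_ifs
    · exact Algebra.subset_adjoin ⟨x, y, rfl⟩
    · exact zero_mem _
  | algebraMap r =>
    have e : ∀ r : Base, algebraMap Base (D.Alg v) r =
        Ideal.Quotient.mk (D.ideal v) (MvPolynomial.C r) := fun _ => rfl
    induction r using Polynomial.induction_on' with
    | add p q hp hq => rw [map_add, map_add, Polynomial.coeff_add]; exact add_mem hp hq
    | monomial k c =>
      have hc : c = 0 ∨ c = 1 := by
        revert c
        decide
      rcases hc with rfl | rfl
      · rw [map_zero, map_zero, map_zero, Polynomial.coeff_zero]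
        exact zero_mem _
      · have : algebraMap Base (D.Alg v) (Polynomial.monomial k 1) = D.mono v k 0 := by
          rw [e, ← Polynomial.X_pow_eq_monomial]
          rfl
        rw [this, spread_mono, Polynomial.coeff_monomial, ← this]
        split_ifs
        · exact Subalgebra.algebraMap_mem _ _
        · exact zero_mem _
  | add z z' _ _ h h' => rw [map_add, Polynomial.coeff_add]; exact add_mem (h n) (h' n)
  | mul z z' _ _ h h' =>
    rw [map_mul, Polynomial.coeff_mul]
    exact sum_mem fun p _ => mul_mem (h p.1) (h' p.2)

theorem sum_algProj (v : D.Vertex) (z : D.Alg v) :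
    ∑ n ∈ (D.spread v z).support, D.algProj v n z = z := by
  have h1 : ∑ n ∈ (D.spread v z).support, D.algProj v n z = (D.spread v z).eval 1 := by
    rw [Polynomial.eval_eq_sum, Polynomial.sum]
    simp only [one_pow, mul_one]
    rfl
  rw [h1]
  refine D.poly_induction (P := fun z => (D.spread v z).eval 1 = z) ?_ ?_ ?_ z
  · intro a m
    rw [spread_mono, Polynomial.eval_monomial, one_pow, mul_one]
  · intro z z' h h'
    rw [map_add, Polynomial.eval_add, h, h']
  · rw [map_zero, Polynomial.eval_zero]

theorem qDeg_injective {v : D.Vertex} {n n' : ℕ} (h : D.qDeg v n = D.qDeg v n') : n = n' := by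
  simp only [qDeg] at h
  omega

open Classical in
/-- The projection to the part of bidegree `k`. -/
def vertexProj (v : D.Vertex) (k : ℤ × ℤ) : D.Alg v →+ D.Alg v :=
  if h : ∃ n, (D.hDeg v, D.qDeg v n) = k then D.algProj v h.choose else 0

theorem vertexProj_mono (v : D.Vertex) (k : ℤ × ℤ) (a : ℕ) (m : D.Darts →₀ ℕ) :
    D.vertexProj v k (D.mono v a m) =
      if (D.hDeg v, D.qDeg v (a + m.degree)) = k then D.mono v a m else 0 := by
  rw [vertexProj]
  split_ifs with h h' h'
  · rw [algProj_mono, if_pos]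
    exact D.qDeg_injective (congrArg Prod.snd (h'.trans h.choose_spec.symm))
  · rw [algProj_mono, if_neg]
    intro h2
    exact h' (by rw [h2]; exact h.choose_spec)
  · exact absurd ⟨_, h'⟩ h
  · rfl

theorem vertexProj_of_mem {v : D.Vertex} {k : ℤ × ℤ} {z : D.Alg v} (hz : z ∈ D.vertexGr v k) :
    D.vertexProj v k z = z := by
  induction hz using AddSubgroup.closure_induction with
  | mem z hz =>
    obtain ⟨a, m, h, rfl⟩ := hz
    rw [vertexProj_mono, if_pos h]
  | zero => exact map_zero _
  | add z z' _ _ h h' => rw [map_add, h, h']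
  | neg z _ h => rw [map_neg, h]

theorem vertexProj_of_ne {v : D.Vertex} {k l : ℤ × ℤ} {z : D.Alg v} (hz : z ∈ D.vertexGr v k)
    (hl : l ≠ k) : D.vertexProj v l z = 0 := by
  induction hz using AddSubgroup.closure_induction with
  | mem z hz =>
    obtain ⟨a, m, h, rfl⟩ := hz
    rw [vertexProj_mono, if_neg]
    rintro rfl
    exact hl h
  | zero => exact map_zero _
  | add z z' _ _ h h' => rw [map_add, h, h', add_zero]
  | neg z _ h => rw [map_neg, h, neg_zero]

theorem vertexProj_mem_redAlg (v : D.Vertex) (k : ℤ × ℤ) {z : D.Alg v} (hz : z ∈ D.redAlg v) :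
    D.vertexProj v k z ∈ D.redAlg v := by
  rw [vertexProj]
  split_ifs with h
  · exact D.algProj_mem_redAlg v _ hz
  · exact zero_mem _

theorem kcrGr_isInternal : DirectSum.IsInternal D.kcrGr := by
  classical
  refine isInternal_of_proj D.kcrGr (fun k =>
    { toFun := fun f => ⟨fun v => D.vertexProj v (k + (0, 1)) (f.1 v),
        D.mem_kcrSub.2 fun v => D.vertexProj_mem_redAlg v _ (D.mem_kcrSub.1 f.2 v)⟩
      map_zero' := Subtype.ext (funext fun v => map_zero _)
      map_add' := fun f g => Subtype.ext (funext fun v => map_add _ _ _) }) ?_ ?_ ?_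
  · intro k f hf
    exact Subtype.ext (funext fun v => D.vertexProj_of_mem (hf v))
  · intro k l f hf hne
    exact Subtype.ext (funext fun v => D.vertexProj_of_ne (hf v) fun h => hne (add_right_cancel h))
  · intro f
    have hs : ∀ v n, Pi.single v (D.algProj v n (f.1 v)) ∈ D.kcrSub := by
      intro v n
      rw [mem_kcrSub]
      intro w
      by_cases h : w = v
      · subst h
        rw [Pi.single_eq_same]
        exact D.algProj_mem_redAlg w n (D.mem_kcrSub.1 f.2 w)
      · rw [Pi.single_eq_of_ne h]
        exact zero_mem _
    have hf : f = ∑ v : D.Vertex, ∑ n ∈ (D.spread v (f.1 v)).support,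
        (⟨Pi.single v (D.algProj v n (f.1 v)), hs v n⟩ : D.kcrSub) := by
      apply Subtype.ext
      rw [AddSubmonoidClass.coe_finsetSum]
      simp only [AddSubmonoidClass.coe_finsetSum]
      conv_lhs => rw [← Finset.univ_sum_single f.1]
      refine Finset.sum_congr rfl fun v _ => ?_
      conv_lhs => rw [← D.sum_algProj v (f.1 v)]
      exact map_sum (AddMonoidHom.single (fun v => D.Alg v) v) _ _
    rw [hf]
    refine sum_mem fun v _ => sum_mem fun n _ => AddSubgroup.mem_iSup_of_mem
      (D.hDeg v, D.qDeg v n - 1) ?_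
    intro w
    by_cases h : w = v
    · subst h
      change Pi.single w _ w ∈ _
      rw [Pi.single_eq_same]
      have : (D.hDeg w, D.qDeg w n - 1) + ((0 : ℤ), (1 : ℤ)) = (D.hDeg w, D.qDeg w n) := by
        ext <;> simp
      rw [this]
      exact D.algProj_mem_vertexGr w n _
    · change Pi.single v _ w ∈ _
      rw [Pi.single_eq_of_ne h]
      exact zero_mem _

/-! ### The structure maps respect the bigrading -/

theorem u_smul_mem_vertexGr {v : D.Vertex} {k : ℤ × ℤ} {z : D.Alg v} (hz : z ∈ D.vertexGr v k) :
    u • z ∈ D.vertexGr v (k + (0, -2)) := by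
  induction hz using AddSubgroup.closure_induction with
  | mem z hz =>
    obtain ⟨a, m, rfl, rfl⟩ := hz
    refine AddSubgroup.subset_closure ⟨a + 1, m, ?_, ?_⟩
    · ext
      · simp
      · simp only [qDeg, Prod.snd_add]
        push_cast
        ring
    · have : u • D.mono v a m = D.mono v 1 0 * D.mono v a m := by
        rw [← mk_u_eq_mono]
        exact Algebra.smul_def _ _
      rw [this, mono_mul_mono, zero_add, add_comm]
  | zero => rw [smul_zero]; exact zero_mem _
  | add z z' _ _ h h' => rw [smul_add]; exact add_mem h h'
  | neg z _ h => rw [smul_neg]; exact neg_mem h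

theorem weight_update {v : D.Vertex} {c : D.C} (hv : v c = false) :
    D.weight (Function.update v c true) = D.weight v + 1 := by
  classical
  rw [weight, weight, Nat.card_eq_fintype_card, Nat.card_eq_fintype_card, Fintype.card_subtype,
    Fintype.card_subtype]
  have : Finset.univ.filter (fun x => Function.update v c true x = true) =
      insert c (Finset.univ.filter fun x => v x = true) := by
    ext x
    by_cases h : x = c
    · subst h
      simp
    · simp [h]
  rw [this, Finset.card_insert_of_notMem (by simp [hv])]

theorem edgeMap_mem_vertexGr (v w : D.Vertex) (c : D.C) {k : ℤ × ℤ} {z : D.Alg v}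
    (hz : z ∈ D.vertexGr v k) : D.edgeMap v w c z ∈ D.vertexGr w (k + (1, 0)) := by
  by_cases h : v c = false ∧ w = Function.update v c true
  · induction hz using AddSubgroup.closure_induction with
    | mem z hz =>
      obtain ⟨a, m, rfl, rfl⟩ := hz
      rw [mono, D.edgeMap_mk h, map_mul]
      change _ * D.mono w a m ∈ _
      obtain ⟨hv, rfl⟩ := h
      have hw := D.weight_update hv
      have hn := D.numCircles_edge hv
      set w := Function.update v c true with hwdef
      change (D.circle w _ = D.circle w _ → D.numCircles v = D.numCircles w + 1) ∧
        (D.circle w _ ≠ D.circle w _ → D.numCircles w = D.numCircles v + 1) at hn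
      by_cases hs : D.circle w (.inl (c, 0)) = D.circle w (.inl (c, 1))
      · rw [D.theta_pos hs, map_one, one_mul]
        refine AddSubgroup.subset_closure ⟨a, m, ?_, rfl⟩
        have := hn.1 hs
        ext
        · simp only [hDeg, Prod.fst_add]
          omega
        · simp only [qDeg, Prod.snd_add]
          omega
      · have := hn.2 hs
        have key : ∀ b n, b + n.degree = 1 → D.mono w b n * D.mono w a m ∈
            D.vertexGr w ((D.hDeg v, D.qDeg v (a + m.degree)) + (1, 0)) := by
          intro b n hbn
          rw [mono_mul_mono]
          refine AddSubgroup.subset_closure ⟨_, _, ?_, rfl⟩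
          rw [map_add]
          ext
          · simp only [hDeg, Prod.fst_add]
            omega
          · simp only [qDeg, Prod.snd_add]
            omega
        rw [D.theta_neg hs, map_add, map_add, add_mul, add_mul, mk_u_eq_mono, mk_X_eq_mono,
          mk_X_eq_mono]
        exact add_mem (add_mem (key _ _ (by simp)) (key _ _ (by simp))) (key _ _ (by simp))
    | zero => rw [map_zero]; exact zero_mem _
    | add z z' _ _ h h' => rw [map_add]; exact add_mem h h'
    | neg z _ h => rw [map_neg]; exact neg_mem h
  · rw [edgeMap, dif_neg h]
    exact zero_mem _

/-- The differential of the reduced complex. -/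
def kcrD : D.kcrSub →ₗ[Base] D.kcrSub :=
  (D.kcD.restrictScalars Base).restrict fun _ => D.kcD_mem_kcrSub

theorem kcrD_mem {k : ℤ × ℤ} {f : D.kcrSub} (hf : f ∈ D.kcrGr k) : D.kcrD f ∈ D.kcrGr (k + (1, 0)) := by
  intro w
  change D.kcD f.1 w ∈ _
  rw [kcD_apply, add_right_comm]
  exact sum_mem fun v _ => sum_mem fun c _ => D.edgeMap_mem_vertexGr v w c (hf v)

theorem kcrD_kcrD (f : D.kcrSub) : D.kcrD (D.kcrD f) = 0 := Subtype.ext (D.kcD_kcD f.1)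

theorem u_smul_mem_kcrGr {k : ℤ × ℤ} {f : D.kcrSub} (hf : f ∈ D.kcrGr k) :
    u • f ∈ D.kcrGr (k + (0, -2)) := by
  intro v
  rw [add_right_comm]
  exact D.u_smul_mem_vertexGr (hf v)

end LinkDiagram

/-! ### Involutive links -/

/-- An orientation-reversing map on half-edges over maps `tC`, `tP` of the vertices. -/
def Dart.reflect {C P : Type} (tC : C → C) (kC : C → ZMod 4) (tP : P → P) (kP : P → ZMod 2) :
    Dart C P → Dart C P
  | .inl (c, i) => .inl (tC c, kC c - i)
  | .inr (p, i) => .inr (tP p, kP p - i)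

/-- A transvergent diagram of an involutive link: a diagram that is preserved by the rotation by
`π` about an axis in the plane of projection. On the projection the rotation acts as the reflection
in the axis, and as it turns over the plane it exchanges over- and under-strands (`kC_odd`).

`axis` says that the reflection is the reflection in an axis: the half-edges not on the axis can be
assigned to its two sides, such that the sides are exchanged by the reflection, and such that only
edges and corners that are mapped to themselves cross the axis. -/
structure TransvergentDiagram extends LinkDiagram where
  tC : C → C
  tP : P → P
  kC : C → ZMod 4
  kP : P → ZMod 2
  kC_odd : ∀ c, kC c = 1 ∨ kC c = 3
  t_t : ∀ x, Dart.reflect tC kC tP kP (Dart.reflect tC kC tP kP x) = x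
  t_e : ∀ x, Dart.reflect tC kC tP kP (e x) = e (Dart.reflect tC kC tP kP x)
  axis : ∃ side : Dart C P → Bool, (∀ x, side (Dart.reflect tC kC tP kP x) = !side x) ∧
    (∀ x, e x ≠ Dart.reflect tC kC tP kP x → side (e x) = side x) ∧
    ∀ x, Dart.prev x ≠ Dart.reflect tC kC tP kP x → side (Dart.prev x) = side x

namespace TransvergentDiagram

variable (D : TransvergentDiagram)

/-- The action of the involution on half-edges. -/
def t : D.Darts → D.Darts := Dart.reflect D.tC D.kC D.tP D.kP

theorem t_inl (c : D.C) (i : ZMod 4) : D.t (.inl (c, i)) = .inl (D.tC c, D.kC c - i) := rfl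

theorem t_t' (x : D.Darts) : D.t (D.t x) = x := D.t_t x

theorem tC_tC (c : D.C) : D.tC (D.tC c) = c :=
  congrArg Prod.fst (Sum.inl.inj (D.t_t (.inl (c, 0))))

/-- The action of the involution on the cube of resolutions. -/
def tV (v : D.Vertex) : D.Vertex := fun c => v (D.tC c)

theorem tV_tV (v : D.Vertex) : D.tV (D.tV v) = v := funext fun c => congrArg v (D.tC_tC c)

theorem t_res (w : D.Vertex) (x : D.Darts) : D.t (D.res (D.tV w) x) = D.res w (D.t x) := by
  have h4 : ∀ k s i : ZMod 4, (k = 1 ∨ k = 3) → (s = 1 ∨ s = 3) → k - (s - i) = s - (k - i) := by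
    decide
  have h2 : ∀ k i : ZMod 2, k - (1 - i) = 1 - (k - i) := by decide
  rcases x with ⟨c, i⟩ | ⟨p, i⟩
  · change (Sum.inl (D.tC c, D.kC c - ((if w (D.tC c) then 3 else 1) - i)) : D.Darts) =
      .inl (D.tC c, (if w (D.tC c) then 3 else 1) - (D.kC c - i))
    rw [h4 _ _ _ (D.kC_odd c) (by split_ifs <;> simp)]
  · change (Sum.inr (D.tP p, D.kP p - (1 - i)) : D.Darts) = .inr (D.tP p, 1 - (D.kP p - i))
    rw [h2]

theorem circle_t {w : D.Vertex} {x y : D.Darts}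
    (h : D.circle (D.tV w) x = D.circle (D.tV w) y) : D.circle w (D.t x) = D.circle w (D.t y) := by
  refine D.circle_rec (r := fun x y => D.circle w (D.t x) = D.circle w (D.t y))
    ⟨fun _ => rfl, fun h => h.symm, fun h h' => h.trans h'⟩ ?_ ?_ h
  · intro x
    have : D.t (D.e x) = D.e (D.t x) := D.t_e x
    rw [this, D.circle_e]
  · intro x
    rw [t_res, D.circle_res]

theorem circle_t_iff {w : D.Vertex} {x y : D.Darts} :
    D.circle (D.tV w) x = D.circle (D.tV w) y ↔ D.circle w (D.t x) = D.circle w (D.t y) := by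
  refine ⟨D.circle_t, fun h => ?_⟩
  rw [← D.tV_tV w] at h
  have := D.circle_t h
  rwa [t_t', t_t'] at this

theorem rename_mem_ideal (w : D.Vertex) :
    D.ideal (D.tV w) ≤ (D.ideal w).comap (MvPolynomial.rename (R := Base) D.t) := by
  refine Ideal.span_le.2 ?_
  rintro _ (⟨x, rfl⟩ | ⟨x, y, hxy, rfl⟩)
  · change MvPolynomial.rename _ _ ∈ D.ideal w
    simp only [map_sub, map_mul, map_pow, MvPolynomial.rename_X, MvPolynomial.rename_C]
    exact D.sq_sub_mem w _
  · change MvPolynomial.rename _ _ ∈ D.ideal w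
    simp only [map_sub, MvPolynomial.rename_X]
    exact D.X_sub_X_mem (D.circle_t hxy)

/-- The isomorphism from the algebra of a resolution to the algebra of the reflected resolution. -/
def tauAlg (w : D.Vertex) : D.Alg (D.tV w) →ₐ[Base] D.Alg w :=
  Ideal.quotientMapₐ (D.ideal w) (MvPolynomial.rename D.t) (D.rename_mem_ideal w)

theorem tauAlg_mk (w : D.Vertex) (F : D.Poly) : D.tauAlg w (Ideal.Quotient.mk _ F) =
    Ideal.Quotient.mk _ (MvPolynomial.rename D.t F) := rfl

/-- The action of `τ` on `Kc'(D)`, induced by the action on resolutions. -/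
def kcTau : D.Kc →ₗ[Base] D.Kc :=
  LinearMap.pi fun w => (D.tauAlg w).toLinearMap.comp (LinearMap.proj (D.tV w))

theorem kcTau_apply (f : D.Kc) (w : D.Vertex) : D.kcTau f w = D.tauAlg w (f (D.tV w)) := rfl

theorem exists_lift (f : D.Kc) : ∃ F : D.Vertex → D.Poly,
    f = fun v => Ideal.Quotient.mk (D.ideal v) (F v) := by
  choose F hF using fun v => Ideal.Quotient.mk_surjective (f v)
  exact ⟨F, funext fun v => (hF v).symm⟩

theorem kcTau_kcTau (f : D.Kc) : D.kcTau (D.kcTau f) = f := by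
  obtain ⟨F, rfl⟩ := D.exists_lift f
  funext w
  rw [kcTau_apply, kcTau_apply, tauAlg_mk, tauAlg_mk, MvPolynomial.rename_rename, tV_tV]
  have : D.t ∘ D.t = id := funext D.t_t
  rw [this, MvPolynomial.rename_id_apply]

theorem edge_iff (v w : D.Vertex) (c : D.C) :
    (D.tV v (D.tC c) = false ∧ D.tV w = Function.update (D.tV v) (D.tC c) true) ↔
      (v c = false ∧ w = Function.update v c true) := by
  have key : Function.update (D.tV v) (D.tC c) true = D.tV (Function.update v c true) := by
    funext b
    by_cases h : b = D.tC c
    · subst h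
      rw [Function.update_self, tV, tC_tC, Function.update_self]
    · rw [Function.update_of_ne h, tV, tV, Function.update_of_ne]
      rintro rfl
      exact h (D.tC_tC b).symm
  rw [key, tV, tC_tC]
  refine and_congr Iff.rfl ⟨fun h => ?_, fun h => by rw [h]⟩
  rw [← D.tV_tV w, h, tV_tV]

theorem mk_rename_theta {w : D.Vertex} {c : D.C} (hw : w c = true) :
    Ideal.Quotient.mk (D.ideal w) (MvPolynomial.rename D.t (D.theta (D.tV w) (D.tC c))) =
      Ideal.Quotient.mk (D.ideal w) (D.theta w c) := by
  have e : (D.circle w (D.t (.inl (D.tC c, 0))) = D.circle w (.inl (c, 1)) ∧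
      D.circle w (D.t (.inl (D.tC c, 1))) = D.circle w (.inl (c, 0))) ∨
      (D.circle w (D.t (.inl (D.tC c, 0))) = D.circle w (.inl (c, 0)) ∧
      D.circle w (D.t (.inl (D.tC c, 1))) = D.circle w (.inl (c, 1))) := by
    rw [t_inl, t_inl, tC_tC]
    rcases D.kC_odd (D.tC c) with h | h <;> rw [h]
    · exact Or.inl ⟨rfl, rfl⟩
    · exact Or.inr ⟨D.circle_30 hw, D.circle_21 hw⟩
  by_cases h : D.circle w (.inl (c, 0)) = D.circle w (.inl (c, 1))
  · rw [D.theta_pos h, D.theta_pos, map_one]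
    rw [circle_t_iff]
    rcases e with ⟨e0, e1⟩ | ⟨e0, e1⟩ <;> rw [e0, e1, h]
  · rw [D.theta_neg h, D.theta_neg]
    · simp only [map_add, MvPolynomial.rename_X, MvPolynomial.rename_C]
      rcases e with ⟨e0, e1⟩ | ⟨e0, e1⟩ <;> rw [D.mk_X_eq e0, D.mk_X_eq e1]
      rw [add_comm (Ideal.Quotient.mk (D.ideal w) (MvPolynomial.X (.inl (c, 1))))]
    · rw [circle_t_iff]
      rcases e with ⟨e0, e1⟩ | ⟨e0, e1⟩ <;> rw [e0, e1]
      · exact fun h' => h h'.symm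
      · exact h

theorem edgeMap_tauAlg (v w : D.Vertex) (c : D.C) (z : D.Alg (D.tV v)) :
    D.edgeMap v w c (D.tauAlg v z) = D.tauAlg w (D.edgeMap (D.tV v) (D.tV w) (D.tC c) z) := by
  obtain ⟨F, rfl⟩ := Ideal.Quotient.mk_surjective z
  by_cases h : v c = false ∧ w = Function.update v c true
  · rw [D.edgeMap_mk ((D.edge_iff v w c).2 h), tauAlg_mk, tauAlg_mk, D.edgeMap_mk h, map_mul,
      map_mul, map_mul, mk_rename_theta]
    rw [h.2, Function.update_self]
  · have h' := fun h' => h ((D.edge_iff v w c).1 h')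
    rw [LinkDiagram.edgeMap, LinkDiagram.edgeMap, dif_neg h, dif_neg h', LinearMap.zero_apply,
      LinearMap.zero_apply, map_zero]

theorem kcD_kcTau (f : D.Kc) : D.kcD (D.kcTau f) = D.kcTau (D.kcD f) := by
  funext w
  rw [kcTau_apply, D.kcD_apply, D.kcD_apply, map_sum]
  let eV : Equiv.Perm D.Vertex := Function.Involutive.toPerm D.tV D.tV_tV
  let eC : Equiv.Perm D.C := Function.Involutive.toPerm D.tC D.tC_tC
  have h1 : ∀ v, D.tauAlg w (∑ c : D.C, D.edgeMap v (D.tV w) c (f v)) =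
      ∑ c : D.C, D.tauAlg w (D.edgeMap v (D.tV w) (D.tC c) (f v)) := fun v => by
    rw [map_sum]
    exact (Equiv.sum_comp eC fun c => D.tauAlg w (D.edgeMap v (D.tV w) c (f v))).symm
  simp only [h1]
  rw [← Equiv.sum_comp eV fun v => ∑ c : D.C, D.tauAlg w (D.edgeMap v (D.tV w) (D.tC c) (f v))]
  exact Finset.sum_congr rfl fun v _ => Finset.sum_congr rfl fun c _ =>
    D.edgeMap_tauAlg v w c (f (D.tV v))

theorem tauAlg_mem_redAlg (w : D.Vertex) {z : D.Alg (D.tV w)} (hz : z ∈ D.redAlg (D.tV w)) :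
    D.tauAlg w z ∈ D.redAlg w := by
  induction hz using Algebra.adjoin_induction with
  | mem z hz =>
    obtain ⟨x, y, rfl⟩ := hz
    rw [tauAlg_mk, map_add, MvPolynomial.rename_X, MvPolynomial.rename_X]
    exact Algebra.subset_adjoin ⟨_, _, rfl⟩
  | algebraMap r => rw [AlgHom.commutes]; exact Subalgebra.algebraMap_mem _ _
  | add z z' _ _ h h' => rw [map_add]; exact add_mem h h'
  | mul z z' _ _ h h' => rw [map_mul]; exact mul_mem h h'

theorem weight_tV (w : D.Vertex) : D.weight (D.tV w) = D.weight w :=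
  Nat.card_congr ⟨fun c => ⟨D.tC c.1, c.2⟩, fun c => ⟨D.tC c.1, by
    change w (D.tC (D.tC c.1)) = true
    rw [tC_tC]
    exact c.2⟩, fun c => Subtype.ext (D.tC_tC c.1), fun c => Subtype.ext (D.tC_tC c.1)⟩

theorem numCircles_tV (w : D.Vertex) : D.numCircles (D.tV w) = D.numCircles w := by
  refine Nat.card_congr ⟨Quot.lift (fun x => D.circle w (D.t x)) fun x y h => D.circle_t (Quot.sound h),
    Quot.lift (fun x => D.circle (D.tV w) (D.t x)) fun x y h => ?_, ?_, ?_⟩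
  · rw [circle_t_iff, t_t', t_t']
    exact Quot.sound h
  · rintro ⟨x⟩
    exact congrArg _ (D.t_t' x)
  · rintro ⟨x⟩
    exact congrArg _ (D.t_t' x)

theorem tauAlg_mem_vertexGr (w : D.Vertex) {k : ℤ × ℤ} {z : D.Alg (D.tV w)}
    (hz : z ∈ D.vertexGr (D.tV w) k) : D.tauAlg w z ∈ D.vertexGr w k := by
  induction hz using AddSubgroup.closure_induction with
  | mem z hz =>
    obtain ⟨a, m, rfl, rfl⟩ := hz
    refine AddSubgroup.subset_closure ⟨a, m.mapDomain D.t, ?_, ?_⟩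
    · rw [Finsupp.degree_mapDomain]
      simp only [LinkDiagram.hDeg, LinkDiagram.qDeg, weight_tV, numCircles_tV]
    · rw [LinkDiagram.mono, tauAlg_mk, MvPolynomial.rename_monomial]
      rfl
  | zero => rw [map_zero]; exact zero_mem _
  | add z z' _ _ h h' => rw [map_add]; exact add_mem h h'
  | neg z _ h => rw [map_neg]; exact neg_mem h

/-- The action of `τ` on the reduced complex. -/
def kcrTau : D.kcrSub →ₗ[Base] D.kcrSub :=
  D.kcTau.restrict fun _ hf => D.mem_kcrSub.2 fun w =>
    D.tauAlg_mem_redAlg w (D.mem_kcrSub.1 hf (D.tV w))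

/-- The reduced complex `Kcr(D)` with its action of `τ`, as a complex over `R[τ]/(τ² + 1)`. -/
def Kcr : KomTau :=
  ofInvolution D.kcrSub D.kcrGr D.kcrGr_isInternal (fun _ _ hf => D.u_smul_mem_kcrGr hf) D.kcrD
    (fun _ _ hf => D.kcrD_mem hf) D.kcrD_kcrD D.kcrTau
    (fun f => Subtype.ext (D.kcTau_kcTau f.1))
    (fun _ _ hf w => D.tauAlg_mem_vertexGr w (hf (D.tV w)))
    (fun f => Subtype.ext (D.kcD_kcTau f.1))

/-- The reduced Borel complex `Kcr_Q(D)`. -/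
def reducedBorel : KomQ := borel D.Kcr

end TransvergentDiagram

/-! ### Equivariant connected sums -/

section Dart

variable {C₁ P₁ C₂ P₂ : Type}

/-- The inclusion of the half-edges of the first summand. -/
def Dart.inL : Dart C₁ P₁ → Dart (C₁ ⊕ C₂) (P₁ ⊕ P₂)
  | .inl (c, i) => .inl (.inl c, i)
  | .inr (p, i) => .inr (.inl p, i)

/-- The inclusion of the half-edges of the second summand. -/
def Dart.inR : Dart C₂ P₂ → Dart (C₁ ⊕ C₂) (P₁ ⊕ P₂)
  | .inl (c, i) => .inl (.inr c, i)
  | .inr (p, i) => .inr (.inr p, i)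

/-- The map on half-edges of a connected sum with given restrictions to the summands. -/
def Dart.elim {A : Type} (f : Dart C₁ P₁ → A) (g : Dart C₂ P₂ → A) :
    Dart (C₁ ⊕ C₂) (P₁ ⊕ P₂) → A
  | .inl (.inl c, i) => f (.inl (c, i))
  | .inl (.inr c, i) => g (.inl (c, i))
  | .inr (.inl p, i) => f (.inr (p, i))
  | .inr (.inr p, i) => g (.inr (p, i))

theorem Dart.elim_inL {A : Type} (f : Dart C₁ P₁ → A) (g : Dart C₂ P₂ → A) (x : Dart C₁ P₁) :
    Dart.elim f g (Dart.inL x) = f x := by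
  rcases x with ⟨c, i⟩ | ⟨p, i⟩ <;> rfl

theorem Dart.elim_inR {A : Type} (f : Dart C₁ P₁ → A) (g : Dart C₂ P₂ → A) (x : Dart C₂ P₂) :
    Dart.elim f g (Dart.inR x) = g x := by
  rcases x with ⟨c, i⟩ | ⟨p, i⟩ <;> rfl

theorem Dart.sum_cases {M : Dart (C₁ ⊕ C₂) (P₁ ⊕ P₂) → Prop} (h₁ : ∀ x, M (Dart.inL x))
    (h₂ : ∀ x, M (Dart.inR x)) (x : Dart (C₁ ⊕ C₂) (P₁ ⊕ P₂)) : M x := by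
  rcases x with ⟨c | c, i⟩ | ⟨p | p, i⟩
  · exact h₁ (.inl (c, i))
  · exact h₂ (.inl (c, i))
  · exact h₁ (.inr (p, i))
  · exact h₂ (.inr (p, i))

theorem Dart.prev_inL (x : Dart C₁ P₁) :
    Dart.prev (Dart.inL (C₂ := C₂) (P₂ := P₂) x) = Dart.inL (Dart.prev x) := by
  rcases x with ⟨c, i⟩ | ⟨p, i⟩ <;> rfl

theorem Dart.prev_inR (x : Dart C₂ P₂) :
    Dart.prev (Dart.inR (C₁ := C₁) (P₁ := P₁) x) = Dart.inR (Dart.prev x) := by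
  rcases x with ⟨c, i⟩ | ⟨p, i⟩ <;> rfl

theorem Dart.inL_injective : Function.Injective (Dart.inL (C₁ := C₁) (P₁ := P₁) (C₂ := C₂) (P₂ := P₂)) := by
  rintro (⟨c, i⟩ | ⟨p, i⟩) (⟨d, j⟩ | ⟨q, j⟩) h <;> simp_all [Dart.inL]

theorem Dart.inR_injective : Function.Injective (Dart.inR (C₁ := C₁) (P₁ := P₁) (C₂ := C₂) (P₂ := P₂)) := by
  rintro (⟨c, i⟩ | ⟨p, i⟩) (⟨d, j⟩ | ⟨q, j⟩) h <;> simp_all [Dart.inR]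

theorem Dart.inL_ne_inR (x : Dart C₁ P₁) (y : Dart C₂ P₂) :
    (Dart.inL x : Dart (C₁ ⊕ C₂) (P₁ ⊕ P₂)) ≠ Dart.inR y := by
  rcases x with ⟨c, i⟩ | ⟨p, i⟩ <;> rcases y with ⟨d, j⟩ | ⟨q, j⟩ <;> simp [Dart.inL, Dart.inR]

end Dart

namespace LinkDiagram

/-- A function on half-edges with vanishing sum at each vertex that agrees on the two halves of
each edge but one agrees on the two halves of that edge as well. -/
theorem cycle_edge (D : LinkDiagram) (a : D.Darts) (z : D.Darts → ZMod 2)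
    (hz : ∀ x, x ≠ a → x ≠ D.e a → z (D.e x) = z x)
    (hC : ∀ c, ∑ i : ZMod 4, z (.inl (c, i)) = 0) (hP : ∀ p, ∑ i : ZMod 2, z (.inr (p, i)) = 0) :
    z (D.e a) = z a := by
  have h0 : ∑ x, z x = 0 := by
    rw [Fintype.sum_sum_type, Fintype.sum_prod_type, Fintype.sum_prod_type,
      Finset.sum_eq_zero fun c _ => hC c, Finset.sum_eq_zero fun p _ => hP p, add_zero]
  have h1 : ∑ x ∈ Finset.univ \ {a, D.e a}, z x = 0 := by
    refine Finset.sum_involution (fun x _ => D.e x) ?_ ?_ ?_ ?_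
    · intro x hx
      simp only [Finset.mem_sdiff, Finset.mem_univ, Finset.mem_insert, Finset.mem_singleton,
        true_and, not_or] at hx
      rw [hz x hx.1 hx.2]
      exact CharTwo.add_self_eq_zero _
    · intro x _ _
      exact D.e_ne x
    · intro x hx
      simp only [Finset.mem_sdiff, Finset.mem_univ, Finset.mem_insert, Finset.mem_singleton,
        true_and, not_or] at hx ⊢
      refine ⟨fun h => hx.2 ?_, fun h => hx.1 ?_⟩
      · rw [← h, D.e_e]
      · rw [← D.e_e x, h, D.e_e]
    · intro x _
      exact D.e_e x
  rw [← Finset.sum_sdiff (Finset.subset_univ {a, D.e a}), h1, zero_add,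
    Finset.sum_pair (D.e_ne a).symm] at h0
  exact (CharTwo.add_eq_zero.1 h0).symm

/-- The gluing of half-edges of the connected sum along the half-edges `a₁` and `a₂`. -/
def sumE (D₁ D₂ : LinkDiagram) (a₁ : D₁.Darts) (a₂ : D₂.Darts) :
    Dart (D₁.C ⊕ D₂.C) (D₁.P ⊕ D₂.P) → Dart (D₁.C ⊕ D₂.C) (D₁.P ⊕ D₂.P) :=
  Dart.elim
    (fun x => if x = a₁ then .inR a₂ else if x = D₁.e a₁ then .inR (D₂.e a₂) else .inL (D₁.e x))
    (fun x => if x = a₂ then .inL a₁ else if x = D₂.e a₂ then .inL (D₁.e a₁) else .inR (D₂.e x))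

section SumE

variable (D₁ D₂ : LinkDiagram) (a₁ : D₁.Darts) (a₂ : D₂.Darts)

theorem sumE_left : D₁.sumE D₂ a₁ a₂ (.inL a₁) = .inR a₂ := by
  rw [sumE, Dart.elim_inL, if_pos rfl]

theorem sumE_left' : D₁.sumE D₂ a₁ a₂ (.inL (D₁.e a₁)) = .inR (D₂.e a₂) := by
  rw [sumE, Dart.elim_inL, if_neg (D₁.e_ne a₁), if_pos rfl]

theorem sumE_right : D₁.sumE D₂ a₁ a₂ (.inR a₂) = .inL a₁ := by
  rw [sumE, Dart.elim_inR, if_pos rfl]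

theorem sumE_right' : D₁.sumE D₂ a₁ a₂ (.inR (D₂.e a₂)) = .inL (D₁.e a₁) := by
  rw [sumE, Dart.elim_inR, if_neg (D₂.e_ne a₂), if_pos rfl]

theorem sumE_inL {x : D₁.Darts} (h : x ≠ a₁) (h' : x ≠ D₁.e a₁) :
    D₁.sumE D₂ a₁ a₂ (.inL x) = .inL (D₁.e x) := by
  rw [sumE, Dart.elim_inL, if_neg h, if_neg h']

theorem sumE_inR {x : D₂.Darts} (h : x ≠ a₂) (h' : x ≠ D₂.e a₂) :
    D₁.sumE D₂ a₁ a₂ (.inR x) = .inR (D₂.e x) := by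
  rw [sumE, Dart.elim_inR, if_neg h, if_neg h']

/-- Case distinction for half-edges of a connected sum. -/
theorem sumE_cases {M : Dart (D₁.C ⊕ D₂.C) (D₁.P ⊕ D₂.P) → Prop} (h1 : M (.inL a₁))
    (h2 : M (.inL (D₁.e a₁))) (h3 : M (.inR a₂)) (h4 : M (.inR (D₂.e a₂)))
    (h5 : ∀ x, x ≠ a₁ → x ≠ D₁.e a₁ → M (.inL x)) (h6 : ∀ x, x ≠ a₂ → x ≠ D₂.e a₂ → M (.inR x)) :
    ∀ x, M x := by
  refine Dart.sum_cases (fun x => ?_) (fun x => ?_)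
  · by_cases h : x = a₁
    · rw [h]; exact h1
    · by_cases h' : x = D₁.e a₁
      · rw [h']; exact h2
      · exact h5 x h h'
  · by_cases h : x = a₂
    · rw [h]; exact h3
    · by_cases h' : x = D₂.e a₂
      · rw [h']; exact h4
      · exact h6 x h h'

theorem e_ne_of {D : LinkDiagram} {a x : D.Darts} (h : x ≠ a) (h' : x ≠ D.e a) :
    D.e x ≠ a ∧ D.e x ≠ D.e a :=
  ⟨fun e => h' (by rw [← e, D.e_e]), fun e => h (by rw [← D.e_e x, e, D.e_e])⟩

end SumE

/-- The connected sum of two link diagrams, in which the edge through `a₁` and the edge through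
`a₂` are cut, and `a₁` is joined to `a₂` and the other half of the first edge to the other half of
the second. If necessary, the orientation of the second link is reversed. -/
def connectedSum (D₁ D₂ : LinkDiagram) (a₁ : D₁.Darts) (a₂ : D₂.Darts) : LinkDiagram where
  C := D₁.C ⊕ D₂.C
  P := D₁.P ⊕ D₂.P
  e := D₁.sumE D₂ a₁ a₂
  e_e := by
    refine D₁.sumE_cases D₂ a₁ a₂ ?_ ?_ ?_ ?_ ?_ ?_
    · rw [sumE_left, sumE_right]
    · rw [sumE_left', sumE_right']
    · rw [sumE_right, sumE_left]
    · rw [sumE_right', sumE_left']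
    · intro x h h'
      rw [sumE_inL _ _ _ _ h h', sumE_inL _ _ _ _ (e_ne_of h h').1 (e_ne_of h h').2, D₁.e_e]
    · intro x h h'
      rw [sumE_inR _ _ _ _ h h', sumE_inR _ _ _ _ (e_ne_of h h').1 (e_ne_of h h').2, D₂.e_e]
  e_ne := by
    refine D₁.sumE_cases D₂ a₁ a₂ ?_ ?_ ?_ ?_ ?_ ?_
    · rw [sumE_left]; exact (Dart.inL_ne_inR _ _).symm
    · rw [sumE_left']; exact (Dart.inL_ne_inR _ _).symm
    · rw [sumE_right]; exact Dart.inL_ne_inR _ _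
    · rw [sumE_right']; exact Dart.inL_ne_inR _ _
    · intro x h h'
      rw [sumE_inL _ _ _ _ h h']
      exact fun e => D₁.e_ne x (Dart.inL_injective e)
    · intro x h h'
      rw [sumE_inR _ _ _ _ h h']
      exact fun e => D₂.e_ne x (Dart.inR_injective e)
  o := Dart.elim D₁.o fun x => D₂.o x + (D₁.o a₁ + D₂.o a₂ + 1)
  o_e := by
    have key1 : ∀ r s : ZMod 2, s + (r + s + 1) = r + 1 := by decide
    have key2 : ∀ r s : ZMod 2, s + 1 + (r + s + 1) = r + 1 + 1 := by decide
    have key3 : ∀ r s : ZMod 2, r = s + (r + s + 1) + 1 := by decide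
    have key4 : ∀ r s : ZMod 2, r + 1 = s + 1 + (r + s + 1) + 1 := by decide
    refine D₁.sumE_cases D₂ a₁ a₂ ?_ ?_ ?_ ?_ ?_ ?_
    · rw [sumE_left, Dart.elim_inL, Dart.elim_inR, key1]
    · rw [sumE_left', Dart.elim_inL, Dart.elim_inR, D₁.o_e, D₂.o_e, key2]
    · rw [sumE_right, Dart.elim_inL, Dart.elim_inR]; exact key3 _ _
    · rw [sumE_right', Dart.elim_inL, Dart.elim_inR, D₁.o_e, D₂.o_e]; exact key4 _ _
    · intro x h h'
      rw [sumE_inL _ _ _ _ h h', Dart.elim_inL, Dart.elim_inL, D₁.o_e]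
    · intro x h h'
      rw [sumE_inR _ _ _ _ h h', Dart.elim_inR, Dart.elim_inR, D₂.o_e]
      ring
  o_crossing := by
    rintro (c | c) i
    · exact D₁.o_crossing c i
    · change D₂.o _ + _ = D₂.o _ + _ + 1
      rw [D₂.o_crossing]
      ring
  o_point := by
    rintro (p | p) i
    · exact D₁.o_point p i
    · change D₂.o _ + _ = D₂.o _ + _ + 1
      rw [D₂.o_point]
      ring
  planar := by
    intro z hz hC hP
    have hz1 : ∀ x, x ≠ a₁ → x ≠ D₁.e a₁ → z (.inL (D₁.e x)) = z (.inL x) := fun x h h' => by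
      rw [← hz (.inL x), sumE_inL _ _ _ _ h h']
    have hz2 : ∀ x, x ≠ a₂ → x ≠ D₂.e a₂ → z (.inR (D₂.e x)) = z (.inR x) := fun x h h' => by
      rw [← hz (.inR x), sumE_inR _ _ _ _ h h']
    have ha1 : z (.inL (D₁.e a₁)) = z (.inL a₁) :=
      D₁.cycle_edge a₁ (fun x => z (.inL x)) hz1 (fun c => hC (.inl c)) (fun p => hP (.inl p))
    have ha2 : z (.inR (D₂.e a₂)) = z (.inR a₂) :=
      D₂.cycle_edge a₂ (fun x => z (.inR x)) hz2 (fun c => hC (.inr c)) (fun p => hP (.inr p))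
    have h12 : z (.inR a₂) = z (.inL a₁) := by
      rw [← hz (.inL a₁), sumE_left]
    obtain ⟨g₁, hg1, hg1'⟩ := D₁.planar (fun x => z (.inL x)) (fun x => by
      by_cases h : x = a₁
      · rw [h]; exact ha1
      · by_cases h' : x = D₁.e a₁
        · rw [h', D₁.e_e]; exact ha1.symm
        · exact hz1 x h h') (fun c => hC (.inl c)) (fun p => hP (.inl p))
    obtain ⟨g₂, hg2, hg2'⟩ := D₂.planar (fun x => z (.inR x)) (fun x => by
      by_cases h : x = a₂
      · rw [h]; exact ha2
      · by_cases h' : x = D₂.e a₂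
        · rw [h', D₂.e_e]; exact ha2.symm
        · exact hz2 x h h') (fun c => hC (.inr c)) (fun p => hP (.inr p))
    have flip : ∀ a b c : ZMod 2, c = a + b → b = a + c := by decide
    have p1 : g₁ (Dart.prev a₁) = g₁ a₁ + z (.inL a₁) := flip _ _ _ (hg1' a₁)
    have p2 : g₂ (Dart.prev a₂) = g₂ a₂ + z (.inL a₁) := by
      rw [← h12]
      exact flip _ _ _ (hg2' a₂)
    have q1 : g₁ (Dart.prev (D₁.e a₁)) = g₁ a₁ := hg1 a₁
    have q2 : g₂ (Dart.prev (D₂.e a₂)) = g₂ a₂ := hg2 a₂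
    have r1 : g₁ (D₁.e a₁) = g₁ a₁ + z (.inL a₁) := by
      rw [← p1, ← hg1 (D₁.e a₁), D₁.e_e]
    have r2 : g₂ (D₂.e a₂) = g₂ a₂ + z (.inL a₁) := by
      rw [← p2, ← hg2 (D₂.e a₂), D₂.e_e]
    have k1 : ∀ a b c : ZMod 2, b + c + (a + b + c) = a := by decide
    have k2 : ∀ a b c : ZMod 2, b + (a + b + c) = a + c := by decide
    refine ⟨Dart.elim g₁ fun x => g₂ x + (g₁ a₁ + g₂ a₂ + z (.inL a₁)), ?_, ?_⟩
    · refine D₁.sumE_cases D₂ a₁ a₂ ?_ ?_ ?_ ?_ ?_ ?_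
      · rw [sumE_left, Dart.prev_inR, Dart.elim_inL, Dart.elim_inR, p2, k1]
      · rw [sumE_left', Dart.prev_inR, Dart.elim_inL, Dart.elim_inR, q2, r1, k2]
      · rw [sumE_right, Dart.prev_inL, Dart.elim_inL, Dart.elim_inR, p1, k2]
      · rw [sumE_right', Dart.prev_inL, Dart.elim_inL, Dart.elim_inR, q1, r2, k1]
      · intro x h h'
        rw [sumE_inL _ _ _ _ h h', Dart.prev_inL, Dart.elim_inL, Dart.elim_inL, hg1]
      · intro x h h'
        rw [sumE_inR _ _ _ _ h h', Dart.prev_inR, Dart.elim_inR, Dart.elim_inR, hg2]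
    · refine Dart.sum_cases (fun x => ?_) (fun x => ?_)
      · rw [Dart.prev_inL, Dart.elim_inL, Dart.elim_inL]
        exact hg1' x
      · rw [Dart.prev_inR, Dart.elim_inR, Dart.elim_inR]
        have k3 : ∀ a b c : ZMod 2, a + c + (b + c) = a + b := by decide
        rw [k3]
        exact hg2' x

end LinkDiagram

namespace TransvergentDiagram

/-- An equivariant basepoint: a point in which an edge of the diagram crosses the axis, together
with one of the two halves of the edge. -/
abbrev Basepoint (D : TransvergentDiagram) : Type := {a : D.Darts // D.e a = D.t a}

/-- The reflection of the connected sum. -/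
def sumReflect (D₁ D₂ : TransvergentDiagram) :
    Dart (D₁.C ⊕ D₂.C) (D₁.P ⊕ D₂.P) → Dart (D₁.C ⊕ D₂.C) (D₁.P ⊕ D₂.P) :=
  Dart.reflect (Sum.map D₁.tC D₂.tC) (Sum.elim D₁.kC D₂.kC) (Sum.map D₁.tP D₂.tP)
    (Sum.elim D₁.kP D₂.kP)

theorem reflect_inL (D₁ D₂ : TransvergentDiagram) (x : D₁.Darts) :
    D₁.sumReflect D₂ (.inL x) = .inL (D₁.t x) := by
  rcases x with ⟨c, i⟩ | ⟨p, i⟩ <;> rfl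

theorem reflect_inR (D₁ D₂ : TransvergentDiagram) (x : D₂.Darts) :
    D₁.sumReflect D₂ (.inR x) = .inR (D₂.t x) := by
  rcases x with ⟨c, i⟩ | ⟨p, i⟩ <;> rfl

theorem t_ne_of {D : TransvergentDiagram} {a x : D.Darts} (ha : D.e a = D.t a) (h : x ≠ a)
    (h' : x ≠ D.e a) : D.t x ≠ a ∧ D.t x ≠ D.e a :=
  ⟨fun e => h' (by rw [ha, ← e, D.t_t']), fun e => h (by rw [← D.t_t' x, e, ha, D.t_t'])⟩

theorem sum_t_t (D₁ D₂ : TransvergentDiagram) (x : Dart (D₁.C ⊕ D₂.C) (D₁.P ⊕ D₂.P)) :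
    D₁.sumReflect D₂ (D₁.sumReflect D₂ x) = x := by
  revert x
  refine Dart.sum_cases (fun x => ?_) (fun x => ?_)
  · rw [reflect_inL, reflect_inL, t_t']
  · rw [reflect_inR, reflect_inR, t_t']

theorem sum_t_e (D₁ D₂ : TransvergentDiagram) {a₁ : D₁.Darts} {a₂ : D₂.Darts}
    (h₁ : D₁.e a₁ = D₁.t a₁) (h₂ : D₂.e a₂ = D₂.t a₂) :
    ∀ x, D₁.sumReflect D₂ (D₁.sumE D₂.toLinkDiagram a₁ a₂ x) =
      D₁.sumE D₂.toLinkDiagram a₁ a₂ (D₁.sumReflect D₂ x) := by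
  have e1 : D₁.t (D₁.e a₁) = a₁ := by rw [h₁, t_t']
  have e2 : D₂.t (D₂.e a₂) = a₂ := by rw [h₂, t_t']
  refine LinkDiagram.sumE_cases _ _ a₁ a₂ ?_ ?_ ?_ ?_ ?_ ?_
  · rw [LinkDiagram.sumE_left, reflect_inR, reflect_inL, ← h₁, ← h₂, LinkDiagram.sumE_left']
  · rw [LinkDiagram.sumE_left', reflect_inR, reflect_inL, e1, e2, LinkDiagram.sumE_left]
  · rw [LinkDiagram.sumE_right, reflect_inR, reflect_inL, ← h₁, ← h₂, LinkDiagram.sumE_right']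
  · rw [LinkDiagram.sumE_right', reflect_inR, reflect_inL, e1, e2, LinkDiagram.sumE_right]
  · intro x h h'
    rw [LinkDiagram.sumE_inL _ _ _ _ h h', reflect_inL, reflect_inL,
      LinkDiagram.sumE_inL _ _ _ _ (t_ne_of h₁ h h').1 (t_ne_of h₁ h h').2]
    exact congrArg _ (D₁.t_e x)
  · intro x h h'
    rw [LinkDiagram.sumE_inR _ _ _ _ h h', reflect_inR, reflect_inR,
      LinkDiagram.sumE_inR _ _ _ _ (t_ne_of h₂ h h').1 (t_ne_of h₂ h h').2]
    exact congrArg _ (D₂.t_e x)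

theorem sum_axis (D₁ D₂ : TransvergentDiagram) {a₁ : D₁.Darts} {a₂ : D₂.Darts}
    (h₁ : D₁.e a₁ = D₁.t a₁) (h₂ : D₂.e a₂ = D₂.t a₂) :
    ∃ side : Dart (D₁.C ⊕ D₂.C) (D₁.P ⊕ D₂.P) → Bool,
      (∀ x, side (D₁.sumReflect D₂ x) = !side x) ∧
      (∀ x, D₁.sumE D₂.toLinkDiagram a₁ a₂ x ≠ D₁.sumReflect D₂ x →
        side (D₁.sumE D₂.toLinkDiagram a₁ a₂ x) = side x) ∧
      ∀ x, Dart.prev x ≠ D₁.sumReflect D₂ x → side (Dart.prev x) = side x := by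
  obtain ⟨s₁, s₁t, s₁e, s₁p⟩ := D₁.axis
  obtain ⟨s₂, s₂t, s₂e, s₂p⟩ := D₂.axis
  have e1 : s₁ (D₁.e a₁) = !s₁ a₁ := by rw [h₁]; exact s₁t a₁
  have e2 : s₂ (D₂.e a₂) = !s₂ a₂ := by rw [h₂]; exact s₂t a₂
  refine ⟨Dart.elim s₁ fun x => xor (s₂ x) (xor (s₁ a₁) (s₂ a₂)), ?_, ?_, ?_⟩
  · refine Dart.sum_cases (fun x => ?_) (fun x => ?_)
    · rw [reflect_inL, Dart.elim_inL, Dart.elim_inL]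
      exact s₁t x
    · rw [reflect_inR, Dart.elim_inR, Dart.elim_inR]
      have := s₂t x
      change s₂ (D₂.t x) = _ at this
      rw [this, Bool.not_xor]
  · refine LinkDiagram.sumE_cases _ _ a₁ a₂ ?_ ?_ ?_ ?_ ?_ ?_
    · intro _
      rw [LinkDiagram.sumE_left, Dart.elim_inL, Dart.elim_inR]
      cases s₁ a₁ <;> cases s₂ a₂ <;> rfl
    · intro _
      rw [LinkDiagram.sumE_left', Dart.elim_inL, Dart.elim_inR, e1, e2]
      cases s₁ a₁ <;> cases s₂ a₂ <;> rfl
    · intro _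
      rw [LinkDiagram.sumE_right, Dart.elim_inL, Dart.elim_inR]
      cases s₁ a₁ <;> cases s₂ a₂ <;> rfl
    · intro _
      rw [LinkDiagram.sumE_right', Dart.elim_inL, Dart.elim_inR, e1, e2]
      cases s₁ a₁ <;> cases s₂ a₂ <;> rfl
    · intro x h h' hne
      rw [LinkDiagram.sumE_inL _ _ _ _ h h', reflect_inL] at hne
      rw [LinkDiagram.sumE_inL _ _ _ _ h h', Dart.elim_inL, Dart.elim_inL]
      exact s₁e x fun e => hne (congrArg _ e)
    · intro x h h' hne
      rw [LinkDiagram.sumE_inR _ _ _ _ h h', reflect_inR] at hne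
      rw [LinkDiagram.sumE_inR _ _ _ _ h h', Dart.elim_inR, Dart.elim_inR]
      rw [s₂e x fun e => hne (congrArg _ e)]
  · refine Dart.sum_cases (fun x hne => ?_) (fun x hne => ?_)
    · rw [Dart.prev_inL, reflect_inL] at hne
      rw [Dart.prev_inL, Dart.elim_inL, Dart.elim_inL]
      exact s₁p x fun e => hne (congrArg _ e)
    · rw [Dart.prev_inR, reflect_inR] at hne
      rw [Dart.prev_inR, Dart.elim_inR, Dart.elim_inR]
      rw [s₂p x fun e => hne (congrArg _ e)]

/-- The equivariant connected sum of two transvergent diagrams at equivariant basepoints: the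
diagrams are placed along a common axis, the edges through the basepoints are cut at the axis, and
the ends on the same side of the axis are joined. -/
def connectedSum (D₁ D₂ : TransvergentDiagram) (b₁ : D₁.Basepoint) (b₂ : D₂.Basepoint) :
    TransvergentDiagram where
  toLinkDiagram := D₁.toLinkDiagram.connectedSum D₂.toLinkDiagram b₁.1 b₂.1
  tC := Sum.map D₁.tC D₂.tC
  tP := Sum.map D₁.tP D₂.tP
  kC := Sum.elim D₁.kC D₂.kC
  kP := Sum.elim D₁.kP D₂.kP
  kC_odd := by
    rintro (c | c)
    · exact D₁.kC_odd c
    · exact D₂.kC_odd c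
  t_t := D₁.sum_t_t D₂
  t_e := D₁.sum_t_e D₂ b₁.2 b₂.2
  axis := D₁.sum_axis D₂ b₁.2 b₂.2

end TransvergentDiagram

end KoszulBorel

end

/-!
The theorem has an algebraic and a topological half. Let `C₁`, `C₂` be the reduced complexes of the
two diagrams, with their actions of `τ`.

*Algebra*: for all complexes `C₁`, `C₂` over `R[τ]/(τ² + 1)`, the Borel construction of `C₁ ⊗ C₂` is
equivalent to `Br (Hh (Br C₁) ⊗ Hh (Br C₂))` (`borel_tensor_equivalent`). An element of `Hh (Br C)`
is a pair of elements of `C[Q]`, its values at `1` and `τ`. The unit `C → Hh (Br C)`,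
`c ↦ (c, τ c)`, is linear over `τ`, and it is the inclusion of a deformation retract over `R`: the
retraction is the constant coefficient of the value at `1`, and the homotopy divides the value at
`1` by `Q` and moves it to `τ` (`HhBasis.unit`). Retractions can be tensored (`Retraction.tensor`).
For an inclusion that is linear over `τ`, the homological perturbation lemma for the perturbation
`Q (1 + τ)` gives an equivalence of Borel constructions, although the retraction and the homotopy do
not commute with `τ` (`Retraction.borel_equivalent`). The series in it is locally finite, as
the homotopy lowers the degree in the variable `Q` of `Hh (Br C)`, which `τ` preserves
(`Retraction.Filtration.tensor_nilpotent`). Finally `Br` is the Borel construction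
(`borel_equivalent_Br`).

*Topology*: the reduced complex of the connected sum is isomorphic to `C₁ ⊗ C₂`, with the diagonal
action of `τ`. In each resolution, the circles of the connected sum are those of the summands with
the circles through the basepoints identified, and the reduced algebra, which is generated by the
`x_c + x_a` for a fixed basepoint `a`, becomes the tensor product of the reduced algebras
(`ConnectedSumData.splitMap_mulMap`, `ConnectedSumData.mulMap_splitMap`). These isomorphisms are
compatible with the differential (`ConnectedSumData.sumMap_d`) and with the involutions
(`ConnectedSumData.sumMap_tau`).
-/

open scoped TensorProduct

noncomputable section

namespace KoszulBorel

/-! ### Homotopy equivalences -/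

/-- An injective homogeneous map reflects degrees, so that the inverse of a bijective one is
homogeneous as well. -/
theorem mem_of_map_mem {ι M N : Type} [DecidableEq ι] [AddCommGroup M] [AddCommGroup N]
    {G : ι → AddSubgroup M} {H : ι → AddSubgroup N} (hG : DirectSum.IsInternal G)
    (hH : DirectSum.IsInternal H) (f : M →+ N) (hf : Function.Injective f)
    (h : ∀ i, ∀ m ∈ G i, f m ∈ H i) {i : ι} {m : M} (hm : f m ∈ H i) : m ∈ G i := by
  obtain ⟨DG, hDG⟩ := exists_delta hG
  obtain ⟨DH, hDH⟩ := exists_delta hH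
  have comm : ∀ m, DH (f m) = Finsupp.mapRange.addMonoidHom f (DG m) := by
    intro m
    induction isInternal_mem_iSup hG m using AddSubgroup.iSup_induction' with
    | h1 => simp
    | hadd x y _ _ hx hy => rw [map_add, map_add, hx, hy, map_add, map_add]
    | hp j x hx => rw [hDH _ _ (h _ _ hx), hDG _ _ hx]; simp
  have hcomp : ∀ m, DG m i ∈ G i := by
    intro m
    induction isInternal_mem_iSup hG m using AddSubgroup.iSup_induction' with
    | h1 => simp
    | hadd x y _ _ hx hy => rw [map_add]; exact add_mem hx hy
    | hp j x hx =>
      rw [hDG _ _ hx]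
      by_cases hij : i = j
      · subst hij; simpa using hx
      · rw [Finsupp.single_eq_of_ne hij]; exact zero_mem _
  have : f (DG m i) = f m := by
    have := DFunLike.congr_fun (comm m) i
    rw [hDH _ _ hm, Finsupp.single_eq_same] at this
    simpa using this.symm
  rw [← hf this]
  exact hcomp m

section HomotopyEquivalent

variable {S : Type} [CommRing S] [Algebra Base S] {s : S} {δ : ℤ × ℤ}

theorem HomotopyEquivalent.of_bijective {A B : BigradedComplex S s δ}
    (f : A.carrier →ₗ[S] B.carrier) (hf : Function.Bijective f)
    (hgr : ∀ n, ∀ x ∈ A.gr n, f x ∈ B.gr n) (hd : ∀ x, f (A.d x) = B.d (f x)) :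
    HomotopyEquivalent A B := by
  let e := LinearEquiv.ofBijective f hf
  have he : ∀ x, e x = f x := fun _ => rfl
  refine ⟨f, e.symm, 0, 0, hgr, ?_, fun _ _ _ => zero_mem _, fun _ _ _ => zero_mem _, hd,
    ?_, ?_, ?_⟩
  · intro n y hy
    refine mem_of_map_mem A.isInternal B.isInternal f.toAddMonoidHom hf.1 hgr ?_
    change f (e.symm y) ∈ _
    rwa [← he, e.apply_symm_apply]
  · intro y
    rw [LinearEquiv.coe_coe, LinearEquiv.symm_apply_eq, he, hd, ← he, e.apply_symm_apply]
  · intro x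
    rw [← he, LinearEquiv.coe_coe, e.symm_apply_apply]; simp
  · intro y
    rw [← he, LinearEquiv.coe_coe, e.apply_symm_apply]; simp

theorem HomotopyEquivalent.trans {A B C : BigradedComplex S s δ} (h₁ : HomotopyEquivalent A B)
    (h₂ : HomotopyEquivalent B C) : HomotopyEquivalent A C := by
  obtain ⟨f, g, h, k, hf, hg, hh, hk, fd, gd, hA, hB⟩ := h₁
  obtain ⟨f', g', h', k', hf', hg', hh', hk', fd', gd', hB', hC⟩ := h₂
  refine ⟨f'.comp f, g.comp g', h + g.comp (h'.comp f), k' + f'.comp (k.comp g'),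
    fun n x hx => hf' _ _ (hf _ _ hx), fun n x hx => hg _ _ (hg' _ _ hx), ?_, ?_, ?_, ?_, ?_, ?_⟩
  · exact fun n x hx => add_mem (hh _ _ hx) (hg _ _ (hh' _ _ (hf _ _ hx)))
  · exact fun n x hx => add_mem (hk' _ _ hx) (hf' _ _ (hk _ _ (hg' _ _ hx)))
  · intro x
    simp only [LinearMap.comp_apply, fd, fd']
  · intro x
    simp only [LinearMap.comp_apply, gd, gd']
  · intro x
    have h1 := congrArg g (hB' (f x))
    have h2 := hA x
    simp only [LinearMap.comp_apply, LinearMap.add_apply, map_add, map_sub, fd, gd] at h1 h2 ⊢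
    rw [← sub_add_sub_cancel _ (g (f x)), h1, h2]
    abel
  · intro x
    have h1 := congrArg f' (hB (g' x))
    have h2 := hC x
    simp only [LinearMap.comp_apply, LinearMap.add_apply, map_add, map_sub, fd', gd'] at h1 h2 ⊢
    rw [← sub_add_sub_cancel _ (f' (g' x)), h1, h2]
    abel

end HomotopyEquivalent

/-! ### Homological perturbation -/

section Unipotent

variable {S M : Type} [CommRing S] [AddCommGroup M] [Module S M]

/-- The telescoping geometric series in characteristic `2`. -/
theorem one_add_mul_sum (h2 : ∀ m : M, m + m = 0) (N : Module.End S M) (n : ℕ) (m : M) :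
    (1 + N) (∑ i ∈ Finset.range n, (N ^ i) m) = m + (N ^ n) m := by
  induction n with
  | zero => simp [h2]
  | succ n ih =>
    rw [Finset.sum_range_succ, map_add, ih, LinearMap.add_apply, Module.End.one_apply,
      ← Module.End.mul_apply, ← pow_succ', add_assoc, ← add_assoc ((N ^ n) m), h2, zero_add]

theorem bijective_one_add (h2 : ∀ m : M, m + m = 0) {N : Module.End S M}
    (hN : ∀ m, ∃ n, (N ^ n) m = 0) : Function.Bijective (1 + N : Module.End S M) := by
  constructor
  · rw [injective_iff_map_eq_zero]
    intro m hm
    have hm' : N m = m := by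
      rw [LinearMap.add_apply, Module.End.one_apply] at hm
      rw [← add_right_inj m, hm, h2]
    obtain ⟨n, hn⟩ := hN m
    have : ∀ k : ℕ, (N ^ k) m = m := by
      intro k
      induction k with
      | zero => simp
      | succ k ih => rw [pow_succ, Module.End.mul_apply, hm', ih]
    rw [← this n, hn]
  · intro m
    obtain ⟨n, hn⟩ := hN m
    exact ⟨_, (one_add_mul_sum h2 N n m).trans (by rw [hn, add_zero])⟩

/-- The inverse of `1 + N` for a locally nilpotent `N`, in characteristic `2`. -/
theorem exists_inverse_one_add (h2 : ∀ m : M, m + m = 0) {N : Module.End S M}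
    (hN : ∀ m, ∃ n, (N ^ n) m = 0) : ∃ T : Module.End S M, (1 + N) * T = 1 ∧ T * (1 + N) = 1 ∧
      ∀ m, ∃ n, T m = ∑ i ∈ Finset.range n, (N ^ i) m := by
  let e := LinearEquiv.ofBijective (1 + N) (bijective_one_add h2 hN)
  refine ⟨e.symm, ?_, ?_, fun m => ?_⟩
  · exact LinearMap.ext fun x => e.apply_symm_apply x
  · exact LinearMap.ext fun x => e.symm_apply_apply x
  · obtain ⟨n, hn⟩ := hN m
    refine ⟨n, ?_⟩
    rw [LinearEquiv.coe_coe, LinearEquiv.symm_apply_eq]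
    exact ((one_add_mul_sum h2 N n m).trans (by rw [hn, add_zero])).symm

end Unipotent

/-- A deformation retraction of a complex `X` over `R[τ]/(τ² + 1)` onto a complex `C`: the
inclusion commutes with `τ`, while the retraction and the homotopy are only `R`-linear. Signs are
irrelevant in characteristic `2`. -/
structure Retraction (C X : KomTau) where
  inc : C.carrier →ₗ[Base] X.carrier
  ret : X.carrier →ₗ[Base] C.carrier
  hom : X.carrier →ₗ[Base] X.carrier
  inc_mem : ∀ n, ∀ c ∈ C.gr n, inc c ∈ X.gr n
  ret_mem : ∀ n, ∀ x ∈ X.gr n, ret x ∈ C.gr n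
  hom_mem : ∀ n, ∀ x ∈ X.gr n, hom x ∈ X.gr (n + (-1, 0))
  inc_tau : ∀ c, inc (C.tauMap c) = X.tauMap (inc c)
  inc_d : ∀ c, inc (C.dBase c) = X.dBase (inc c)
  ret_d : ∀ x, ret (X.dBase x) = C.dBase (ret x)
  ret_inc : ∀ c, ret (inc c) = c
  hom_inc : ∀ c, hom (inc c) = 0
  inc_ret : ∀ x, inc (ret x) = x + (X.dBase (hom x) + hom (X.dBase x))

theorem baseChange_mem {C X : KomTau} (f : C.carrier →ₗ[Base] X.carrier) {δ : ℤ × ℤ}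
    (hf : ∀ n, ∀ c ∈ C.gr n, f c ∈ X.gr (n + δ)) (n : ℤ × ℤ) (z : (borel C).carrier)
    (hz : z ∈ (borel C).gr n) :
    (f.baseChange QRing z : (borel X).carrier) ∈ (borel X).gr (n + δ) := by
  refine tensorGr_map_mem (P := QRing ⊗[Base] X.carrier)
    ((f.baseChange QRing).restrictScalars Base).toAddMonoidHom ?_ hz
  rintro i j rfl x hx y hy
  exact tmul_mem_tensorGr (by abel) hx (hf _ _ hy)

theorem baseChange_mem_zero {C X : KomTau} (f : C.carrier →ₗ[Base] X.carrier)
    (hf : ∀ n, ∀ c ∈ C.gr n, f c ∈ X.gr n) (n : ℤ × ℤ) (z : (borel C).carrier)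
    (hz : z ∈ (borel C).gr n) :
    (f.baseChange QRing z : (borel X).carrier) ∈ (borel X).gr n := by
  have := baseChange_mem f (δ := 0) (fun n c hc => by rw [add_zero]; exact hf n c hc) n z hz
  rwa [add_zero] at this

/-- The commutation defect of a differential `d` with the inverse `T` of `1 + δ * H`, where `δ` is
the perturbation, `H` the homotopy and `e = 1 + d * H + H * d` the projection. -/
theorem perturbation_defect {E : Type} [Semiring E] (h2 : ∀ x : E, x + x = 0) {d δ H T e : E}
    (hdδ : d * δ = δ * d) (hδδ : δ * δ = 0) (he : e = 1 + (d * H + H * d))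
    (hT : (1 + δ * H) * T = 1) (hT' : T * (1 + δ * H) = 1) :
    d * T + (T * d + T * δ) = T * (δ * e) * T := by
  have key : (1 + δ * H) * d + (d * (1 + δ * H) + δ * (1 + δ * H)) = δ * e := by
    have h3 : d * (δ * H) = δ * (d * H) := by rw [← mul_assoc, hdδ, mul_assoc]
    have h4 : δ * (δ * H) = 0 := by rw [← mul_assoc, hδδ, zero_mul]
    have h5 : ∀ a b : E, d + a + (d + b + (δ + 0)) = δ + (b + a) + (d + d) := fun a b => by abel
    rw [he, add_mul, mul_add, mul_add, mul_add, mul_add, h3, h4, one_mul, mul_one, mul_one,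
      mul_assoc, h5, h2, add_zero]
  have h5 : T * ((1 + δ * H) * d + (d * (1 + δ * H) + δ * (1 + δ * H))) * T =
      d * T + (T * d + T * δ) := by
    rw [mul_add, add_mul, ← mul_assoc, hT', one_mul, mul_add, add_mul, ← mul_assoc, mul_assoc, hT,
      mul_one, ← mul_assoc T δ, mul_assoc (T * δ), hT, mul_one]
  rw [← h5, key]

/-- The homological perturbation lemma for the perturbation `δ = Q (1 + τ)` of the differential `d`
of `X[Q]`. With the inclusion `i`, the retraction `p`, the homotopy `H` and `T = (1 + δ H)⁻¹`, the
maps of the homotopy equivalence are `i` and `p T`, with the homotopy `H T`. As `i` commutes with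
`τ`, the perturbation lemma changes neither `i` nor the differential `d + δ` of `C[Q]`. -/
theorem Retraction.borel_equivalent {C X : KomTau} (r : Retraction C X)
    (hN : ∀ x, ∃ n,
      (((LinearMap.id + X.tauMap).comp r.hom : Module.End Base X.carrier) ^ n) x = 0) :
    HomotopyEquivalent (borel C) (borel X) := by
  have h2 : ∀ m : QRing ⊗[Base] X.carrier, m + m = 0 := fun m => add_self_eq_zero m
  have h2' : ∀ m : QRing ⊗[Base] C.carrier, m + m = 0 := fun m => add_self_eq_zero m
  let d : Module.End QRing (QRing ⊗[Base] X.carrier) := X.dBase.baseChange QRing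
  let dC : Module.End QRing (QRing ⊗[Base] C.carrier) := C.dBase.baseChange QRing
  let δ : Module.End QRing (QRing ⊗[Base] X.carrier) :=
    Q • (LinearMap.id + X.tauMap).baseChange QRing
  let δC : Module.End QRing (QRing ⊗[Base] C.carrier) :=
    Q • (LinearMap.id + C.tauMap).baseChange QRing
  let H : Module.End QRing (QRing ⊗[Base] X.carrier) := r.hom.baseChange QRing
  let i := r.inc.baseChange QRing
  let p := r.ret.baseChange QRing
  have hD : ∀ z, (borel X).d z = d z + δ z := fun _ => rfl
  have hDC : ∀ z, (borel C).d z = dC z + δC z := fun _ => rfl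
  have ed : ∀ q x, d (q ⊗ₜ x) = q ⊗ₜ X.dBase x := fun _ _ => rfl
  have edC : ∀ q x, dC (q ⊗ₜ x) = q ⊗ₜ C.dBase x := fun _ _ => rfl
  have eδ : ∀ q x, δ (q ⊗ₜ x) = (Q * q) ⊗ₜ (x + X.tauMap x) := fun _ _ => rfl
  have eδC : ∀ q x, δC (q ⊗ₜ x) = (Q * q) ⊗ₜ (x + C.tauMap x) := fun _ _ => rfl
  have eH : ∀ q x, H (q ⊗ₜ x) = q ⊗ₜ r.hom x := fun _ _ => rfl
  have ei : ∀ q x, i (q ⊗ₜ x) = q ⊗ₜ r.inc x := fun _ _ => rfl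
  have ep : ∀ q x, p (q ⊗ₜ x) = q ⊗ₜ r.ret x := fun _ _ => rfl
  have hdδ : d * δ = δ * d := by
    refine TensorProduct.AlgebraTensorModule.ext fun q x => ?_
    simp only [Module.End.mul_apply, ed, eδ, map_add, KomTau.dBase_tauMap]
  have hδδ : δ * δ = 0 := by
    refine TensorProduct.AlgebraTensorModule.ext fun q x => ?_
    simp only [Module.End.mul_apply, eδ, map_add, KomTau.tauMap_tauMap, LinearMap.zero_apply]
    rw [add_comm (X.tauMap x) x, add_self_eq_zero (x + X.tauMap x), TensorProduct.tmul_zero]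
  have he : i ∘ₗ p = 1 + (d * H + H * d) := by
    refine TensorProduct.AlgebraTensorModule.ext fun q x => ?_
    simp only [LinearMap.comp_apply, LinearMap.add_apply, Module.End.mul_apply, ed, eH, ep, ei,
      Module.End.one_apply, r.inc_ret, TensorProduct.tmul_add]
  have hHi : H ∘ₗ i = 0 := by
    refine TensorProduct.AlgebraTensorModule.ext fun q x => ?_
    simp only [LinearMap.comp_apply, eH, ei, r.hom_inc, TensorProduct.tmul_zero,
      LinearMap.zero_apply]
  have hpi : p ∘ₗ i = LinearMap.id := by
    refine TensorProduct.AlgebraTensorModule.ext fun q x => ?_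
    simp only [LinearMap.comp_apply, ep, ei, r.ret_inc, LinearMap.id_apply]
  have hdi : d ∘ₗ i = i ∘ₗ dC := by
    refine TensorProduct.AlgebraTensorModule.ext fun q x => ?_
    simp only [LinearMap.comp_apply, ed, edC, ei, r.inc_d]
  have hδi : δ ∘ₗ i = i ∘ₗ δC := by
    refine TensorProduct.AlgebraTensorModule.ext fun q x => ?_
    simp only [LinearMap.comp_apply, eδ, eδC, ei, map_add, r.inc_tau]
  have hpd : p ∘ₗ d = dC ∘ₗ p := by
    refine TensorProduct.AlgebraTensorModule.ext fun q x => ?_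
    simp only [LinearMap.comp_apply, ed, edC, ep, r.ret_d]
  have hδH : ∀ n q x, ((δ * H) ^ n) (q ⊗ₜ x) = (Q ^ n * q) ⊗ₜ
      ((((LinearMap.id + X.tauMap).comp r.hom : Module.End Base X.carrier) ^ n) x) := by
    intro n
    induction n with
    | zero => intro q x; simp
    | succ n ih =>
      intro q x
      rw [pow_succ, Module.End.mul_apply, Module.End.mul_apply, eH, eδ, ih, pow_succ, pow_succ,
        mul_assoc]
      rfl
  -- `Q ^ n` never vanishes, so the series for `T` is locally finite only because `(1 + τ) h` is
  -- locally nilpotent on `X` itself.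
  have hnil : ∀ z, ∃ n, ((δ * H) ^ n) z = 0 := by
    intro z
    induction z using TensorProduct.induction_on with
    | zero => exact ⟨0, map_zero _⟩
    | tmul q x =>
      obtain ⟨n, hn⟩ := hN x
      exact ⟨n, by rw [hδH, hn, TensorProduct.tmul_zero]⟩
    | add x y hx hy =>
      obtain ⟨n, hn⟩ := hx
      obtain ⟨m, hm⟩ := hy
      refine ⟨n + m, ?_⟩
      rw [map_add, pow_add, Module.End.mul_apply _ _ y, hm, ← pow_add, add_comm n m, pow_add,
        Module.End.mul_apply, hn, map_zero, map_zero, add_zero]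
  obtain ⟨T, hT, hT', hTsum⟩ := exists_inverse_one_add (S := QRing)
    (M := QRing ⊗[Base] X.carrier) (N := δ * H) h2 hnil
  have hTi : T ∘ₗ i = i := by
    have : (1 + δ * H) ∘ₗ i = i := by
      rw [LinearMap.add_comp, Module.End.mul_eq_comp, LinearMap.comp_assoc, hHi,
        LinearMap.comp_zero, add_zero]
      rfl
    conv_lhs => rw [← this, ← LinearMap.comp_assoc, ← Module.End.mul_eq_comp, hT']
    rfl
  have defect : d * T + (T * d + T * δ) = i ∘ₗ δC ∘ₗ p ∘ₗ T := by
    rw [perturbation_defect (E := Module.End QRing (QRing ⊗[Base] X.carrier))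
      (fun x => LinearMap.ext fun m => h2 (x m)) hdδ hδδ he hT hT']
    have : T * (δ * i ∘ₗ p) = i ∘ₗ δC ∘ₗ p := by
      rw [Module.End.mul_eq_comp, Module.End.mul_eq_comp, ← LinearMap.comp_assoc p i δ, hδi,
        LinearMap.comp_assoc, ← LinearMap.comp_assoc _ i T, hTi]
    rw [this]
    rfl
  have defect' : ∀ z, d (T z) + (T (d z) + T (δ z)) = i (δC (p (T z))) := fun z =>
    LinearMap.congr_fun defect z
  have hTmem : ∀ n, ∀ z ∈ (borel X).gr n, T z ∈ (borel X).gr n := by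
    intro n z hz
    have hNmem : ∀ n, ∀ z ∈ (borel X).gr n, (δ * H) z ∈ (borel X).gr n := by
      intro n z hz
      have h := baseChange_mem r.hom r.hom_mem n z hz
      have h' := baseChange_mem_zero (LinearMap.id + X.tauMap)
        (fun n c hc => add_mem hc (X.tauMap_mem n c hc)) _ _ h
      have h'' := (borel X).s_smul_mem _ _ h'
      have e : n + (-1, 0) + ((1 : ℤ), (0 : ℤ)) = n := by ext <;> simp
      rwa [e] at h''
    obtain ⟨k, hk⟩ := hTsum z
    rw [hk]
    refine sum_mem fun j hj => ?_
    clear hj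
    induction j with
    | zero => exact hz
    | succ j ih => rw [pow_succ']; exact hNmem n _ ih
  have neg : ∀ a b : QRing ⊗[Base] X.carrier, a - b = a + b := fun a b => by
    rw [sub_eq_iff_eq_add, add_assoc, h2, add_zero]
  have f_d : ∀ z, i (dC z + δC z) = d (i z) + δ (i z) := fun z => by
    rw [map_add]
    exact congrArg₂ (· + ·) (LinearMap.congr_fun hdi z).symm (LinearMap.congr_fun hδi z).symm
  have g_d : ∀ z, p (T (d z + δ z)) = dC (p (T z)) + δC (p (T z)) := fun z => by
    have h := congrArg p (defect' z)
    have e1 : p (d (T z)) = dC (p (T z)) := LinearMap.congr_fun hpd (T z)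
    have e2 : p (i (δC (p (T z)))) = δC (p (T z)) := LinearMap.congr_fun hpi (δC (p (T z)))
    rw [map_add, map_add p, e1, e2] at h
    rw [map_add T, map_add p, ← h, ← map_add p (T _), ← add_assoc, h2', zero_add]
  have g_f : ∀ z, p (T (i z)) - z = (dC 0 + δC 0) + 0 := fun z => by
    have e1 : T (i z) = i z := LinearMap.congr_fun hTi z
    have e2 : p (i z) = z := LinearMap.congr_fun hpi z
    rw [e1, e2, sub_self, map_zero, map_zero, add_zero, add_zero]
  have f_g : ∀ z, i (p (T z)) - z =
      (d (H (T z)) + δ (H (T z))) + H (T (d z + δ z)) := fun z => by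
    have e1 : H (d (T z)) + (H (T (d z)) + H (T (δ z))) = 0 := by
      rw [← map_add, ← map_add, defect']
      exact LinearMap.congr_fun hHi _
    have e2 : i (p (T z)) = T z + (d (H (T z)) + H (d (T z))) := LinearMap.congr_fun he (T z)
    have e3 : T z + δ (H (T z)) = z := LinearMap.congr_fun hT z
    have e4 : H (T (d z)) + H (T (δ z)) = H (d (T z)) := by
      rw [← zero_add (_ + _), ← h2 (H (d (T z))), add_assoc, e1, add_zero]
    rw [neg, map_add T, map_add H, e4, e2]
    have e5 : ∀ a b c w : QRing ⊗[Base] X.carrier, a + (b + c) + (a + w) = b + w + c + (a + a) :=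
      fun a b c w => by abel
    refine (congrArg (T z + (d (H (T z)) + H (d (T z))) + ·) e3.symm).trans ?_
    rw [e5, h2, add_zero]
  refine ⟨i, p ∘ₗ T, 0, H ∘ₗ T, baseChange_mem_zero _ r.inc_mem,
    fun n z hz => baseChange_mem_zero _ r.ret_mem _ _ (hTmem n z hz), fun _ _ _ => zero_mem _,
    fun n z hz => baseChange_mem _ r.hom_mem _ _ (hTmem n z hz), f_d, g_d, g_f, f_g⟩

/-! ### The functor `Br` is the Borel construction -/

theorem KomTau.smul_eq (X : KomTau) (z : TauRing) (x : X.carrier) :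
    z • x = z.re • x + z.im • X.tauMap x := by
  conv_lhs => rw [tauRing_eq z]
  rw [add_smul, mul_smul, algebraMap_smul, algebraMap_smul]
  rfl

section FreeBimodule

variable (B : BigradedBimodule TauRing tau (0, 0) QRing Q (1, 0)) (ε : B.carrier)
  (c₁ c₂ : B.carrier →ₗ[Base] QRing) (X : KomTau)

/-- The map `q ⊗ x ↦ q ε ⊗ x`, for an element `ε` of a bimodule `B`. -/
def fromBorel : QRing ⊗[Base] X.carrier →ₗ[QRing] B.carrier ⊗[TauRing] X.carrier :=
  LinearMap.liftBaseChange QRing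
    { toFun := fun x => ε ⊗ₜ[TauRing] x
      map_add' := fun x y => TensorProduct.tmul_add _ _ _
      map_smul' := fun r x => by
        rw [RingHom.id_apply, ← algebraMap_smul TauRing r x, ← TensorProduct.smul_tmul,
          algebraMap_smul, TensorProduct.smul_tmul'] }

theorem fromBorel_tmul (q : QRing) (x : X.carrier) :
    fromBorel B ε X (q ⊗ₜ[Base] x) = (q • ε) ⊗ₜ[TauRing] x := rfl

/-- The inverse of `fromBorel`, in terms of the coordinates of a bimodule with the basis `ε`,
`τ ε` over `R[Q]`. -/
def toBorel (hc₁ : ∀ (t : TauRing) b, c₁ (t • b) = t.re • c₁ b + t.im • c₂ b)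
    (hc₂ : ∀ (t : TauRing) b, c₂ (t • b) = t.re • c₂ b + t.im • c₁ b) :
    B.carrier ⊗[TauRing] X.carrier →+ QRing ⊗[Base] X.carrier :=
  TensorProduct.liftAddHom
    (((LinearMap.toAddMonoidHom'.comp (TensorProduct.mk Base QRing X.carrier).toAddMonoidHom).comp
      c₁.toAddMonoidHom) +
    (((LinearMap.toAddMonoidHom'.comp
      (TensorProduct.mk Base QRing X.carrier).toAddMonoidHom).comp
      c₂.toAddMonoidHom).compl₂ X.tauMap.toAddMonoidHom))
    (fun t b x => by
      change c₁ (t • b) ⊗ₜ[Base] x + c₂ (t • b) ⊗ₜ[Base] X.tauMap x =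
        c₁ b ⊗ₜ[Base] (t • x) + c₂ b ⊗ₜ[Base] X.tauMap (t • x)
      rw [hc₁, hc₂, X.smul_eq, map_add, map_smul, map_smul, X.tauMap_tauMap]
      simp only [TensorProduct.add_tmul, TensorProduct.tmul_add, TensorProduct.smul_tmul]
      abel)

variable {B ε c₁ c₂}

/-- `c₁`, `c₂` are the coordinates with respect to the basis `ε`, `τ ε` of `B` over `R[Q]`. -/
theorem fromBorel_bijective (hc₁ : ∀ (t : TauRing) b, c₁ (t • b) = t.re • c₁ b + t.im • c₂ b)
    (hc₂ : ∀ (t : TauRing) b, c₂ (t • b) = t.re • c₂ b + t.im • c₁ b)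
    (h₁ : ∀ q : QRing, c₁ (q • ε) = q) (h₂ : ∀ q : QRing, c₂ (q • ε) = 0)
    (hε : ∀ b, b = c₁ b • ε + tau • c₂ b • ε) : Function.Bijective (fromBorel B ε X) := by
  have e : ∀ b x, toBorel B c₁ c₂ X hc₁ hc₂ (b ⊗ₜ x) =
    c₁ b ⊗ₜ[Base] x + c₂ b ⊗ₜ[Base] X.tauMap x := fun _ _ => rfl
  refine Function.bijective_iff_has_inverse.2
    ⟨toBorel B c₁ c₂ X hc₁ hc₂, fun z => ?_, fun z => ?_⟩
  · induction z using TensorProduct.induction_on with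
    | zero => rw [map_zero, map_zero]
    | add x y hx hy => rw [map_add, map_add, hx, hy]
    | tmul q x => rw [fromBorel_tmul, e, h₁, h₂, TensorProduct.zero_tmul, add_zero]
  · induction z using TensorProduct.induction_on with
    | zero => rw [map_zero, map_zero]
    | add x y hx hy => rw [map_add, map_add, hx, hy]
    | tmul b x =>
      have h3 : X.tauMap x = tau • x := rfl
      rw [e, map_add, fromBorel_tmul, fromBorel_tmul, h3, ← TensorProduct.smul_tmul,
        ← TensorProduct.add_tmul, ← hε]

/-- If `B` is free over `R[Q]` on `ε`, `τ ε`, with `∂ε = Q (1 + τ) ε`, then `X ⊗ B` is the Borel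
construction. -/
theorem borel_equivalent_tensorBimodule
    (hc₁ : ∀ (t : TauRing) b, c₁ (t • b) = t.re • c₁ b + t.im • c₂ b)
    (hc₂ : ∀ (t : TauRing) b, c₂ (t • b) = t.re • c₂ b + t.im • c₁ b)
    (h₁ : ∀ q : QRing, c₁ (q • ε) = q) (h₂ : ∀ q : QRing, c₂ (q • ε) = 0)
    (hε : ∀ b, b = c₁ b • ε + tau • c₂ b • ε)
    (hgr : ∀ n, ∀ q ∈ qGr n, q • ε ∈ B.gr n) (hd : B.d ε = Q • (1 + tau) • ε) :
    HomotopyEquivalent (borel X) (tensorBimodule adjoin_tau B X) := by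
  refine HomotopyEquivalent.of_bijective (fromBorel B ε X)
    (fromBorel_bijective X hc₁ hc₂ h₁ h₂ hε) ?_ ?_
  · intro n z hz
    refine tensorGr_map_mem (A := Base) (P := B.carrier ⊗[TauRing] X.carrier)
      (fromBorel B ε X).toAddMonoidHom ?_ hz
    rintro i j rfl q hq x hx
    exact tmul_mem_tensorGr rfl (hgr i q hq) hx
  · have key : ∀ z : QRing ⊗[Base] X.carrier,
        fromBorel B ε X (borelD X z) = tensorD B X (fromBorel B ε X z) := by
      intro z
      induction z using TensorProduct.induction_on with
      | zero => simp only [map_zero]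
      | add x y hx hy => simp only [map_add, hx, hy]
      | tmul q x =>
        have h4 : x + X.tauMap x = (1 + tau) • x := by
          rw [add_smul, one_smul]
          rfl
        have h5 : X.dBase x = X.d x := rfl
        rw [borelD_tmul, map_add, fromBorel_tmul, fromBorel_tmul, fromBorel_tmul, tensorD_tmul,
          B.d_smul, hd, h4, h5, ← TensorProduct.smul_tmul, add_comm, mul_smul, smul_comm q Q,
          smul_comm (1 + tau) Q, smul_comm (1 + tau) q]
    exact key

end FreeBimodule

/-- The functor `Br` is naturally isomorphic to the Borel construction. -/
theorem borel_equivalent_Br (X : KomTau) : HomotopyEquivalent (borel X) (Br X) := by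
  let c₁ : BrCarrier →ₗ[Base] QRing := TensorProduct.lift
    (LinearMap.mk₂ Base (fun (a : TauRing) (q : QRing) => a.re • q)
      (fun a a' q => by rw [QuadraticAlgebra.re_add, add_smul])
      (fun r a q => by rw [QuadraticAlgebra.re_smul, smul_assoc])
      (fun a q q' => smul_add _ _ _) (fun r a q => smul_comm _ _ _))
  let c₂ : BrCarrier →ₗ[Base] QRing := TensorProduct.lift
    (LinearMap.mk₂ Base (fun (a : TauRing) (q : QRing) => a.im • q)
      (fun a a' q => by rw [QuadraticAlgebra.im_add, add_smul])
      (fun r a q => by rw [QuadraticAlgebra.im_smul, smul_assoc])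
      (fun a q q' => smul_add _ _ _) (fun r a q => smul_comm _ _ _))
  have e₁ : ∀ a q, c₁ (a ⊗ₜ[Base] q) = a.re • q := fun _ _ => rfl
  have e₂ : ∀ a q, c₂ (a ⊗ₜ[Base] q) = a.im • q := fun _ _ => rfl
  let ε : BrCarrier := (1 : TauRing) ⊗ₜ[Base] (1 : QRing)
  have eε : ∀ q : QRing, q • ε = (1 : TauRing) ⊗ₜ[Base] q := fun q => by
    rw [br_smul_tmul, mul_one]
  have hc₁ : ∀ (t : TauRing) (b : BrCarrier), c₁ (t • b) = t.re • c₁ b + t.im • c₂ b := by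
    intro t b
    induction b using TensorProduct.induction_on with
    | zero => simp only [smul_zero, map_zero, add_zero]
    | add b b' h h' => rw [smul_add, map_add, map_add, map_add, h, h', smul_add, smul_add]; abel
    | tmul a q =>
      rw [TensorProduct.smul_tmul', e₁, e₁, e₂, smul_eq_mul, QuadraticAlgebra.re_mul, one_mul,
        add_smul, mul_smul, mul_smul]
  have hc₂ : ∀ (t : TauRing) (b : BrCarrier), c₂ (t • b) = t.re • c₂ b + t.im • c₁ b := by
    intro t b
    induction b using TensorProduct.induction_on with
    | zero => simp only [smul_zero, map_zero, add_zero]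
    | add b b' h h' => rw [smul_add, map_add, map_add, map_add, h, h', smul_add, smul_add]; abel
    | tmul a q =>
      rw [TensorProduct.smul_tmul', e₂, e₂, e₁, smul_eq_mul, QuadraticAlgebra.im_mul, zero_mul,
        zero_mul, add_zero, add_smul, mul_smul, mul_smul]
  have hε : ∀ b : BrCarrier, b = c₁ b • ε + tau • c₂ b • ε := by
    intro b
    induction b using TensorProduct.induction_on with
    | zero => simp only [smul_zero, map_zero, add_zero, zero_smul]
    | add b b' h h' =>
      rw [map_add, map_add, add_smul, add_smul, smul_add, add_add_add_comm, ← h, ← h']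
    | tmul a q =>
      rw [e₁, e₂, eε, eε, TensorProduct.smul_tmul', smul_eq_mul, mul_one,
        ← TensorProduct.smul_tmul, ← TensorProduct.smul_tmul, ← TensorProduct.add_tmul]
      conv_lhs => rw [tauRing_eq a]
      rw [Algebra.algebraMap_eq_smul_one, Algebra.algebraMap_eq_smul_one, smul_mul_assoc, one_mul]
  refine borel_equivalent_tensorBimodule (B := brBimodule) (ε := ε) (c₁ := c₁) (c₂ := c₂) X
    hc₁ hc₂ ?_ ?_ hε ?_ ?_
  · intro q
    refine (congrArg c₁ (eε q)).trans ?_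
    rw [e₁, QuadraticAlgebra.re_one, one_smul]
  · intro q
    refine (congrArg c₂ (eε q)).trans ?_
    rw [e₂, QuadraticAlgebra.im_one, zero_smul]
  · intro n q hq
    refine (congrArg (· ∈ brBimodule.gr n) (eε q)).mpr ?_
    exact tmul_mem_tensorGr (zero_add n) one_mem_tauGr hq
  · refine (brBimodule_d_tmul 1 1).trans ?_
    rw [mul_one, mul_one]
    refine Eq.trans ?_ (smul_comm (1 + tau) Q ε)
    rw [eε, TensorProduct.smul_tmul', smul_eq_mul, mul_one]

/-! ### Tensor products of retractions -/

theorem KomTau.tensor_tauMap (X₁ X₂ : KomTau) (z : X₁.carrier ⊗[Base] X₂.carrier) :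
    (X₁.tensor X₂).tauMap z = TensorProduct.map X₁.tauMap X₂.tauMap z := by
  have : (0 : Base) • z + (1 : Base) • TensorProduct.map X₁.tauMap X₂.tauMap z =
      TensorProduct.map X₁.tauMap X₂.tauMap z := by rw [zero_smul, one_smul, zero_add]
  exact this

theorem tensor_ext {A B C : Type} [AddCommGroup A] [AddCommGroup B] [AddCommGroup C]
    [Module Base A] [Module Base B] [Module Base C] {f g : A ⊗[Base] B →ₗ[Base] C}
    (h : ∀ a b, f (a ⊗ₜ b) = g (a ⊗ₜ b)) (z : A ⊗[Base] B) : f z = g z := by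
  rw [TensorProduct.ext' h]

namespace Retraction

variable {C₁ C₂ X₁ X₂ : KomTau} (r₁ : Retraction C₁ X₁) (r₂ : Retraction C₂ X₂)

/-- The homotopy `h₁ ⊗ 1 + i₁ p₁ ⊗ h₂` of a tensor product of retractions. -/
def tensorHom : X₁.carrier ⊗[Base] X₂.carrier →ₗ[Base] X₁.carrier ⊗[Base] X₂.carrier :=
  TensorProduct.map r₁.hom LinearMap.id + TensorProduct.map (r₁.inc ∘ₗ r₁.ret) r₂.hom

theorem tensorHom_tmul (x : X₁.carrier) (y : X₂.carrier) : r₁.tensorHom r₂ (x ⊗ₜ y) =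
    r₁.hom x ⊗ₜ y + r₁.inc (r₁.ret x) ⊗ₜ r₂.hom y := rfl

/-- The homotopy identity for `tensorHom`, on pure tensors. -/
theorem tensor_homotopy (x : X₁.carrier) (y : X₂.carrier) :
    r₁.inc (r₁.ret x) ⊗ₜ[Base] r₂.inc (r₂.ret y) = x ⊗ₜ[Base] y +
      ((TensorProduct.map X₁.dBase LinearMap.id + TensorProduct.map LinearMap.id X₂.dBase :
        Module.End Base _) (r₁.tensorHom r₂ (x ⊗ₜ y)) +
      r₁.tensorHom r₂ ((TensorProduct.map X₁.dBase LinearMap.id +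
        TensorProduct.map LinearMap.id X₂.dBase : Module.End Base _) (x ⊗ₜ y))) := by
  have e : ∀ a b, (TensorProduct.map X₁.dBase LinearMap.id +
      TensorProduct.map LinearMap.id X₂.dBase : Module.End Base _) (a ⊗ₜ[Base] b) =
      X₁.dBase a ⊗ₜ b + a ⊗ₜ X₂.dBase b := fun _ _ => rfl
  have h2 := fun z : X₁.carrier ⊗[Base] X₂.carrier => add_self_eq_zero z
  rw [e, map_add, tensorHom_tmul, tensorHom_tmul, tensorHom_tmul, map_add, e, e, r₁.ret_d,
    r₁.inc_d]
  have h1 : X₁.dBase (r₁.hom x) ⊗ₜ[Base] y + r₁.hom (X₁.dBase x) ⊗ₜ[Base] y =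
      r₁.inc (r₁.ret x) ⊗ₜ y + x ⊗ₜ y := by
    rw [r₁.inc_ret x, TensorProduct.add_tmul, add_comm (x ⊗ₜ[Base] y), add_assoc, h2, add_zero,
      TensorProduct.add_tmul]
  have h3 : r₁.inc (r₁.ret x) ⊗ₜ[Base] X₂.dBase (r₂.hom y) +
      r₁.inc (r₁.ret x) ⊗ₜ[Base] r₂.hom (X₂.dBase y) =
      r₁.inc (r₁.ret x) ⊗ₜ[Base] r₂.inc (r₂.ret y) + r₁.inc (r₁.ret x) ⊗ₜ y := by
    rw [r₂.inc_ret y, TensorProduct.tmul_add, add_comm (_ ⊗ₜ[Base] y), add_assoc, h2, add_zero,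
      TensorProduct.tmul_add]
  -- All mixed terms occur twice.
  have e5 : ∀ a b c d k l m : X₁.carrier ⊗[Base] X₂.carrier,
      m + (a + b + (c + d) + (k + c + (b + l))) = m + (a + k) + (d + l) + (b + b) + (c + c) :=
    fun a b c d k l m => by abel
  have e6 : ∀ a b c : X₁.carrier ⊗[Base] X₂.carrier, a + (b + a) + (c + b) =
      c + (a + a) + (b + b) := fun a b c => by abel
  rw [e5, h1, h3, h2, h2, e6, h2, h2]
  simp only [add_zero]

/-- The tensor product of two retractions. -/
def tensor : Retraction (C₁.tensor C₂) (X₁.tensor X₂) where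
  inc := TensorProduct.map r₁.inc r₂.inc
  ret := TensorProduct.map r₁.ret r₂.ret
  hom := r₁.tensorHom r₂
  inc_mem n c hc := by
    refine tensorGr_map_mem (TensorProduct.map r₁.inc r₂.inc).toAddMonoidHom ?_ hc
    rintro i j rfl x hx y hy
    exact tmul_mem_tensorGr rfl (r₁.inc_mem _ _ hx) (r₂.inc_mem _ _ hy)
  ret_mem n c hc := by
    refine tensorGr_map_mem (TensorProduct.map r₁.ret r₂.ret).toAddMonoidHom ?_ hc
    rintro i j rfl x hx y hy
    exact tmul_mem_tensorGr rfl (r₁.ret_mem _ _ hx) (r₂.ret_mem _ _ hy)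
  hom_mem n c hc := by
    refine tensorGr_map_mem (r₁.tensorHom r₂).toAddMonoidHom ?_ hc
    rintro i j rfl x hx y hy
    exact add_mem (tmul_mem_tensorGr (by abel) (r₁.hom_mem _ _ hx) hy)
      (tmul_mem_tensorGr (by abel) (r₁.inc_mem _ _ (r₁.ret_mem _ _ hx)) (r₂.hom_mem _ _ hy))
  inc_tau z := by
    refine (congrArg (TensorProduct.map r₁.inc r₂.inc) (KomTau.tensor_tauMap C₁ C₂ z)).trans
      (Eq.trans ?_ (KomTau.tensor_tauMap X₁ X₂ (TensorProduct.map r₁.inc r₂.inc z)).symm)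
    revert z
    refine tensor_ext (f := TensorProduct.map r₁.inc r₂.inc ∘ₗ TensorProduct.map _ _)
      (g := TensorProduct.map _ _ ∘ₗ TensorProduct.map r₁.inc r₂.inc) fun x y => ?_
    simp only [LinearMap.comp_apply, TensorProduct.map_tmul, r₁.inc_tau, r₂.inc_tau]
  inc_d := by
    refine tensor_ext (f := TensorProduct.map r₁.inc r₂.inc ∘ₗ
      (TensorProduct.map C₁.dBase LinearMap.id + TensorProduct.map LinearMap.id C₂.dBase))
      (g := (TensorProduct.map X₁.dBase LinearMap.id +
      TensorProduct.map LinearMap.id X₂.dBase) ∘ₗ TensorProduct.map r₁.inc r₂.inc) fun x y => ?_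
    simp only [LinearMap.comp_apply, LinearMap.add_apply, TensorProduct.map_tmul, map_add, r₁.inc_d,
      r₂.inc_d, LinearMap.id_apply]
  ret_d := by
    refine tensor_ext (f := TensorProduct.map r₁.ret r₂.ret ∘ₗ
      (TensorProduct.map X₁.dBase LinearMap.id + TensorProduct.map LinearMap.id X₂.dBase))
      (g := (TensorProduct.map C₁.dBase LinearMap.id +
      TensorProduct.map LinearMap.id C₂.dBase) ∘ₗ TensorProduct.map r₁.ret r₂.ret) fun x y => ?_
    simp only [LinearMap.comp_apply, LinearMap.add_apply, TensorProduct.map_tmul, map_add, r₁.ret_d,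
      r₂.ret_d, LinearMap.id_apply]
  ret_inc := by
    refine tensor_ext (f := TensorProduct.map r₁.ret r₂.ret ∘ₗ TensorProduct.map r₁.inc r₂.inc)
      (g := LinearMap.id) fun x y => ?_
    simp only [LinearMap.comp_apply, TensorProduct.map_tmul, r₁.ret_inc,
      r₂.ret_inc, LinearMap.id_apply]
  hom_inc := by
    refine tensor_ext (f := r₁.tensorHom r₂ ∘ₗ TensorProduct.map r₁.inc r₂.inc)
      (g := 0) fun x y => ?_
    rw [LinearMap.comp_apply, TensorProduct.map_tmul, tensorHom_tmul, r₁.hom_inc, r₂.hom_inc,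
      TensorProduct.zero_tmul, TensorProduct.tmul_zero, add_zero, LinearMap.zero_apply]
  inc_ret := by
    refine tensor_ext (f := TensorProduct.map r₁.inc r₂.inc ∘ₗ TensorProduct.map r₁.ret r₂.ret)
      (g := LinearMap.id + ((TensorProduct.map X₁.dBase LinearMap.id +
      TensorProduct.map LinearMap.id X₂.dBase) ∘ₗ r₁.tensorHom r₂ +
      r₁.tensorHom r₂ ∘ₗ (TensorProduct.map X₁.dBase LinearMap.id +
      TensorProduct.map LinearMap.id X₂.dBase))) fun x y => ?_
    exact r₁.tensor_homotopy r₂ x y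

end Retraction

/-- An exhaustive sequence of `τ`-invariant subspaces of `X`, beginning with `0`, that is lowered by
the homotopy of a retraction, and whose first term after `0` contains the image of the
inclusion. -/
structure Retraction.Filtration {C X : KomTau} (r : Retraction C X) where
  fil : ℕ → Submodule Base X.carrier
  zero : fil 0 = ⊥
  exhaust : ∀ x, ∃ n, x ∈ fil n
  tau_mem : ∀ n, ∀ x ∈ fil n, X.tauMap x ∈ fil n
  hom_mem : ∀ n, ∀ x ∈ fil (n + 1), r.hom x ∈ fil n
  inc_mem : ∀ c, r.inc c ∈ fil 1

/-- On the tensor product of the filtered pieces `a` and `b`, the term `h₁ ⊗ 1` of the homotopy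
lowers `a`, and the term `i₁ p₁ ⊗ h₂` lowers `b` and resets `a` to `1`; as it can be nonzero only
for `a ≥ 1`, the number `a + b` drops in either case. -/
theorem Retraction.Filtration.tensor_nilpotent {C₁ C₂ X₁ X₂ : KomTau} {r₁ : Retraction C₁ X₁}
    {r₂ : Retraction C₂ X₂} (F₁ : r₁.Filtration) (F₂ : r₂.Filtration)
    (z : (X₁.tensor X₂).carrier) : ∃ n, (((LinearMap.id + (X₁.tensor X₂).tauMap).comp
      (r₁.tensor r₂).hom : Module.End Base (X₁.tensor X₂).carrier) ^ n) z = 0 := by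
  let t : Module.End Base (X₁.carrier ⊗[Base] X₂.carrier) := (X₁.tensor X₂).tauMap
  let N : Module.End Base (X₁.carrier ⊗[Base] X₂.carrier) :=
    (LinearMap.id + t) ∘ₗ r₁.tensorHom r₂
  suffices h : ∀ z, ∃ n, (N ^ n) z = 0 from h z
  have ht : ∀ x y, t (x ⊗ₜ y) = X₁.tauMap x ⊗ₜ X₂.tauMap y := fun x y =>
    KomTau.tensor_tauMap X₁ X₂ (x ⊗ₜ y)
  have key : ∀ n a b, a + b ≤ n → ∀ x ∈ F₁.fil a, ∀ y ∈ F₂.fil b, (N ^ n) (x ⊗ₜ[Base] y) = 0 := by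
    intro n
    induction n with
    | zero =>
      intro a b hab x hx y hy
      have : a = 0 := by omega
      subst this
      rw [F₁.zero, Submodule.mem_bot] at hx
      rw [hx, TensorProduct.zero_tmul, map_zero]
    | succ n ih =>
      have ih' : ∀ a b, a + b ≤ n → ∀ x ∈ F₁.fil a, ∀ y ∈ F₂.fil b,
          (N ^ n) ((LinearMap.id + t : Module.End Base _) (x ⊗ₜ[Base] y)) = 0 := by
        intro a b hab x hx y hy
        rw [LinearMap.add_apply, LinearMap.id_apply, map_add, ht, ih a b hab x hx y hy,
          ih a b hab _ (F₁.tau_mem a x hx) _ (F₂.tau_mem b y hy), add_zero]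
      intro a b hab x hx y hy
      have e : N (x ⊗ₜ y) = (LinearMap.id + t : Module.End Base _)
        (r₁.hom x ⊗ₜ y + r₁.inc (r₁.ret x) ⊗ₜ r₂.hom y) := rfl
      rw [pow_succ, Module.End.mul_apply, e, map_add, map_add]
      cases a with
      | zero =>
        rw [F₁.zero, Submodule.mem_bot] at hx
        simp only [hx, map_zero, TensorProduct.zero_tmul, add_zero]
      | succ a =>
        rw [ih' a b (by omega) _ (F₁.hom_mem a x hx) _ hy, zero_add]
        cases b with
        | zero =>
          rw [F₂.zero, Submodule.mem_bot] at hy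
          simp only [hy, map_zero, TensorProduct.tmul_zero]
        | succ b => exact ih' 1 b (by omega) _ (F₁.inc_mem _) _ (F₂.hom_mem b y hy)
  intro z
  induction z using TensorProduct.induction_on with
  | zero => exact ⟨0, map_zero _⟩
  | tmul x y =>
    obtain ⟨a, ha⟩ := F₁.exhaust x
    obtain ⟨b, hb⟩ := F₂.exhaust y
    exact ⟨a + b, key _ a b le_rfl x ha y hb⟩
  | add x y hx hy =>
    obtain ⟨n, hn⟩ := hx
    obtain ⟨m, hm⟩ := hy
    refine ⟨n + m, ?_⟩
    rw [map_add, pow_add, Module.End.mul_apply _ _ y, hm, ← pow_add, add_comm n m, pow_add,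
      Module.End.mul_apply, hn, map_zero, map_zero, add_zero]

/-! ### The unit of Koszul duality -/

/-- A description of `Y` as the Borel construction of `C`: the inclusion `ι` of `C` as the part
without `Q`, the constant coefficient `κ`, and the division `σ` by `Q`. -/
structure BorelModel (C : KomTau) (Y : KomQ) where
  ι : C.carrier →ₗ[Base] Y.carrier
  κ : Y.carrier →ₗ[Base] C.carrier
  σ : Y.carrier →ₗ[Base] Y.carrier
  ι_mem : ∀ n, ∀ c ∈ C.gr n, ι c ∈ Y.gr n
  κ_mem : ∀ n, ∀ y ∈ Y.gr n, κ y ∈ C.gr n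
  σ_mem : ∀ n, ∀ y ∈ Y.gr n, σ y ∈ Y.gr (n + (-1, 0))
  κ_ι : ∀ c, κ (ι c) = c
  σ_ι : ∀ c, σ (ι c) = 0
  κ_Q : ∀ y, κ (Q • y) = 0
  σ_Q : ∀ y, σ (Q • y) = y
  eq : ∀ y, y = Q • σ y + ι (κ y)
  d_ι : ∀ c, Y.d (ι c) = ι (C.dBase c) + Q • ι (c + C.tauMap c)
  nilpotent : ∀ y, ∃ n : ℕ, ((σ : Module.End Base Y.carrier) ^ n) y = 0

/-- A basis `e`, `τ e` over `R[Q]`, with dual basis `v₁`, `v₂`, of a bimodule with the differential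
of `Hh`. -/
structure HhBasis (B : BigradedBimodule QRing Q (1, 0) TauRing tau (0, 0)) where
  e : B.carrier
  v₁ : B.carrier →ₗ[QRing] QRing
  v₂ : B.carrier →ₗ[QRing] QRing
  v₁_e : v₁ e = 1
  v₂_e : v₂ e = 0
  v₁_tau : ∀ b, v₁ (tau • b) = v₂ b
  v₂_tau : ∀ b, v₂ (tau • b) = v₁ b
  eq : ∀ b, b = v₁ b • e + v₂ b • (tau • e)
  e_mem : e ∈ B.gr 0
  v₁_mem : ∀ n, ∀ b ∈ B.gr n, v₁ b ∈ qGr n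
  d_e : B.d e = Q • (e + tau • e)

/-- A homogeneous element of `R[Q]` is `0` or a monomial. -/
theorem eq_monomial_of_mem_qGr {i : ℤ × ℤ} {q : QRing} (hq : q ∈ qGr i) (h0 : q ≠ 0) :
    ∃ a k : ℕ, i = ((0 : ℤ), -2 * (k : ℤ)) + ((a : ℤ), 0) ∧ q = Polynomial.C (u ^ k) * Q ^ a := by
  obtain ⟨a, ha⟩ : ∃ a, q.coeff a ≠ 0 := by
    by_contra h
    push Not at h
    exact h0 (Polynomial.ext h)
  obtain ⟨k, hk⟩ : ∃ k, (q.coeff a).coeff k ≠ 0 := by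
    by_contra h
    push Not at h
    exact ha (Polynomial.ext h)
  have hi := hq a k hk
  have hone : ∀ c : ZMod 2, c ≠ 0 → c = 1 := by decide
  refine ⟨a, k, by rw [← hi]; ext <;> simp, ?_⟩
  ext b l
  rw [Polynomial.coeff_C_mul_X_pow]
  by_cases hbl : b = a ∧ l = k
  · rw [hbl.1, hbl.2, if_pos rfl, Polynomial.coeff_X_pow_self, hone _ hk]
  · have h1 : (q.coeff b).coeff l = 0 := by
      by_contra h
      have := (hq b l h).trans hi.symm
      simp only [Prod.mk.injEq, Nat.cast_inj] at this
      exact hbl ⟨this.1, by omega⟩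
    rw [h1]
    split_ifs with h2
    · rw [Polynomial.coeff_X_pow, if_neg fun h3 => hbl ⟨h2, h3⟩]
    · simp

theorem BigradedComplex.u_pow_smul_mem {S : Type} [CommRing S] [Algebra Base S] {s : S}
    {δ : ℤ × ℤ} (X : BigradedComplex S s δ) (k : ℕ) {n : ℤ × ℤ} {x : X.carrier} (hx : x ∈ X.gr n) :
    u ^ k • x ∈ X.gr ((0, -2 * (k : ℤ)) + n) := by
  induction k with
  | zero => rw [pow_zero, one_smul, Nat.cast_zero, mul_zero, Prod.mk_zero_zero, zero_add]; exact hx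
  | succ k ih =>
    rw [pow_succ', mul_smul]
    have e : ((0 : ℤ), -2 * ((k + 1 : ℕ) : ℤ)) + n = ((0 : ℤ), -2 * (k : ℤ)) + n + (0, -2) := by
      ext
      · simp
      · simp only [Prod.snd_add]; push_cast; ring
    rw [e]
    exact X.u_smul_mem _ _ ih

/-- Homogeneous elements of `R[Q]` act homogeneously. -/
theorem KomQ.smul_mem (Y : KomQ) {i j : ℤ × ℤ} {q : QRing} (hq : q ∈ qGr i) {y : Y.carrier}
    (hy : y ∈ Y.gr j) : q • y ∈ Y.gr (i + j) := by
  by_cases h0 : q = 0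
  · rw [h0, zero_smul]
    exact zero_mem _
  · obtain ⟨a, k, rfl, rfl⟩ := eq_monomial_of_mem_qGr hq h0
    have hQ : Q ^ a • y ∈ Y.gr (((a : ℤ), 0) + j) := by
      clear hq h0
      induction a with
      | zero => rw [pow_zero, one_smul, Nat.cast_zero, Prod.mk_zero_zero, zero_add]; exact hy
      | succ a ih =>
        rw [pow_succ', mul_smul]
        have e : (((a + 1 : ℕ) : ℤ), (0 : ℤ)) + j = ((a : ℤ), (0 : ℤ)) + j + (1, 0) := by
          ext
          · simp only [Prod.fst_add]; push_cast; ring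
          · simp
        rw [e]
        exact Y.s_smul_mem _ _ ih
    have e2 : Polynomial.C (u ^ k) = algebraMap Base QRing (u ^ k) := rfl
    rw [mul_smul, e2, algebraMap_smul, add_assoc]
    exact Y.u_pow_smul_mem k hQ

section Unit

variable {B : BigradedBimodule QRing Q (1, 0) TauRing tau (0, 0)} (β : HhBasis B)
  {C : KomTau} {Y : KomQ} (m : BorelModel C Y)

theorem HhBasis.tau_tau (b : B.carrier) : tau • tau • b = b := by
  rw [smul_smul, tau_mul_tau, one_smul]

/-- The evaluation of an element of `Hom_R(R[τ]/(τ² + 1), Y)` at `1`. -/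
def HhBasis.evOne : B.carrier ⊗[QRing] Y.carrier →ₗ[QRing] Y.carrier :=
  TensorProduct.lift ((LinearMap.lsmul QRing Y.carrier).comp β.v₁)

/-- The evaluation of an element of `Hom_R(R[τ]/(τ² + 1), Y)` at `τ`. -/
def HhBasis.evTau : B.carrier ⊗[QRing] Y.carrier →ₗ[QRing] Y.carrier :=
  TensorProduct.lift ((LinearMap.lsmul QRing Y.carrier).comp β.v₂)

theorem HhBasis.evOne_tmul (b : B.carrier) (y : Y.carrier) :
    β.evOne (b ⊗ₜ[QRing] y) = β.v₁ b • y := rfl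

theorem HhBasis.evTau_tmul (b : B.carrier) (y : Y.carrier) :
    β.evTau (b ⊗ₜ[QRing] y) = β.v₂ b • y := rfl

/-- An element is determined by its values at `1` and `τ`. -/
theorem HhBasis.tensor_eq (z : B.carrier ⊗[QRing] Y.carrier) :
    z = β.e ⊗ₜ[QRing] β.evOne z + (tau • β.e) ⊗ₜ[QRing] β.evTau z := by
  induction z using TensorProduct.induction_on with
  | zero => simp only [map_zero, TensorProduct.tmul_zero, add_zero]
  | add x y hx hy =>
    rw [map_add, map_add, TensorProduct.tmul_add, TensorProduct.tmul_add, add_add_add_comm, ← hx,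
      ← hy]
  | tmul b y =>
    rw [β.evOne_tmul, β.evTau_tmul, ← TensorProduct.smul_tmul, ← TensorProduct.smul_tmul,
      ← TensorProduct.add_tmul, ← β.eq]

theorem HhBasis.tensorD_e (y : Y.carrier) : tensorD B Y (β.e ⊗ₜ[QRing] y) =
    β.e ⊗ₜ (Q • y + Y.d y) + (tau • β.e) ⊗ₜ (Q • y) := by
  rw [tensorD_tmul, β.d_e, TensorProduct.smul_tmul, TensorProduct.add_tmul, TensorProduct.tmul_add]
  abel

theorem HhBasis.tensorD_tau (y : Y.carrier) : tensorD B Y ((tau • β.e) ⊗ₜ[QRing] y) =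
    β.e ⊗ₜ (Q • y) + (tau • β.e) ⊗ₜ (Q • y + Y.d y) := by
  rw [tensorD_tmul, B.d_smul, β.d_e, ← smul_comm Q tau, smul_add, HhBasis.tau_tau,
    TensorProduct.smul_tmul, TensorProduct.add_tmul, TensorProduct.tmul_add]
  abel

theorem HhBasis.evOne_e (y : Y.carrier) : β.evOne (β.e ⊗ₜ[QRing] y) = y := by
  rw [β.evOne_tmul, β.v₁_e, one_smul]

theorem HhBasis.evOne_tau (y : Y.carrier) : β.evOne ((tau • β.e) ⊗ₜ[QRing] y) = 0 := by
  rw [β.evOne_tmul, β.v₁_tau, β.v₂_e, zero_smul]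

theorem HhBasis.evTau_e (y : Y.carrier) : β.evTau (β.e ⊗ₜ[QRing] y) = 0 := by
  rw [β.evTau_tmul, β.v₂_e, zero_smul]

theorem HhBasis.evTau_tau (y : Y.carrier) : β.evTau ((tau • β.e) ⊗ₜ[QRing] y) = y := by
  rw [β.evTau_tmul, β.v₂_tau, β.v₁_e, one_smul]

/-- The unit of Koszul duality: `c ↦ (x ↦ x c)`. -/
def HhBasis.unitInc : C.carrier →ₗ[Base] B.carrier ⊗[QRing] Y.carrier :=
  (TensorProduct.mk QRing B.carrier Y.carrier β.e).restrictScalars Base ∘ₗ m.ι +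
    (TensorProduct.mk QRing B.carrier Y.carrier (tau • β.e)).restrictScalars Base ∘ₗ m.ι ∘ₗ C.tauMap

/-- The constant coefficient of the value at `1`, a retraction for the unit. -/
def HhBasis.unitRet : B.carrier ⊗[QRing] Y.carrier →ₗ[Base] C.carrier :=
  m.κ ∘ₗ (β.evOne (Y := Y)).restrictScalars Base

/-- The homotopy for the unit: divide the value at `1` by `Q` and move it to `τ`. -/
def HhBasis.unitHom : B.carrier ⊗[QRing] Y.carrier →ₗ[Base] B.carrier ⊗[QRing] Y.carrier :=
  (TensorProduct.mk QRing B.carrier Y.carrier (tau • β.e)).restrictScalars Base ∘ₗ m.σ ∘ₗ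
    (β.evOne (Y := Y)).restrictScalars Base

theorem HhBasis.unitInc_apply (c : C.carrier) : β.unitInc m c =
    β.e ⊗ₜ[QRing] m.ι c + (tau • β.e) ⊗ₜ[QRing] m.ι (C.tauMap c) := rfl

theorem HhBasis.unitRet_apply (z : B.carrier ⊗[QRing] Y.carrier) :
    β.unitRet m z = m.κ (β.evOne z) := rfl

theorem HhBasis.unitHom_apply (z : B.carrier ⊗[QRing] Y.carrier) :
    β.unitHom m z = (tau • β.e) ⊗ₜ[QRing] m.σ (β.evOne z) := rfl

theorem HhBasis.evOne_unitHom (z : B.carrier ⊗[QRing] Y.carrier) :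
    β.evOne (β.unitHom m z) = 0 := by
  rw [β.unitHom_apply, β.evOne_tau]

theorem HhBasis.evTau_unitHom (z : B.carrier ⊗[QRing] Y.carrier) :
    β.evTau (β.unitHom m z) = m.σ (β.evOne z) := by
  rw [β.unitHom_apply, β.evTau_tau]

theorem BorelModel.κ_d (y : Y.carrier) : m.κ (Y.d y) = C.dBase (m.κ y) := by
  conv_lhs => rw [m.eq y]
  rw [map_add, map_smul, m.d_ι, map_add, map_add, m.κ_Q, m.κ_Q, m.κ_ι, zero_add, add_zero]

theorem BorelModel.σ_d (y : Y.carrier) :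
    m.σ (Y.d y) = Y.d (m.σ y) + m.ι (m.κ y + C.tauMap (m.κ y)) := by
  conv_lhs => rw [m.eq y]
  rw [map_add, map_smul, m.d_ι, map_add, map_add, m.σ_Q, m.σ_Q, m.σ_ι, zero_add]

theorem HhBasis.unitInc_d (c : C.carrier) :
    β.unitInc m (C.dBase c) = tensorD B Y (β.unitInc m c) := by
  have h2 := fun z : B.carrier ⊗[QRing] Y.carrier => add_self_eq_zero z
  rw [β.unitInc_apply, β.unitInc_apply, map_add, β.tensorD_e, β.tensorD_tau, m.d_ι, m.d_ι,
    C.dBase_tauMap, C.tauMap_tauMap, map_add, map_add]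
  simp only [TensorProduct.tmul_add, smul_add]
  have e : ∀ a b p q r s : B.carrier ⊗[QRing] Y.carrier,
      p + (a + (p + q)) + r + (q + (s + (b + (s + r)))) =
        a + b + (p + p) + (q + q) + (r + r) + (s + s) := fun a b p q r s => by abel
  rw [e]
  simp only [h2, add_zero]

theorem HhBasis.unitRet_d (z : B.carrier ⊗[QRing] Y.carrier) :
    β.unitRet m (tensorD B Y z) = C.dBase (β.unitRet m z) := by
  rw [β.unitRet_apply, β.unitRet_apply]
  conv_lhs => rw [β.tensor_eq z]
  rw [map_add, β.tensorD_e, β.tensorD_tau]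
  simp only [map_add, β.evOne_e, β.evOne_tau, m.κ_Q, m.κ_d, add_zero, zero_add]

theorem HhBasis.unit_homotopy (z : B.carrier ⊗[QRing] Y.carrier) :
    β.unitInc m (β.unitRet m z) =
      z + (tensorD B Y (β.unitHom m z) + β.unitHom m (tensorD B Y z)) := by
  have h2 := fun z : B.carrier ⊗[QRing] Y.carrier => add_self_eq_zero z
  rw [β.unitInc_apply, β.unitRet_apply, β.unitHom_apply, β.unitHom_apply, β.tensorD_tau]
  have h3 : β.evOne (tensorD B Y z) = Q • β.evOne z + Y.d (β.evOne z) + Q • β.evTau z := by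
    conv_lhs => rw [β.tensor_eq z]
    rw [map_add, β.tensorD_e, β.tensorD_tau]
    simp only [map_add, β.evOne_e, β.evOne_tau, add_zero]
  have h4 := m.eq (β.evOne z)
  have h5 : Q • m.σ (β.evOne z) = β.evOne z + m.ι (m.κ (β.evOne z)) := by
    rw [← sub_eq_iff_eq_add.2 h4, sub_eq_add_neg, neg_eq_of_add_eq_zero_left (add_self_eq_zero _)]
  rw [h3, map_add, map_add, m.σ_Q, m.σ_Q, m.σ_d, h5]
  refine Eq.trans ?_ (congrArg (· + _) (β.tensor_eq z).symm)
  simp only [TensorProduct.tmul_add, map_add]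
  have e : ∀ a t p f g k l : B.carrier ⊗[QRing] Y.carrier,
      a + t + (a + p + (f + g + k) + (f + (k + (g + l)) + t)) =
        p + l + (a + a) + (t + t) + (f + f) + (g + g) + (k + k) := fun a t p f g k l => by abel
  rw [e]
  simp only [h2, add_zero]

theorem HhBasis.evOne_mem {n : ℤ × ℤ} {z : B.carrier ⊗[QRing] Y.carrier}
    (hz : z ∈ tensorGr (A := QRing) B.gr Y.gr n) : β.evOne z ∈ Y.gr n := by
  refine tensorGr_map_mem (β.evOne (Y := Y)).toAddMonoidHom ?_ hz
  rintro i j rfl b hb y hy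
  exact Y.smul_mem (β.v₁_mem i b hb) hy

theorem HhBasis.tau_e_mem : tau • β.e ∈ B.gr 0 := B.s_smul_mem 0 _ β.e_mem

theorem HhBasis.evOne_tau_smul (z : B.carrier ⊗[QRing] Y.carrier) :
    β.evOne (tau • z) = β.evTau z := by
  induction z using TensorProduct.induction_on with
  | zero => rw [smul_zero, map_zero, map_zero]
  | add x y hx hy => rw [smul_add, map_add, map_add, hx, hy]
  | tmul b y => rw [TensorProduct.smul_tmul', β.evOne_tmul, β.evTau_tmul, β.v₁_tau]

theorem HhBasis.evTau_tau_smul (z : B.carrier ⊗[QRing] Y.carrier) :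
    β.evTau (tau • z) = β.evOne z := by
  induction z using TensorProduct.induction_on with
  | zero => rw [smul_zero, map_zero, map_zero]
  | add x y hx hy => rw [smul_add, map_add, map_add, hx, hy]
  | tmul b y => rw [TensorProduct.smul_tmul', β.evOne_tmul, β.evTau_tmul, β.v₂_tau]

/-- The unit of Koszul duality is the inclusion of a retract. -/
def HhBasis.unit : Retraction C (tensorBimodule adjoin_Q B Y) where
  inc := β.unitInc m
  ret := β.unitRet m
  hom := β.unitHom m
  inc_mem n c hc := add_mem (tmul_mem_tensorGr (zero_add n) β.e_mem (m.ι_mem n c hc))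
    (tmul_mem_tensorGr (zero_add n) β.tau_e_mem (m.ι_mem n _ (C.tauMap_mem n c hc)))
  ret_mem n z hz := m.κ_mem n _ (β.evOne_mem hz)
  hom_mem n z hz := tmul_mem_tensorGr (zero_add _) β.tau_e_mem (m.σ_mem n _ (β.evOne_mem hz))
  inc_tau c := by
    have h : β.unitInc m (C.tauMap c) = tau • β.unitInc m c := by
      rw [β.unitInc_apply, β.unitInc_apply, C.tauMap_tauMap, smul_add, TensorProduct.smul_tmul',
        TensorProduct.smul_tmul', HhBasis.tau_tau, add_comm]
    exact h
  inc_d := β.unitInc_d m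
  ret_d := β.unitRet_d m
  ret_inc c := by
    have h : m.κ (β.evOne (β.unitInc m c)) = c := by
      rw [β.unitInc_apply, map_add, β.evOne_e, β.evOne_tau, add_zero, m.κ_ι]
    exact h
  hom_inc c := by
    have h : (tau • β.e) ⊗ₜ[QRing] m.σ (β.evOne (β.unitInc m c)) = 0 := by
      rw [β.unitInc_apply, map_add, β.evOne_e, β.evOne_tau, add_zero, m.σ_ι,
        TensorProduct.tmul_zero]
    exact h
  inc_ret := β.unit_homotopy m

/-- The filtration of the unit by the degree in the inner variable `Q`. -/
def HhBasis.unitFiltration : (β.unit m).Filtration where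
  fil n := LinearMap.ker (((m.σ : Module.End Base Y.carrier) ^ n) ∘ₗ
      (β.evOne (Y := Y)).restrictScalars Base) ⊓
    LinearMap.ker (((m.σ : Module.End Base Y.carrier) ^ n) ∘ₗ
      (β.evTau (Y := Y)).restrictScalars Base)
  zero := by
    refine (Submodule.eq_bot_iff _).2 fun z hz => ?_
    have h1 : β.evOne z = 0 := hz.1
    have h2 : β.evTau z = 0 := hz.2
    refine (β.tensor_eq z).trans ?_
    rw [h1, h2, TensorProduct.tmul_zero, TensorProduct.tmul_zero, add_zero]
    rfl
  exhaust z := by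
    obtain ⟨a, ha⟩ := m.nilpotent (β.evOne z)
    obtain ⟨b, hb⟩ := m.nilpotent (β.evTau z)
    refine ⟨a + b, ?_, ?_⟩
    · change ((m.σ : Module.End Base Y.carrier) ^ (a + b)) (β.evOne z) = 0
      rw [add_comm, pow_add, Module.End.mul_apply, ha, map_zero]
    · change ((m.σ : Module.End Base Y.carrier) ^ (a + b)) (β.evTau z) = 0
      rw [pow_add, Module.End.mul_apply, hb, map_zero]
  tau_mem n z hz := by
    refine ⟨?_, ?_⟩
    · exact (congrArg ((m.σ : Module.End Base Y.carrier) ^ n) (β.evOne_tau_smul z)).trans hz.2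
    · exact (congrArg ((m.σ : Module.End Base Y.carrier) ^ n) (β.evTau_tau_smul z)).trans hz.1
  hom_mem n z hz := by
    have h1 : ((m.σ : Module.End Base Y.carrier) ^ (n + 1)) (β.evOne z) = 0 := hz.1
    rw [pow_succ, Module.End.mul_apply] at h1
    refine ⟨?_, ?_⟩
    · refine (congrArg ((m.σ : Module.End Base Y.carrier) ^ n) (β.evOne_unitHom m z)).trans ?_
      exact map_zero _
    · exact (congrArg ((m.σ : Module.End Base Y.carrier) ^ n) (β.evTau_unitHom m z)).trans h1
  inc_mem c := by
    refine ⟨?_, ?_⟩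
    · change m.σ (β.evOne (β.unitInc m c)) = 0
      rw [β.unitInc_apply, map_add, β.evOne_e, β.evOne_tau, add_zero, m.σ_ι]
    · change m.σ (β.evTau (β.unitInc m c)) = 0
      rw [β.unitInc_apply, map_add, β.evTau_e, β.evTau_tau, zero_add, m.σ_ι]

end Unit

/-- The bimodule `Hh` is free over `R[Q]` on the basis dual to `1`, `τ`. -/
def hhBasis : HhBasis hhBimodule where
  e := hhMk 1 0
  v₁ := { toFun := fun F : HhCarrier => F 1
          map_add' := fun _ _ => rfl
          map_smul' := fun _ _ => rfl }
  v₂ := { toFun := fun F : HhCarrier => F tau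
          map_add' := fun _ _ => rfl
          map_smul' := fun _ _ => rfl }
  v₁_e := hhMk_one 1 0
  v₂_e := hhMk_tau 1 0
  v₁_tau F := congrArg (fun x => (show HhCarrier from F) x) (mul_one tau)
  v₂_tau F := congrArg (fun x => (show HhCarrier from F) x) tau_mul_tau
  eq F := by
    have h : ∀ F : HhCarrier, F = F 1 • hhMk 1 0 + F tau • (tau • hhMk 1 0) := by
      intro F
      apply hh_ext
      · simp [hh_tau_smul_apply, hhMk_one, hhMk_tau]
      · simp [hh_tau_smul_apply, hhMk_one, hhMk_tau, tau_mul_tau]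
    exact h F
  e_mem := by
    refine (mem_hhGr_iff _ _).2 ?_
    rw [hhMk_one, hhMk_tau]
    refine ⟨?_, zero_mem _⟩
    intro a k h
    rw [Polynomial.coeff_one] at h
    split_ifs at h with ha
    · rw [Polynomial.coeff_one] at h
      split_ifs at h with hk
      · rw [ha, hk]; rfl
      · exact absurd rfl h
    · simp at h
  v₁_mem n F hF := ((mem_hhGr_iff n F).1 hF).1
  d_e := by
    have h : hhD (hhMk 1 0) = Q • (hhMk 1 0 + tau • hhMk 1 0) := by
      change Q • ((1 + tau) • hhMk 1 0) = _
      rw [add_smul, one_smul]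
    exact h

/-- Division of polynomials by `Q`, dropping the constant coefficient. -/
def divQ : QRing →ₗ[Base] QRing where
  toFun := Polynomial.divX
  map_add' _ _ := Polynomial.divX_add
  map_smul' r p := by ext; simp

theorem divQ_coeff (q : QRing) (a : ℕ) : (divQ q).coeff a = q.coeff (a + 1) :=
  Polynomial.coeff_divX

theorem divQ_mem {i : ℤ × ℤ} {q : QRing} (hq : q ∈ qGr i) : divQ q ∈ qGr (i + (-1, 0)) := by
  intro a k h
  rw [divQ_coeff] at h
  rw [← hq _ _ h]
  ext <;> simp

theorem divQ_nilpotent (q : QRing) : ∃ n : ℕ, ((divQ : Module.End Base QRing) ^ n) q = 0 := by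
  have h : ∀ (n : ℕ) (q : QRing) (a : ℕ),
      (((divQ : Module.End Base QRing) ^ n) q).coeff a = q.coeff (a + n) := by
    intro n
    induction n with
    | zero => intro q a; rfl
    | succ n ih =>
      intro q a
      rw [pow_succ, Module.End.mul_apply, ih, divQ_coeff, add_assoc]
  refine ⟨q.natDegree + 1, Polynomial.ext fun a => ?_⟩
  rw [h, Polynomial.coeff_zero]
  exact Polynomial.coeff_eq_zero_of_natDegree_lt (by omega)

/-- The Borel construction, with division of polynomials by `Q`. -/
def borelModel (C : KomTau) : BorelModel C (borel C) where
  ι := TensorProduct.mk Base QRing C.carrier 1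
  κ := (TensorProduct.lid Base C.carrier).toLinearMap ∘ₗ
    (Polynomial.lcoeff Base 0).rTensor C.carrier
  σ := divQ.rTensor C.carrier
  ι_mem n c hc := by
    refine tmul_mem_tensorGr (zero_add n) ?_ hc
    intro a k h
    rw [Polynomial.coeff_one] at h
    split_ifs at h with ha
    · rw [Polynomial.coeff_one] at h
      split_ifs at h with hk
      · rw [ha, hk]; rfl
      · exact absurd rfl h
    · simp at h
  κ_mem n z hz := by
    refine tensorGr_map_mem (((TensorProduct.lid Base C.carrier).toLinearMap ∘ₗ
      (Polynomial.lcoeff Base 0).rTensor C.carrier).toAddMonoidHom) ?_ hz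
    rintro i j rfl q hq c hc
    change q.coeff 0 • c ∈ C.gr (i + j)
    by_cases h0 : q.coeff 0 = 0
    · rw [h0, zero_smul]
      exact zero_mem _
    · obtain ⟨a, k, rfl, rfl⟩ := eq_monomial_of_mem_qGr hq (by rintro rfl; exact h0 rfl)
      rw [Polynomial.coeff_C_mul_X_pow] at h0 ⊢
      split_ifs at h0 ⊢ with ha
      · have e : ((0 : ℤ), -2 * (k : ℤ)) + ((a : ℤ), 0) + j = (0, -2 * (k : ℤ)) + j := by
          rw [← ha, Nat.cast_zero, Prod.mk_zero_zero, add_zero]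
        rw [e]
        exact C.u_pow_smul_mem k hc
      · exact absurd rfl h0
  σ_mem n z hz := by
    refine tensorGr_map_mem (P := QRing ⊗[Base] C.carrier)
      (divQ.rTensor C.carrier).toAddMonoidHom ?_ hz
    rintro i j rfl q hq c hc
    exact tmul_mem_tensorGr (by abel) (divQ_mem hq) hc
  κ_ι c := by
    change (1 : QRing).coeff 0 • c = c
    rw [Polynomial.coeff_one_zero, one_smul]
  σ_ι c := by
    have h : divQ 1 = 0 := Polynomial.divX_one
    change divQ 1 ⊗ₜ[Base] c = 0
    rw [h, TensorProduct.zero_tmul]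
  κ_Q := by
    have h : ∀ z : QRing ⊗[Base] C.carrier, TensorProduct.lid Base C.carrier
        ((Polynomial.lcoeff Base 0).rTensor C.carrier (Q • z)) = 0 := by
      intro z
      induction z using TensorProduct.induction_on with
      | zero => simp only [smul_zero, map_zero]
      | add x y hx hy => rw [smul_add, map_add, map_add, hx, hy, add_zero]
      | tmul q c =>
        change (Q * q).coeff 0 • c = 0
        rw [Polynomial.coeff_X_mul_zero, zero_smul]
    exact h
  σ_Q := by
    have h : ∀ z : QRing ⊗[Base] C.carrier, divQ.rTensor C.carrier (Q • z) = z := by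
      intro z
      induction z using TensorProduct.induction_on with
      | zero => simp only [smul_zero, map_zero]
      | add x y hx hy => rw [smul_add, map_add, hx, hy]
      | tmul q c =>
        have e : divQ (Q * q) = q := Polynomial.ext fun a => by
          rw [divQ_coeff, Polynomial.coeff_X_mul]
        change divQ (Q * q) ⊗ₜ[Base] c = q ⊗ₜ c
        rw [e]
    exact h
  eq := by
    have h : ∀ z : QRing ⊗[Base] C.carrier, z = Q • divQ.rTensor C.carrier z +
        (1 : QRing) ⊗ₜ[Base] (TensorProduct.lid Base C.carrier
        ((Polynomial.lcoeff Base 0).rTensor C.carrier z)) := by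
      intro z
      induction z using TensorProduct.induction_on with
      | zero => simp only [smul_zero, map_zero, TensorProduct.tmul_zero, add_zero]
      | add x y hx hy =>
        simp only [map_add, smul_add, TensorProduct.tmul_add]
        rw [add_add_add_comm, ← hx, ← hy]
      | tmul q c =>
        change q ⊗ₜ[Base] c = (Q * divQ q) ⊗ₜ[Base] c + (1 : QRing) ⊗ₜ[Base] (q.coeff 0 • c)
        have e : Q * divQ q + q.coeff 0 • (1 : QRing) = q := by
          rw [← Algebra.algebraMap_eq_smul_one]
          exact Polynomial.X_mul_divX_add q
        rw [← TensorProduct.smul_tmul, ← TensorProduct.add_tmul, e]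
    exact h
  d_ι c := rfl
  nilpotent := by
    have h : ∀ z : QRing ⊗[Base] C.carrier,
        ∃ n : ℕ, ((divQ.rTensor C.carrier : Module.End Base _) ^ n) z = 0 := by
      have e : ∀ (n : ℕ) (q : QRing) (c : C.carrier),
          ((divQ.rTensor C.carrier : Module.End Base _) ^ n) (q ⊗ₜ[Base] c) =
            ((divQ : Module.End Base QRing) ^ n) q ⊗ₜ[Base] c := by
        intro n
        induction n with
        | zero => intro q c; rfl
        | succ n ih =>
          intro q c
          rw [pow_succ, Module.End.mul_apply, LinearMap.rTensor_tmul, ih, pow_succ,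
            Module.End.mul_apply]
      intro z
      induction z using TensorProduct.induction_on with
      | zero => exact ⟨0, map_zero _⟩
      | tmul q c =>
        obtain ⟨n, hn⟩ := divQ_nilpotent q
        exact ⟨n, by rw [e, hn, TensorProduct.zero_tmul]⟩
      | add x y hx hy =>
        obtain ⟨n, hn⟩ := hx
        obtain ⟨m, hm⟩ := hy
        refine ⟨n + m, ?_⟩
        rw [map_add, pow_add, Module.End.mul_apply _ _ y, hm, ← pow_add, add_comm n m, pow_add,
          Module.End.mul_apply, hn, map_zero, map_zero, add_zero]
    exact h

/-- The Borel construction takes the diagonal tensor product to `⊗_Br`: the tensor product of the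
two units `C → Hh (Br C)` becomes a homotopy equivalence. -/
theorem borel_tensor_equivalent (C₁ C₂ : KomTau) :
    HomotopyEquivalent (borel (C₁.tensor C₂)) (brTensor (borel C₁) (borel C₂)) :=
  (((hhBasis.unit (borelModel C₁)).tensor (hhBasis.unit (borelModel C₂))).borel_equivalent
    ((hhBasis.unitFiltration (borelModel C₁)).tensor_nilpotent
      (hhBasis.unitFiltration (borelModel C₂)))).trans (borel_equivalent_Br _)

/-! ### Circles of a connected sum -/

/-- The data of a presentation of `D` as a connected sum of `D₁` and `D₂`, in a form that is
symmetric in the two summands: the half-edges and the crossings of `D` are those of the summands,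
`a₁` is glued to `a₂`, the other half of the first edge to the other half of the second, and the
orientations of the summands are kept or reversed. -/
structure ConnectedSumData (D₁ D₂ D : LinkDiagram) where
  darts : D₁.Darts ⊕ D₂.Darts ≃ D.Darts
  crossings : D₁.C ⊕ D₂.C ≃ D.C
  a₁ : D₁.Darts
  a₂ : D₂.Darts
  e_left : D.e (darts (.inl a₁)) = darts (.inr a₂)
  e_left' : D.e (darts (.inl (D₁.e a₁))) = darts (.inr (D₂.e a₂))
  e_inl : ∀ x, x ≠ a₁ → x ≠ D₁.e a₁ → D.e (darts (.inl x)) = darts (.inl (D₁.e x))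
  e_inr : ∀ x, x ≠ a₂ → x ≠ D₂.e a₂ → D.e (darts (.inr x)) = darts (.inr (D₂.e x))
  crossing_inl : ∀ c i, darts (.inl (.inl (c, i))) = .inl (crossings (.inl c), i)
  crossing_inr : ∀ c i, darts (.inr (.inl (c, i))) = .inl (crossings (.inr c), i)
  res_inl : ∀ (v : D.Vertex) x, D.res v (darts (.inl x)) =
    darts (.inl (D₁.res (fun c => v (crossings (.inl c))) x))
  res_inr : ∀ (v : D.Vertex) x, D.res v (darts (.inr x)) =
    darts (.inr (D₂.res (fun c => v (crossings (.inr c))) x))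
  /-- `1` if the orientation of the first summand is reversed, and `0` otherwise. -/
  s₁ : ZMod 2
  /-- `1` if the orientation of the second summand is reversed, and `0` otherwise. -/
  s₂ : ZMod 2
  o_inl : ∀ x, D.o (darts (.inl x)) = D₁.o x + s₁
  o_inr : ∀ x, D.o (darts (.inr x)) = D₂.o x + s₂

namespace ConnectedSumData

variable {D₁ D₂ D : LinkDiagram} (s : ConnectedSumData D₁ D₂ D)

/-- The inclusion of the half-edges of the first summand. -/
def inL (x : D₁.Darts) : D.Darts := s.darts (.inl x)

/-- The inclusion of the half-edges of the second summand. -/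
def inR (x : D₂.Darts) : D.Darts := s.darts (.inr x)

/-- The resolution of the first summand in a resolution of the connected sum. -/
def vL (v : D.Vertex) : D₁.Vertex := fun c => v (s.crossings (.inl c))

/-- The resolution of the second summand in a resolution of the connected sum. -/
def vR (v : D.Vertex) : D₂.Vertex := fun c => v (s.crossings (.inr c))

/-- The two summands exchanged. -/
def symm : ConnectedSumData D₂ D₁ D where
  darts := (Equiv.sumComm _ _).trans s.darts
  crossings := (Equiv.sumComm _ _).trans s.crossings
  a₁ := s.a₂
  a₂ := s.a₁
  e_left := by
    change D.e (s.darts (.inr s.a₂)) = s.darts (.inl s.a₁)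
    rw [← s.e_left, D.e_e]
  e_left' := by
    change D.e (s.darts (.inr (D₂.e s.a₂))) = s.darts (.inl (D₁.e s.a₁))
    rw [← s.e_left', D.e_e]
  e_inl := s.e_inr
  e_inr := s.e_inl
  crossing_inl := s.crossing_inr
  crossing_inr := s.crossing_inl
  res_inl := s.res_inr
  res_inr := s.res_inl
  s₁ := s.s₂
  s₂ := s.s₁
  o_inl := s.o_inr
  o_inr := s.o_inl

theorem darts_cases {M : D.Darts → Prop} (hL : ∀ x, M (s.inL x)) (hR : ∀ x, M (s.inR x))
    (x : D.Darts) : M x := by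
  obtain ⟨x | x, rfl⟩ := s.darts.surjective x
  · exact hL x
  · exact hR x

/-- In the second summand, the arc that is left of the circle through the basepoint connects the two
halves of the cut edge: in the indicator function of a circle of the connected sum, the half-edges
at each crossing cancel in pairs, so it cannot tell the two halves apart (`cycle_edge`). -/
theorem circle_inR_base (v : D.Vertex) :
    D.circle v (s.inR (D₂.e s.a₂)) = D.circle v (s.inR s.a₂) := by
  classical
  let z : D₂.Darts → ZMod 2 := fun x =>
    if D.circle v (s.inR x) = D.circle v (s.inR s.a₂) then 1 else 0
  have hres : ∀ x, z (D₂.res (s.vR v) x) = z x := by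
    intro x
    have : D.circle v (s.inR (D₂.res (s.vR v) x)) = D.circle v (s.inR x) := by
      rw [← D.circle_res v (s.inR x)]
      exact congrArg _ (s.res_inr v x).symm
    simp only [z, this]
  have hz : z (D₂.e s.a₂) = z s.a₂ := by
    refine D₂.cycle_edge s.a₂ z ?_ ?_ ?_
    · intro x h h'
      have : D.circle v (s.inR (D₂.e x)) = D.circle v (s.inR x) := by
        rw [← D.circle_e v (s.inR x)]
        exact congrArg _ (s.e_inr x h h').symm
      simp only [z, this]
    · intro c
      have h := fun i => hres (.inl (c, i))
      have e : ∀ f : ZMod 4 → ZMod 2, ∑ i : ZMod 4, f i = f 0 + f 1 + f 2 + f 3 :=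
        fun f => Fin.sum_univ_four f
      rw [e]
      cases hv : s.vR v c with
      | false =>
        simp only [D₂.res_false hv] at h
        have h0 : z (.inl (c, 1)) = z (.inl (c, 0)) := h 0
        have h2 : z (.inl (c, 3)) = z (.inl (c, 2)) := h 2
        rw [h0, h2, CharTwo.add_self_eq_zero, zero_add, CharTwo.add_self_eq_zero]
      | true =>
        simp only [D₂.res_true hv] at h
        have h0 : z (.inl (c, 3)) = z (.inl (c, 0)) := h 0
        have h2 : z (.inl (c, 2)) = z (.inl (c, 1)) := h 1
        rw [h0, h2, add_assoc (z (.inl (c, 0))), CharTwo.add_self_eq_zero, add_zero,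
          CharTwo.add_self_eq_zero]
    · intro p
      have h : z (.inr (p, 1)) = z (.inr (p, 0)) := hres (.inr (p, 0))
      have e : ∀ f : ZMod 2 → ZMod 2, ∑ i : ZMod 2, f i = f 0 + f 1 :=
        fun f => Fin.sum_univ_two f
      rw [e, h, CharTwo.add_self_eq_zero]
  by_contra hne
  simp [z, hne] at hz

/-- The circles through the two basepoints become one. -/
theorem circle_base (v : D.Vertex) : D.circle v (s.inR s.a₂) = D.circle v (s.inL s.a₁) := by
  rw [← D.circle_e v (s.inL s.a₁)]
  exact congrArg _ s.e_left.symm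

theorem circle_inL {v : D.Vertex} {x y : D₁.Darts}
    (h : D₁.circle (s.vL v) x = D₁.circle (s.vL v) y) :
    D.circle v (s.inL x) = D.circle v (s.inL y) := by
  refine D₁.circle_rec (r := fun x y => D.circle v (s.inL x) = D.circle v (s.inL y))
    ⟨fun _ => rfl, fun h => h.symm, fun h h' => h.trans h'⟩ ?_ ?_ h
  · have base : D.circle v (s.inL s.a₁) = D.circle v (s.inL (D₁.e s.a₁)) :=
      (s.symm.circle_inR_base v).symm
    intro x
    by_cases h : x = s.a₁
    · rw [h, base]
    · by_cases h' : x = D₁.e s.a₁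
      · rw [h', D₁.e_e, base]
      · rw [← D.circle_e v (s.inL x)]
        exact congrArg _ (s.e_inl x h h')
  · intro x
    rw [← D.circle_res v (s.inL x)]
    exact congrArg _ (s.res_inl v x)

theorem circle_inR {v : D.Vertex} {x y : D₂.Darts}
    (h : D₂.circle (s.vR v) x = D₂.circle (s.vR v) y) :
    D.circle v (s.inR x) = D.circle v (s.inR y) := s.symm.circle_inL h

/-- The map from the circles of the connected sum to those of the first summand that sends all
circles of the second summand to the circle through the basepoint. -/
def collapse (v : D.Vertex) : D.Circle v → D₁.Circle (s.vL v) :=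
  fun c => Quot.lift (r := D.Joined v) (fun x => Sum.elim (D₁.circle (s.vL v))
    (fun _ => D₁.circle (s.vL v) s.a₁) (s.darts.symm x)) (by
    have hL : ∀ x, s.darts.symm (s.inL x) = .inl x := fun x => s.darts.symm_apply_apply _
    have hR : ∀ x, s.darts.symm (s.inR x) = .inr x := fun x => s.darts.symm_apply_apply _
    rintro x _ (rfl | rfl)
    · revert x
      refine s.darts_cases (fun x => ?_) (fun x => ?_)
      · rw [hL]
        by_cases h : x = s.a₁
        · have e : D.e (s.inL x) = s.inR s.a₂ := h ▸ s.e_left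
          rw [e, hR, h]
          rfl
        · by_cases h' : x = D₁.e s.a₁
          · have e : D.e (s.inL x) = s.inR (D₂.e s.a₂) := h' ▸ s.e_left'
            rw [e, hR, h']
            exact D₁.circle_e _ _
          · have e : D.e (s.inL x) = s.inL (D₁.e x) := s.e_inl x h h'
            rw [e, hL]
            exact (D₁.circle_e _ _).symm
      · rw [hR]
        by_cases h : x = s.a₂
        · have e : D.e (s.inR x) = s.inL s.a₁ := h ▸ s.symm.e_left
          rw [e, hL]
          rfl
        · by_cases h' : x = D₂.e s.a₂
          · have e : D.e (s.inR x) = s.inL (D₁.e s.a₁) := h' ▸ s.symm.e_left'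
            rw [e, hL]
            exact (D₁.circle_e _ _).symm
          · have e : D.e (s.inR x) = s.inR (D₂.e x) := s.e_inr x h h'
            rw [e, hR]
            rfl
    · revert x
      refine s.darts_cases (fun x => ?_) (fun x => ?_)
      · have e : D.res v (s.inL x) = s.inL (D₁.res (s.vL v) x) := s.res_inl v x
        rw [e, hL, hL]
        exact (D₁.circle_res _ _).symm
      · have e : D.res v (s.inR x) = s.inR (D₂.res (s.vR v) x) := s.res_inr v x
        rw [e, hR, hR]
        rfl) c

theorem collapse_inL (v : D.Vertex) (x : D₁.Darts) :
    s.collapse v (D.circle v (s.inL x)) = D₁.circle (s.vL v) x :=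
  congrArg (Sum.elim (D₁.circle (s.vL v)) (fun _ => D₁.circle (s.vL v) s.a₁))
    (s.darts.symm_apply_apply (.inl x))

theorem collapse_inR (v : D.Vertex) (x : D₂.Darts) :
    s.collapse v (D.circle v (s.inR x)) = D₁.circle (s.vL v) s.a₁ :=
  congrArg (Sum.elim (D₁.circle (s.vL v)) (fun _ => D₁.circle (s.vL v) s.a₁))
    (s.darts.symm_apply_apply (.inr x))

theorem circle_inL_iff {v : D.Vertex} {x y : D₁.Darts} :
    D.circle v (s.inL x) = D.circle v (s.inL y) ↔
      D₁.circle (s.vL v) x = D₁.circle (s.vL v) y := by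
  refine ⟨fun h => ?_, s.circle_inL⟩
  rw [← s.collapse_inL, h, s.collapse_inL]

end ConnectedSumData

instance (D : LinkDiagram) (v : D.Vertex) : Finite (D.Circle v) :=
  inferInstanceAs (Finite (Quot (D.Joined v)))

namespace ConnectedSumData

variable {D₁ D₂ D : LinkDiagram} (s : ConnectedSumData D₁ D₂ D)

/-- The circles of the connected sum are those of the two summands, with the two circles through
the basepoints identified. -/
theorem numCircles_add_one (v : D.Vertex) :
    D.numCircles v + 1 = D₁.numCircles (s.vL v) + D₂.numCircles (s.vR v) := by
  classical
  let mL : D₁.Circle (s.vL v) → D.Circle v :=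
    Quot.lift (fun x => D.circle v (s.inL x)) fun x y h => s.circle_inL (Quot.sound h)
  let mR : D₂.Circle (s.vR v) → D.Circle v :=
    Quot.lift (fun x => D.circle v (s.inR x)) fun x y h => s.circle_inR (Quot.sound h)
  have cL : ∀ c, s.collapse v (mL c) = c := by
    rintro ⟨x⟩
    exact s.collapse_inL v x
  have cR : ∀ c, s.symm.collapse v (mR c) = c := by
    rintro ⟨x⟩
    exact s.symm.collapse_inL v x
  have cRL : ∀ c, s.symm.collapse v (mL c) = D₂.circle (s.vR v) s.a₂ := by
    rintro ⟨x⟩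
    exact s.symm.collapse_inR v x
  let g : D₁.Circle (s.vL v) ⊕ {c : D₂.Circle (s.vR v) // c ≠ D₂.circle (s.vR v) s.a₂} →
    D.Circle v := Sum.elim mL fun c => mR c.1
  have hg : Function.Bijective g := by
    constructor
    · rintro (c | c) (c' | c') h
      · have := congrArg (s.collapse v) h
        exact congrArg Sum.inl ((cL c).symm.trans (this.trans (cL c')))
      · have := congrArg (s.symm.collapse v) h
        exact absurd ((cR c'.1).symm.trans (this.symm.trans (cRL c))) c'.2
      · have := congrArg (s.symm.collapse v) h
        exact absurd ((cR c.1).symm.trans (this.trans (cRL c'))) c.2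
      · have := congrArg (s.symm.collapse v) h
        exact congrArg Sum.inr (Subtype.ext ((cR c.1).symm.trans (this.trans (cR c'.1))))
    · rintro ⟨x⟩
      change ∃ a, g a = D.circle v x
      revert x
      refine s.darts_cases (fun x => ⟨.inl (D₁.circle _ x), rfl⟩) (fun x => ?_)
      by_cases h : D₂.circle (s.vR v) x = D₂.circle (s.vR v) s.a₂
      · refine ⟨.inl (D₁.circle _ s.a₁), ?_⟩
        rw [s.circle_inR h, s.circle_base]
        rfl
      · exact ⟨.inr ⟨D₂.circle _ x, h⟩, rfl⟩
  have := Fintype.ofFinite (D₁.Circle (s.vL v))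
  have := Fintype.ofFinite (D₂.Circle (s.vR v))
  have hpos : 0 < Fintype.card (D₂.Circle (s.vR v)) :=
    Fintype.card_pos_iff.2 ⟨D₂.circle (s.vR v) s.a₂⟩
  rw [LinkDiagram.numCircles, LinkDiagram.numCircles, LinkDiagram.numCircles,
    ← Nat.card_congr (Equiv.ofBijective g hg), Nat.card_eq_fintype_card, Nat.card_eq_fintype_card,
    Nat.card_eq_fintype_card, Fintype.card_sum, Fintype.card_subtype_compl,
    Fintype.card_subtype_eq]
  omega

theorem card_crossings (p : D.C → Prop) : Nat.card {c // p c} =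
    Nat.card {c // p (s.crossings (.inl c))} + Nat.card {c // p (s.crossings (.inr c))} := by
  rw [← Nat.card_sum]
  exact Nat.card_congr ((Equiv.subtypeEquiv s.crossings.symm (p := p)
    (q := fun c => p (s.crossings c)) (by simp)).trans Equiv.subtypeSum)

theorem weight_eq (v : D.Vertex) : D.weight v = D₁.weight (s.vL v) + D₂.weight (s.vR v) :=
  s.card_crossings fun c => v c = true

theorem nPlus_eq {D₁ D₂ D : LinkDiagram} (s : ConnectedSumData D₁ D₂ D) :
    D.nPlus = D₁.nPlus + D₂.nPlus := by
  rw [LinkDiagram.nPlus, s.card_crossings]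
  -- A sign compares two orientations at a crossing, so a shift of both does not matter.
  simp only [← s.crossing_inl, ← s.crossing_inr, s.o_inl, s.o_inr, add_left_inj]
  rfl

theorem nMinus_eq {D₁ D₂ D : LinkDiagram} (s : ConnectedSumData D₁ D₂ D) :
    D.nMinus = D₁.nMinus + D₂.nMinus := by
  rw [LinkDiagram.nMinus, s.card_crossings]
  simp only [← s.crossing_inl, ← s.crossing_inr, s.o_inl, s.o_inr, add_left_inj]
  rfl

theorem hDeg_eq (v : D.Vertex) : D.hDeg v = D₁.hDeg (s.vL v) + D₂.hDeg (s.vR v) := by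
  simp only [LinkDiagram.hDeg, s.weight_eq, s.nMinus_eq]
  push_cast
  ring

/-- The `-1` is the circle lost in the connected sum; it makes up for the normalization of the
reduced quantum degree, which is shifted by one in each summand. -/
theorem qDeg_eq (v : D.Vertex) (m n : ℕ) :
    D.qDeg v (m + n) = D₁.qDeg (s.vL v) m + D₂.qDeg (s.vR v) n - 1 := by
  have := s.numCircles_add_one v
  simp only [LinkDiagram.qDeg, s.weight_eq, s.nMinus_eq, s.nPlus_eq]
  omega

end ConnectedSumData

set_option maxSynthPendingDepth 3

/-! ### The reduced algebra of a resolution of a connected sum -/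

namespace LinkDiagram

variable (D : LinkDiagram)

/-- The element `x_c + x_a` of the reduced algebra, for a circle `c` and a half-edge `a`. These
elements generate the reduced algebra; the one for the circle through `a` vanishes. -/
def redGen (v : D.Vertex) (a : D.Darts) : D.Circle v → D.redAlg v :=
  Quot.lift (fun x => ⟨Ideal.Quotient.mk (D.ideal v) (MvPolynomial.X x + MvPolynomial.X a),
    Algebra.subset_adjoin ⟨x, a, rfl⟩⟩) fun x y h => by
    refine Subtype.ext ?_
    change Ideal.Quotient.mk (D.ideal v) _ = Ideal.Quotient.mk (D.ideal v) _
    rw [map_add, map_add, D.mk_X_eq (Quot.sound h)]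

theorem coe_redGen (v : D.Vertex) (a x : D.Darts) : (D.redGen v a (D.circle v x) : D.Alg v) =
    Ideal.Quotient.mk (D.ideal v) (MvPolynomial.X x) +
      Ideal.Quotient.mk (D.ideal v) (MvPolynomial.X a) :=
  map_add (Ideal.Quotient.mk (D.ideal v)) _ _

theorem redGen_self (v : D.Vertex) (a : D.Darts) : D.redGen v a (D.circle v a) = 0 :=
  Subtype.ext ((D.coe_redGen v a a).trans (D.alg_add_self _))

theorem redGen_sq (v : D.Vertex) (a : D.Darts) (c : D.Circle v) :
    D.redGen v a c * D.redGen v a c = algebraMap Base _ u * D.redGen v a c := by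
  obtain ⟨x, rfl⟩ := Quot.exists_rep c
  refine Subtype.ext ?_
  change (D.redGen v a (D.circle v x) : D.Alg v) * (D.redGen v a (D.circle v x) : D.Alg v) =
    Ideal.Quotient.mk (D.ideal v) (MvPolynomial.C u) * (D.redGen v a (D.circle v x) : D.Alg v)
  rw [coe_redGen, mul_add, add_mul, add_mul, mk_X_sq, mk_X_sq, mul_add]
  linear_combination D.alg_add_self (Ideal.Quotient.mk (D.ideal v) (MvPolynomial.X x) *
    Ideal.Quotient.mk (D.ideal v) (MvPolynomial.X a))

theorem mk_X_add_X (v : D.Vertex) (a x y : D.Darts) :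
    Ideal.Quotient.mk (D.ideal v) (MvPolynomial.X x + MvPolynomial.X y) =
      (D.redGen v a (D.circle v x) : D.Alg v) + D.redGen v a (D.circle v y) := by
  rw [coe_redGen, coe_redGen, map_add]
  linear_combination - D.alg_add_self (Ideal.Quotient.mk (D.ideal v) (MvPolynomial.X a))

/-- The universal property of `R[x_c : c ∈ Z(D_v)] / (x_c ^ 2 = u x_c)`. -/
def algLift (v : D.Vertex) {T : Type} [CommRing T] [Algebra Base T] (g : D.Circle v → T)
    (hg : ∀ c, g c * g c = algebraMap Base T u * g c) : D.Alg v →ₐ[Base] T :=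
  Ideal.Quotient.liftₐ (D.ideal v) (MvPolynomial.aeval fun x => g (D.circle v x)) fun F hF => by
    rw [← RingHom.mem_ker]
    refine (Ideal.span_le (I := RingHom.ker _)).2 ?_ hF
    rintro _ (⟨x, rfl⟩ | ⟨x, y, hxy, rfl⟩)
    · change MvPolynomial.aeval _ _ = _
      rw [map_sub, map_pow, map_mul, MvPolynomial.aeval_X, MvPolynomial.aeval_C, pow_two, hg,
        sub_self]
    · change MvPolynomial.aeval _ _ = _
      rw [map_sub, MvPolynomial.aeval_X, MvPolynomial.aeval_X, hxy, sub_self]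

theorem algLift_mk_X (v : D.Vertex) {T : Type} [CommRing T] [Algebra Base T] (g : D.Circle v → T)
    (hg : ∀ c, g c * g c = algebraMap Base T u * g c) (x : D.Darts) :
    D.algLift v g hg (Ideal.Quotient.mk (D.ideal v) (MvPolynomial.X x)) = g (D.circle v x) :=
  MvPolynomial.aeval_X _ x

end LinkDiagram

namespace ConnectedSumData

variable {D₁ D₂ D : LinkDiagram} (s : ConnectedSumData D₁ D₂ D)

theorem rename_mem_ideal (v : D.Vertex) :
    D₁.ideal (s.vL v) ≤ (D.ideal v).comap (MvPolynomial.rename (R := Base) s.inL) := by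
  refine Ideal.span_le.2 ?_
  rintro _ (⟨x, rfl⟩ | ⟨x, y, hxy, rfl⟩)
  · change MvPolynomial.rename _ _ ∈ D.ideal v
    simp only [map_sub, map_mul, map_pow, MvPolynomial.rename_X, MvPolynomial.rename_C]
    exact D.sq_sub_mem v _
  · change MvPolynomial.rename _ _ ∈ D.ideal v
    simp only [map_sub, MvPolynomial.rename_X]
    exact D.X_sub_X_mem (s.circle_inL hxy)

/-- The map from the algebra of the first summand that is induced by the inclusion of circles. -/
def algL (v : D.Vertex) : D₁.Alg (s.vL v) →ₐ[Base] D.Alg v :=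
  Ideal.quotientMapₐ (D.ideal v) (MvPolynomial.rename s.inL) (s.rename_mem_ideal v)

/-- The map from the algebra of the second summand that is induced by the inclusion of circles. -/
def algR (v : D.Vertex) : D₂.Alg (s.vR v) →ₐ[Base] D.Alg v := s.symm.algL v

theorem algL_mk (v : D.Vertex) (F : D₁.Poly) : s.algL v (Ideal.Quotient.mk _ F) =
    Ideal.Quotient.mk _ (MvPolynomial.rename s.inL F) := rfl

theorem algR_mk (v : D.Vertex) (F : D₂.Poly) : s.algR v (Ideal.Quotient.mk _ F) =
    Ideal.Quotient.mk _ (MvPolynomial.rename s.inR F) := rfl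

theorem algL_mem_redAlg (v : D.Vertex) {z : D₁.Alg (s.vL v)} (hz : z ∈ D₁.redAlg (s.vL v)) :
    s.algL v z ∈ D.redAlg v := by
  induction hz using Algebra.adjoin_induction with
  | mem z hz =>
    obtain ⟨x, y, rfl⟩ := hz
    rw [algL_mk, map_add, MvPolynomial.rename_X, MvPolynomial.rename_X]
    exact Algebra.subset_adjoin ⟨_, _, rfl⟩
  | algebraMap r => rw [AlgHom.commutes]; exact algebraMap_mem _ _
  | add z z' _ _ h h' => rw [map_add]; exact add_mem h h'
  | mul z z' _ _ h h' => rw [map_mul]; exact mul_mem h h'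

theorem algR_mem_redAlg (v : D.Vertex) {z : D₂.Alg (s.vR v)} (hz : z ∈ D₂.redAlg (s.vR v)) :
    s.algR v z ∈ D.redAlg v := s.symm.algL_mem_redAlg v hz

/-- The tensor product of the two reduced algebras over `R`. -/
abbrev RedTensor (v : D.Vertex) : Type := D₁.redAlg (s.vL v) ⊗[Base] D₂.redAlg (s.vR v)

/-- The multiplication map from the tensor product of the reduced algebras of the summands. It is
injective, and its image is the reduced algebra of the connected sum. -/
def mulMap (v : D.Vertex) : s.RedTensor v →ₐ[Base] D.Alg v :=
  Algebra.TensorProduct.productMap ((s.algL v).comp (D₁.redAlg (s.vL v)).val)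
    ((s.algR v).comp (D₂.redAlg (s.vR v)).val)

theorem mulMap_tmul (v : D.Vertex) (x : D₁.redAlg (s.vL v)) (y : D₂.redAlg (s.vR v)) :
    s.mulMap v (x ⊗ₜ y) = s.algL v x * s.algR v y :=
  Algebra.TensorProduct.productMap_apply_tmul _ _ _ _

theorem mulMap_mem_redAlg (v : D.Vertex) (t : s.RedTensor v) : s.mulMap v t ∈ D.redAlg v := by
  induction t using TensorProduct.induction_on with
  | zero => rw [map_zero]; exact zero_mem _
  | tmul x y =>
    rw [mulMap_tmul]
    exact mul_mem (s.algL_mem_redAlg v x.2) (s.algR_mem_redAlg v y.2)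
  | add x y hx hy => rw [map_add]; exact add_mem hx hy

/-- The element of the tensor product of the reduced algebras that corresponds to `x_c + x_a`,
where `a` is the basepoint. A circle of the connected sum collapses to the circle through the
basepoint in at least one summand, so at most one of the two terms is nonzero. -/
def splitGen (v : D.Vertex) (c : D.Circle v) : s.RedTensor v :=
  D₁.redGen (s.vL v) s.a₁ (s.collapse v c) ⊗ₜ 1 + 1 ⊗ₜ D₂.redGen (s.vR v) s.a₂ (s.symm.collapse v c)

theorem splitGen_sq (v : D.Vertex) (c : D.Circle v) :
    s.splitGen v c * s.splitGen v c = algebraMap Base _ u * s.splitGen v c := by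
  have h : ∀ a : s.RedTensor v, a + a = 0 := fun a => add_self_eq_zero a
  set x := D₁.redGen (s.vL v) s.a₁ (s.collapse v c) with hx
  set y := D₂.redGen (s.vR v) s.a₂ (s.symm.collapse v c) with hy
  have hx2 : x * x = algebraMap Base _ u * x := D₁.redGen_sq _ _ _
  have hy2 : y * y = algebraMap Base _ u * y := D₂.redGen_sq _ _ _
  have e1 : (algebraMap Base _ u * x) ⊗ₜ[Base] (1 : D₂.redAlg (s.vR v)) =
      algebraMap Base (s.RedTensor v) u * (x ⊗ₜ 1) := by
    rw [← Algebra.smul_def, ← Algebra.smul_def, TensorProduct.smul_tmul']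
  have e2 : (1 : D₁.redAlg (s.vL v)) ⊗ₜ[Base] (algebraMap Base _ u * y) =
      algebraMap Base (s.RedTensor v) u * (1 ⊗ₜ y) := by
    rw [← Algebra.smul_def, ← Algebra.smul_def, TensorProduct.tmul_smul]
  change (x ⊗ₜ 1 + 1 ⊗ₜ y) * (x ⊗ₜ 1 + 1 ⊗ₜ y) =
    algebraMap Base (s.RedTensor v) u * (x ⊗ₜ 1 + 1 ⊗ₜ y)
  rw [mul_add, add_mul, add_mul, Algebra.TensorProduct.tmul_mul_tmul,
    Algebra.TensorProduct.tmul_mul_tmul, Algebra.TensorProduct.tmul_mul_tmul,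
    Algebra.TensorProduct.tmul_mul_tmul, hx2, hy2, one_mul, mul_one, one_mul, mul_one, one_mul,
    mul_one, mul_add, e1, e2]
  have e3 : ∀ a b c : s.RedTensor v, a + c + (c + b) = a + b + (c + c) := fun a b c => by abel
  rw [e3, h, add_zero]

/-- The algebra map that is inverse to `mulMap` on the reduced algebra. -/
def splitMap (v : D.Vertex) : D.Alg v →ₐ[Base] s.RedTensor v :=
  D.algLift v (s.splitGen v) (s.splitGen_sq v)

theorem splitMap_mk_X (v : D.Vertex) (x : D.Darts) :
    s.splitMap v (Ideal.Quotient.mk (D.ideal v) (MvPolynomial.X x)) =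
      s.splitGen v (D.circle v x) := D.algLift_mk_X v _ _ x

theorem splitGen_inL (v : D.Vertex) (x : D₁.Darts) : s.splitGen v (D.circle v (s.inL x)) =
    D₁.redGen (s.vL v) s.a₁ (D₁.circle (s.vL v) x) ⊗ₜ 1 := by
  have h : s.symm.collapse v (D.circle v (s.inL x)) = D₂.circle (s.vR v) s.a₂ :=
    s.symm.collapse_inR v x
  rw [splitGen, collapse_inL, h, LinkDiagram.redGen_self, TensorProduct.tmul_zero, add_zero]

theorem splitGen_inR (v : D.Vertex) (x : D₂.Darts) : s.splitGen v (D.circle v (s.inR x)) =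
    1 ⊗ₜ D₂.redGen (s.vR v) s.a₂ (D₂.circle (s.vR v) x) := by
  have h : s.symm.collapse v (D.circle v (s.inR x)) = D₂.circle (s.vR v) x :=
    s.symm.collapse_inL v x
  rw [splitGen, collapse_inR, h, LinkDiagram.redGen_self, TensorProduct.zero_tmul, zero_add]

theorem splitMap_algL (v : D.Vertex) (z : D₁.redAlg (s.vL v)) :
    s.splitMap v (s.algL v z) = z ⊗ₜ 1 := by
  obtain ⟨z, hz⟩ := z
  induction hz using Algebra.adjoin_induction with
  | mem z hz =>
    obtain ⟨x, y, rfl⟩ := hz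
    change s.splitMap v (s.algL v (Ideal.Quotient.mk _ (MvPolynomial.X x + MvPolynomial.X y))) = _
    rw [algL_mk, map_add, MvPolynomial.rename_X, MvPolynomial.rename_X, map_add, map_add,
      splitMap_mk_X, splitMap_mk_X, splitGen_inL, splitGen_inL, ← TensorProduct.add_tmul]
    congr 1
    exact Subtype.ext (D₁.mk_X_add_X _ s.a₁ x y).symm
  | algebraMap r =>
    change s.splitMap v (s.algL v (algebraMap Base _ r)) = (algebraMap Base _ r) ⊗ₜ 1
    rw [AlgHom.commutes, AlgHom.commutes]
    rfl
  | add z z' hz hz' h h' =>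
    change s.splitMap v (s.algL v (z + z')) = ((⟨z, hz⟩ + ⟨z', hz'⟩ : D₁.redAlg (s.vL v))) ⊗ₜ 1
    rw [map_add, map_add, TensorProduct.add_tmul, ← h, ← h']
  | mul z z' hz hz' h h' =>
    change s.splitMap v (s.algL v (z * z')) = ((⟨z, hz⟩ * ⟨z', hz'⟩ : D₁.redAlg (s.vL v))) ⊗ₜ 1
    rw [map_mul, map_mul, ← mul_one (1 : D₂.redAlg (s.vR v)),
      ← Algebra.TensorProduct.tmul_mul_tmul, ← h, ← h']

theorem splitMap_algR (v : D.Vertex) (z : D₂.redAlg (s.vR v)) :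
    s.splitMap v (s.algR v z) = 1 ⊗ₜ z := by
  obtain ⟨z, hz⟩ := z
  induction hz using Algebra.adjoin_induction with
  | mem z hz =>
    obtain ⟨x, y, rfl⟩ := hz
    change s.splitMap v (s.algR v (Ideal.Quotient.mk _ (MvPolynomial.X x + MvPolynomial.X y))) = _
    rw [algR_mk, map_add, MvPolynomial.rename_X, MvPolynomial.rename_X, map_add, map_add,
      splitMap_mk_X, splitMap_mk_X, splitGen_inR, splitGen_inR, ← TensorProduct.tmul_add]
    congr 1
    exact Subtype.ext (D₂.mk_X_add_X _ s.a₂ x y).symm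
  | algebraMap r =>
    change s.splitMap v (s.algR v (algebraMap Base _ r)) = 1 ⊗ₜ (algebraMap Base _ r)
    rw [AlgHom.commutes, AlgHom.commutes, Algebra.algebraMap_eq_smul_one,
      Algebra.algebraMap_eq_smul_one, TensorProduct.tmul_smul]
    rfl
  | add z z' hz hz' h h' =>
    change s.splitMap v (s.algR v (z + z')) = 1 ⊗ₜ ((⟨z, hz⟩ + ⟨z', hz'⟩ : D₂.redAlg (s.vR v)))
    rw [map_add, map_add, TensorProduct.tmul_add, ← h, ← h']
  | mul z z' hz hz' h h' =>
    change s.splitMap v (s.algR v (z * z')) = 1 ⊗ₜ ((⟨z, hz⟩ * ⟨z', hz'⟩ : D₂.redAlg (s.vR v)))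
    rw [map_mul, map_mul, ← mul_one (1 : D₁.redAlg (s.vL v)),
      ← Algebra.TensorProduct.tmul_mul_tmul, ← h, ← h']

theorem splitMap_mulMap (v : D.Vertex) (t : s.RedTensor v) : s.splitMap v (s.mulMap v t) = t := by
  induction t using TensorProduct.induction_on with
  | zero => rw [map_zero, map_zero]
  | tmul x y =>
    rw [mulMap_tmul, map_mul, splitMap_algL, splitMap_algR, Algebra.TensorProduct.tmul_mul_tmul,
      mul_one, one_mul]
  | add x y hx hy => rw [map_add, map_add, hx, hy]

/-- On `D.Alg v`, the composition sends `x_c` to `x_c + x_a`, where `a` is the basepoint; it fixes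
only the reduced algebra. -/
theorem mulMap_splitGen (v : D.Vertex) (x : D.Darts) : s.mulMap v (s.splitGen v (D.circle v x)) =
    Ideal.Quotient.mk (D.ideal v) (MvPolynomial.X x) +
      Ideal.Quotient.mk (D.ideal v) (MvPolynomial.X (s.inL s.a₁)) := by
  revert x
  refine s.darts_cases (fun x => ?_) (fun x => ?_)
  · rw [splitGen_inL, mulMap_tmul, LinkDiagram.coe_redGen, map_add, algL_mk, algL_mk,
      MvPolynomial.rename_X, MvPolynomial.rename_X]
    exact (congrArg _ (map_one (s.algR v))).trans (mul_one _)
  · rw [splitGen_inR, mulMap_tmul, LinkDiagram.coe_redGen, map_add, algR_mk, algR_mk,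
      MvPolynomial.rename_X, MvPolynomial.rename_X, D.mk_X_eq (s.circle_base v)]
    exact (congrArg (· * _) (map_one (s.algL v))).trans (one_mul _)

theorem mulMap_splitMap (v : D.Vertex) {z : D.Alg v} (hz : z ∈ D.redAlg v) :
    s.mulMap v (s.splitMap v z) = z := by
  induction hz using Algebra.adjoin_induction with
  | mem z hz =>
    obtain ⟨x, y, rfl⟩ := hz
    rw [map_add, map_add, map_add, splitMap_mk_X, splitMap_mk_X, mulMap_splitGen, mulMap_splitGen]
    linear_combination D.alg_add_self
      (Ideal.Quotient.mk (D.ideal v) (MvPolynomial.X (s.inL s.a₁)))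
  | algebraMap r => rw [AlgHom.commutes, AlgHom.commutes]
  | add z z' _ _ h h' => rw [map_add, map_add, h, h']
  | mul z z' _ _ h h' => rw [map_mul, map_mul, h, h']

end ConnectedSumData

theorem sum_prod_tmul {ι κ A M N : Type} [Fintype ι] [Fintype κ] [CommRing A] [AddCommGroup M]
    [AddCommGroup N] [Module A M] [Module A N] (f : ι → M) (g : κ → N) :
    ∑ p : ι × κ, f p.1 ⊗ₜ[A] g p.2 = (∑ i, f i) ⊗ₜ (∑ j, g j) := by
  rw [Fintype.sum_prod_type, TensorProduct.sum_tmul]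
  simp only [TensorProduct.tmul_sum]

/-! ### The reduced complex of a connected sum -/

namespace LinkDiagram

variable (D : LinkDiagram)

/-- The component of an element of the reduced complex at a vertex of the cube. -/
def component (v : D.Vertex) : D.kcrSub →ₗ[Base] D.redAlg v where
  toFun f := ⟨f.1 v, D.mem_kcrSub.1 f.2 v⟩
  map_add' _ _ := rfl
  map_smul' _ _ := rfl

/-- The inclusion of the reduced algebra at a vertex of the cube into the reduced complex. -/
def atVertex (v : D.Vertex) : D.redAlg v →ₗ[Base] D.kcrSub where
  toFun z := ⟨Pi.single v (z : D.Alg v), D.mem_kcrSub.2 fun w => by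
    by_cases h : w = v
    · subst h
      rw [Pi.single_eq_same]
      exact z.2
    · rw [Pi.single_eq_of_ne h]
      exact zero_mem _⟩
  map_add' x y := Subtype.ext (Pi.single_add (f := D.Alg) v (x : D.Alg v) (y : D.Alg v))
  map_smul' r x := Subtype.ext (Pi.single_smul (f := D.Alg) v r (x : D.Alg v))

theorem component_atVertex (v : D.Vertex) (z : D.redAlg v) :
    D.component v (D.atVertex v z) = z :=
  Subtype.ext (Pi.single_eq_same (M := D.Alg) v (z : D.Alg v))

theorem component_atVertex_of_ne {v w : D.Vertex} (h : w ≠ v) (z : D.redAlg v) :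
    D.component w (D.atVertex v z) = 0 :=
  Subtype.ext (Pi.single_eq_of_ne (M := D.Alg) h (z : D.Alg v))

theorem sum_atVertex (f : D.kcrSub) : ∑ v, D.atVertex v (D.component v f) = f := by
  refine Subtype.ext ?_
  rw [AddSubmonoidClass.coe_finsetSum]
  exact Finset.univ_sum_single f.1

theorem update_edge {w : D.Vertex} {c : D.C} : (Function.update w c false c = false ∧
    w = Function.update (Function.update w c false) c true) ↔ w c = true := by
  rw [Function.update_self, Function.update_idem]
  exact ⟨fun h => by rw [h.2, Function.update_self],
    fun h => ⟨rfl, by rw [← h, Function.update_eq_self]⟩⟩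

/-- The differential as a sum over the crossings: for each crossing there is at most one edge of
the cube with a given target. -/
theorem kcD_apply_eq (f : D.Kc) (w : D.Vertex) : D.kcD f w =
    ∑ c : D.C, D.edgeMap (Function.update w c false) w c (f (Function.update w c false)) := by
  rw [kcD_apply, Finset.sum_comm]
  refine Finset.sum_congr rfl fun c _ => Finset.sum_eq_single _ (fun v _ hv => ?_)
    fun h => absurd (Finset.mem_univ _) h
  rw [edgeMap, dif_neg, LinearMap.zero_apply]
  rintro ⟨h, rfl⟩
  exact hv (by rw [Function.update_idem, ← h, Function.update_eq_self])

end LinkDiagram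

namespace ConnectedSumData

variable {D₁ D₂ D : LinkDiagram} (s : ConnectedSumData D₁ D₂ D)

/-- The cube of resolutions of the connected sum is the product of the cubes of the summands. -/
def vertexEquiv : D.Vertex ≃ D₁.Vertex × D₂.Vertex :=
  (Equiv.arrowCongr s.crossings.symm (Equiv.refl Bool)).trans (Equiv.sumArrowEquivProdArrow _ _ _)

/-- The map from the tensor product of the reduced complexes of the summands to the reduced
complex of the connected sum. -/
def sumMap : D₁.kcrSub ⊗[Base] D₂.kcrSub →ₗ[Base] D.kcrSub :=
  LinearMap.codRestrict D.kcrSub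
    (LinearMap.pi fun v => (s.mulMap v).toLinearMap.comp
      (TensorProduct.map (D₁.component (s.vL v)) (D₂.component (s.vR v))))
    fun _ => D.mem_kcrSub.2 fun v => s.mulMap_mem_redAlg v _

theorem sumMap_apply (t : D₁.kcrSub ⊗[Base] D₂.kcrSub) (v : D.Vertex) : (s.sumMap t).1 v =
    s.mulMap v (TensorProduct.map (D₁.component (s.vL v)) (D₂.component (s.vR v)) t) := rfl

theorem sumMap_tmul (f : D₁.kcrSub) (g : D₂.kcrSub) (v : D.Vertex) :
    (s.sumMap (f ⊗ₜ g)).1 v = s.algL v (f.1 (s.vL v)) * s.algR v (g.1 (s.vR v)) := by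
  rw [sumMap_apply, TensorProduct.map_tmul, mulMap_tmul]
  rfl

/-- The inverse of `sumMap`. -/
def sumInv : D.kcrSub →ₗ[Base] D₁.kcrSub ⊗[Base] D₂.kcrSub :=
  ∑ v, (TensorProduct.map (D₁.atVertex (s.vL v)) (D₂.atVertex (s.vR v))).comp
    ((s.splitMap v).toLinearMap.comp ((D.redAlg v).val.toLinearMap.comp (D.component v)))

theorem sumInv_apply (f : D.kcrSub) : s.sumInv f =
    ∑ v, TensorProduct.map (D₁.atVertex (s.vL v)) (D₂.atVertex (s.vR v))
      (s.splitMap v (f.1 v)) := by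
  rw [sumInv, LinearMap.sum_apply]
  rfl

theorem sumInv_sumMap (t : D₁.kcrSub ⊗[Base] D₂.kcrSub) : s.sumInv (s.sumMap t) = t := by
  rw [sumInv_apply]
  simp only [sumMap_apply, splitMap_mulMap]
  induction t using TensorProduct.induction_on with
  | zero => simp
  | add x y hx hy => simp only [map_add, Finset.sum_add_distrib, hx, hy]
  | tmul f g =>
    simp only [TensorProduct.map_tmul]
    refine (Equiv.sum_comp s.vertexEquiv fun p : D₁.Vertex × D₂.Vertex =>
      D₁.atVertex p.1 (D₁.component p.1 f) ⊗ₜ[Base] D₂.atVertex p.2 (D₂.component p.2 g)).trans ?_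
    refine (sum_prod_tmul (fun v => D₁.atVertex v (D₁.component v f))
      fun v => D₂.atVertex v (D₂.component v g)).trans ?_
    rw [LinkDiagram.sum_atVertex, LinkDiagram.sum_atVertex]

theorem map_component_atVertex {v w : D.Vertex} (h : w ≠ v) (t : s.RedTensor v) :
    TensorProduct.map (D₁.component (s.vL w)) (D₂.component (s.vR w))
      (TensorProduct.map (D₁.atVertex (s.vL v)) (D₂.atVertex (s.vR v)) t) = 0 := by
  induction t using TensorProduct.induction_on with
  | zero => rw [map_zero, map_zero]
  | add x y hx hy => rw [map_add, map_add, hx, hy, add_zero]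
  | tmul x y =>
    rw [TensorProduct.map_tmul, TensorProduct.map_tmul]
    by_cases hL : s.vL w = s.vL v
    · by_cases hR : s.vR w = s.vR v
      · exact absurd (s.vertexEquiv.injective (Prod.ext hL hR)) h
      · rw [D₂.component_atVertex_of_ne hR, TensorProduct.tmul_zero]
    · rw [D₁.component_atVertex_of_ne hL, TensorProduct.zero_tmul]

theorem map_component_atVertex_self (v : D.Vertex) (t : s.RedTensor v) :
    TensorProduct.map (D₁.component (s.vL v)) (D₂.component (s.vR v))
      (TensorProduct.map (D₁.atVertex (s.vL v)) (D₂.atVertex (s.vR v)) t) = t := by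
  induction t using TensorProduct.induction_on with
  | zero => rw [map_zero, map_zero]
  | add x y hx hy => rw [map_add, map_add, hx, hy]
  | tmul x y =>
    rw [TensorProduct.map_tmul, TensorProduct.map_tmul, LinkDiagram.component_atVertex,
      LinkDiagram.component_atVertex]

theorem sumMap_sumInv (f : D.kcrSub) : s.sumMap (s.sumInv f) = f := by
  refine Subtype.ext (funext fun v => ?_)
  rw [sumMap_apply, sumInv_apply, map_sum, Finset.sum_eq_single v, map_component_atVertex_self,
    s.mulMap_splitMap v (D.mem_kcrSub.1 f.2 v)]
  · exact fun w _ h => s.map_component_atVertex h.symm _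
  · exact fun h => absurd (Finset.mem_univ _) h

theorem algL_mono (v : D.Vertex) (a : ℕ) (m : D₁.Darts →₀ ℕ) :
    s.algL v (D₁.mono (s.vL v) a m) = D.mono v a (m.mapDomain s.inL) := by
  rw [LinkDiagram.mono, algL_mk, MvPolynomial.rename_monomial]
  rfl

theorem algR_mono (v : D.Vertex) (a : ℕ) (m : D₂.Darts →₀ ℕ) :
    s.algR v (D₂.mono (s.vR v) a m) = D.mono v a (m.mapDomain s.inR) := s.symm.algL_mono v a m

theorem mul_mem_vertexGr (v : D.Vertex) {k l : ℤ × ℤ} {x : D₁.Alg (s.vL v)}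
    (hx : x ∈ D₁.vertexGr (s.vL v) (k + (0, 1))) {y : D₂.Alg (s.vR v)}
    (hy : y ∈ D₂.vertexGr (s.vR v) (l + (0, 1))) :
    s.algL v x * s.algR v y ∈ D.vertexGr v (k + l + (0, 1)) := by
  induction hx using AddSubgroup.closure_induction with
  | zero => rw [map_zero, zero_mul]; exact zero_mem _
  | add x x' _ _ h h' => rw [map_add, add_mul]; exact add_mem h h'
  | neg x _ h => rw [map_neg, neg_mul]; exact neg_mem h
  | mem x hx =>
    obtain ⟨a, m, hk, rfl⟩ := hx
    induction hy using AddSubgroup.closure_induction with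
    | zero => rw [map_zero, mul_zero]; exact zero_mem _
    | add y y' _ _ h h' => rw [map_add, mul_add]; exact add_mem h h'
    | neg y _ h => rw [map_neg, mul_neg]; exact neg_mem h
    | mem y hy =>
      obtain ⟨b, n, hl, rfl⟩ := hy
      rw [algL_mono, algR_mono, LinkDiagram.mono_mul_mono]
      refine AddSubgroup.subset_closure ⟨_, _, ?_, rfl⟩
      have hd : a + b + (m.mapDomain s.inL + n.mapDomain s.inR).degree =
          (a + m.degree) + (b + n.degree) := by
        rw [map_add, Finsupp.degree_mapDomain, Finsupp.degree_mapDomain]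
        omega
      rw [hd, s.hDeg_eq, s.qDeg_eq]
      have hk1 := congrArg Prod.fst hk
      have hk2 := congrArg Prod.snd hk
      have hl1 := congrArg Prod.fst hl
      have hl2 := congrArg Prod.snd hl
      simp only [Prod.fst_add, Prod.snd_add] at hk1 hk2 hl1 hl2
      ext
      · simp only [Prod.fst_add]
        omega
      · simp only [Prod.snd_add]
        omega

theorem sumMap_mem {k : ℤ × ℤ} {t : D₁.kcrSub ⊗[Base] D₂.kcrSub}
    (ht : t ∈ tensorGr D₁.kcrGr D₂.kcrGr k) : s.sumMap t ∈ D.kcrGr k := by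
  refine tensorGr_map_mem s.sumMap.toAddMonoidHom ?_ ht
  rintro i j rfl f hf g hg v
  change (s.sumMap (f ⊗ₜ g)).1 v ∈ _
  rw [sumMap_tmul]
  exact s.mul_mem_vertexGr v (hf _) (hg _)

theorem rename_theta (w : D.Vertex) (c : D₁.C) :
    MvPolynomial.rename s.inL (D₁.theta (s.vL w) c) = D.theta w (s.crossings (.inl c)) := by
  have e0 : s.inL (.inl (c, 0)) = .inl (s.crossings (.inl c), 0) := s.crossing_inl c 0
  have e1 : s.inL (.inl (c, 1)) = .inl (s.crossings (.inl c), 1) := s.crossing_inl c 1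
  by_cases h : D₁.circle (s.vL w) (.inl (c, 0)) = D₁.circle (s.vL w) (.inl (c, 1))
  · rw [D₁.theta_pos h, D.theta_pos, map_one]
    rw [← e0, ← e1]
    exact s.circle_inL h
  · rw [D₁.theta_neg h, D.theta_neg, ← e0, ← e1]
    · simp only [map_add, MvPolynomial.rename_X, MvPolynomial.rename_C]
    · rw [← e0, ← e1, s.circle_inL_iff]
      exact h

theorem vL_update (w : D.Vertex) (c : D₁.C) (b : Bool) :
    s.vL (Function.update w (s.crossings (.inl c)) b) = Function.update (s.vL w) c b := by
  funext c'
  by_cases h : c' = c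
  · subst h
    rw [vL, Function.update_self, Function.update_self]
  · rw [vL, Function.update_of_ne h, Function.update_of_ne]
    · rfl
    · exact fun h' => h (Sum.inl.inj (s.crossings.injective h'))

theorem vR_update (w : D.Vertex) (c : D₁.C) (b : Bool) :
    s.vR (Function.update w (s.crossings (.inl c)) b) = s.vR w := by
  funext c'
  exact Function.update_of_ne (fun h' => Sum.inr_ne_inl (s.crossings.injective h')) _ _

/-- The edge map for a crossing of the first summand, in terms of representing polynomials. -/
theorem edgeMap_inl (w : D.Vertex) (c : D₁.C) (F : D₁.Poly) (G : D₂.Poly) :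
    D.edgeMap (Function.update w (s.crossings (.inl c)) false) w (s.crossings (.inl c))
      (Ideal.Quotient.mk _ (MvPolynomial.rename s.inL F * MvPolynomial.rename s.inR G)) =
    s.algL w (D₁.edgeMap (Function.update (s.vL w) c false) (s.vL w) c (Ideal.Quotient.mk _ F)) *
      s.algR w (Ideal.Quotient.mk _ G) := by
  by_cases h : w (s.crossings (.inl c)) = true
  · rw [D.edgeMap_mk (D.update_edge.2 h), D₁.edgeMap_mk (D₁.update_edge.2 h), algL_mk, algR_mk,
      ← s.rename_theta, ← mul_assoc, ← map_mul (MvPolynomial.rename s.inL)]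
    exact map_mul _ _ _
  · rw [LinkDiagram.edgeMap, dif_neg (fun h' => h (D.update_edge.1 h')), LinkDiagram.edgeMap,
      dif_neg (fun h' => h (D₁.update_edge.1 h')), LinearMap.zero_apply, LinearMap.zero_apply,
      map_zero, zero_mul]

theorem edgeMap_inr (w : D.Vertex) (c : D₂.C) (F : D₁.Poly) (G : D₂.Poly) :
    D.edgeMap (Function.update w (s.crossings (.inr c)) false) w (s.crossings (.inr c))
      (Ideal.Quotient.mk _ (MvPolynomial.rename s.inL F * MvPolynomial.rename s.inR G)) =
    s.algL w (Ideal.Quotient.mk _ F) *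
      s.algR w (D₂.edgeMap (Function.update (s.vR w) c false) (s.vR w) c
        (Ideal.Quotient.mk _ G)) := by
  rw [mul_comm, mul_comm (s.algL w _)]
  exact s.symm.edgeMap_inl w c G F

/-- The differential of the connected sum is the differential of the tensor product. -/
theorem sumMap_d (f : D₁.kcrSub) (g : D₂.kcrSub) : D.kcrD (s.sumMap (f ⊗ₜ g)) =
    s.sumMap (D₁.kcrD f ⊗ₜ g + f ⊗ₜ D₂.kcrD g) := by
  refine Subtype.ext (funext fun w => ?_)
  have hf : ∃ F : D₁.Vertex → D₁.Poly, f.1 = fun v => Ideal.Quotient.mk (D₁.ideal v) (F v) := by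
    choose F hF using fun v => Ideal.Quotient.mk_surjective (f.1 v)
    exact ⟨F, funext fun v => (hF v).symm⟩
  have hg : ∃ G : D₂.Vertex → D₂.Poly, g.1 = fun v => Ideal.Quotient.mk (D₂.ideal v) (G v) := by
    choose G hG using fun v => Ideal.Quotient.mk_surjective (g.1 v)
    exact ⟨G, funext fun v => (hG v).symm⟩
  obtain ⟨F, hF⟩ := hf
  obtain ⟨G, hG⟩ := hg
  have hm : ∀ v, (s.sumMap (f ⊗ₜ g)).1 v = Ideal.Quotient.mk (D.ideal v)
      (MvPolynomial.rename s.inL (F (s.vL v)) * MvPolynomial.rename s.inR (G (s.vR v))) := by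
    intro v
    rw [sumMap_tmul, hF, hG, map_mul]
    rfl
  have h1 : (s.sumMap (D₁.kcrD f ⊗ₜ g)).1 w = s.algL w (D₁.kcD f.1 (s.vL w)) *
      s.algR w (g.1 (s.vR w)) := s.sumMap_tmul _ _ _
  have h2 : (s.sumMap (f ⊗ₜ D₂.kcrD g)).1 w = s.algL w (f.1 (s.vL w)) *
      s.algR w (D₂.kcD g.1 (s.vR w)) := s.sumMap_tmul _ _ _
  rw [map_add]
  change D.kcD (s.sumMap (f ⊗ₜ g)).1 w = (s.sumMap (D₁.kcrD f ⊗ₜ g)).1 w +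
    (s.sumMap (f ⊗ₜ D₂.kcrD g)).1 w
  rw [h1, h2, D.kcD_apply_eq, D₁.kcD_apply_eq, D₂.kcD_apply_eq, ← Equiv.sum_comp s.crossings,
    Fintype.sum_sum_type, map_sum, map_sum, Finset.sum_mul, Finset.mul_sum]
  congr 1
  · refine Finset.sum_congr rfl fun c _ => ?_
    rw [hm, s.vL_update, s.vR_update, edgeMap_inl, hF, hG]
  · refine Finset.sum_congr rfl fun c _ => ?_
    have hL : s.vL (Function.update w (s.crossings (.inr c)) false) = s.vL w :=
      s.symm.vR_update w c false
    have hR : s.vR (Function.update w (s.crossings (.inr c)) false) =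
        Function.update (s.vR w) c false := s.symm.vL_update w c false
    rw [hm, hL, hR, edgeMap_inr, hF, hG]

end ConnectedSumData

/-! ### Equivariance, and the homotopy equivalence -/

theorem HomotopyEquivalent.symm {S : Type} [CommRing S] [Algebra Base S] {s : S} {δ : ℤ × ℤ}
    {A B : BigradedComplex S s δ} (h : HomotopyEquivalent A B) : HomotopyEquivalent B A := by
  obtain ⟨f, g, h, k, hf, hg, hh, hk, fd, gd, hA, hB⟩ := h
  exact ⟨g, f, k, h, hg, hf, hk, hh, gd, fd, hB, hA⟩

/-- Isomorphic complexes over `R[τ]/(τ² + 1)` have homotopy equivalent Borel complexes. -/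
theorem borel_equivalent_of_iso {C X : KomTau} (e : C.carrier ≃ₗ[Base] X.carrier)
    (he : ∀ n, ∀ c ∈ C.gr n, e c ∈ X.gr n) (hd : ∀ c, e (C.dBase c) = X.dBase (e c))
    (hτ : ∀ c, e (C.tauMap c) = X.tauMap (e c)) : HomotopyEquivalent (borel C) (borel X) := by
  let r : Retraction C X :=
    { inc := e
      ret := e.symm
      hom := 0
      inc_mem := he
      ret_mem := fun n x hx =>
        mem_of_map_mem C.isInternal X.isInternal e.toLinearMap.toAddMonoidHom e.injective he <| by
          change e (e.symm x) ∈ X.gr n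
          rwa [e.apply_symm_apply]
      hom_mem := fun _ _ _ => zero_mem _
      inc_tau := hτ
      inc_d := hd
      ret_d := fun x => by
        change e.symm _ = C.dBase (e.symm x)
        rw [LinearEquiv.symm_apply_eq, hd, e.apply_symm_apply]
      ret_inc := e.symm_apply_apply
      hom_inc := fun _ => rfl
      inc_ret := fun x => by
        change e (e.symm x) = x + (X.dBase 0 + 0)
        rw [e.apply_symm_apply, map_zero, add_zero, add_zero] }
  refine r.borel_equivalent fun x => ⟨1, ?_⟩
  rw [pow_one]
  exact map_zero (LinearMap.id + X.tauMap)

theorem TransvergentDiagram.Kcr_tauMap (T : TransvergentDiagram) (f : T.kcrSub) :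
    T.Kcr.tauMap f = T.kcrTau f := by
  have : (0 : Base) • f + (1 : Base) • T.kcrTau f = T.kcrTau f := by
    rw [zero_smul, one_smul, zero_add]
  exact this

namespace ConnectedSumData

variable {T₁ T₂ T : TransvergentDiagram}
    (s : ConnectedSumData T₁.toLinkDiagram T₂.toLinkDiagram T.toLinkDiagram)

/-- The isomorphism of reduced complexes respects involutions that are glued from involutions of
the summands. -/
theorem sumMap_tau (hL : ∀ x, T.t (s.inL x) = s.inL (T₁.t x))
    (hR : ∀ x, T.t (s.inR x) = s.inR (T₂.t x))
    (hCL : ∀ c, T.tC (s.crossings (.inl c)) = s.crossings (.inl (T₁.tC c)))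
    (hCR : ∀ c, T.tC (s.crossings (.inr c)) = s.crossings (.inr (T₂.tC c)))
    (f : T₁.kcrSub) (g : T₂.kcrSub) :
    T.kcrTau (s.sumMap (f ⊗ₜ g)) = s.sumMap (T₁.kcrTau f ⊗ₜ T₂.kcrTau g) := by
  refine Subtype.ext (funext fun w => ?_)
  have vL : s.vL (T.tV w) = T₁.tV (s.vL w) := funext fun c => congrArg w (hCL c)
  have vR : s.vR (T.tV w) = T₂.tV (s.vR w) := funext fun c => congrArg w (hCR c)
  obtain ⟨F, hF⟩ := T₁.exists_lift f.1
  obtain ⟨G, hG⟩ := T₂.exists_lift g.1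
  have hm : ∀ v, (s.sumMap (f ⊗ₜ g)).1 v = Ideal.Quotient.mk (T.ideal v)
      (MvPolynomial.rename s.inL (F (s.vL v)) * MvPolynomial.rename s.inR (G (s.vR v))) := by
    intro v
    rw [sumMap_tmul, hF, hG, map_mul]
    rfl
  rw [sumMap_tmul]
  change T.tauAlg w ((s.sumMap (f ⊗ₜ g)).1 (T.tV w)) =
    s.algL w (T₁.tauAlg (s.vL w) (f.1 (T₁.tV (s.vL w)))) *
      s.algR w (T₂.tauAlg (s.vR w) (g.1 (T₂.tV (s.vR w))))
  have cL : T.t ∘ s.inL = s.inL ∘ T₁.t := funext hL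
  have cR : T.t ∘ s.inR = s.inR ∘ T₂.t := funext hR
  rw [hm, hF, hG, TransvergentDiagram.tauAlg_mk, TransvergentDiagram.tauAlg_mk,
    TransvergentDiagram.tauAlg_mk, algL_mk, algR_mk, vL, vR, map_mul (MvPolynomial.rename T.t),
    MvPolynomial.rename_rename, MvPolynomial.rename_rename, MvPolynomial.rename_rename,
    MvPolynomial.rename_rename, cL, cR]
  exact map_mul _ _ _

/-- The Borel complex of an equivariant connected sum is that of the tensor product of the reduced
complexes, with `τ` acting diagonally. -/
theorem borel_equivalent (hL : ∀ x, T.t (s.inL x) = s.inL (T₁.t x))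
    (hR : ∀ x, T.t (s.inR x) = s.inR (T₂.t x))
    (hCL : ∀ c, T.tC (s.crossings (.inl c)) = s.crossings (.inl (T₁.tC c)))
    (hCR : ∀ c, T.tC (s.crossings (.inr c)) = s.crossings (.inr (T₂.tC c))) :
    HomotopyEquivalent (borel (T₁.Kcr.tensor T₂.Kcr)) (borel T.Kcr) := by
  let e : T₁.kcrSub ⊗[Base] T₂.kcrSub ≃ₗ[Base] T.kcrSub :=
    LinearEquiv.ofLinearMap s.sumMap s.sumInv (LinearMap.ext s.sumMap_sumInv)
      (LinearMap.ext s.sumInv_sumMap)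
  have hd : ∀ t, s.sumMap ((TensorProduct.map T₁.kcrD LinearMap.id +
      TensorProduct.map LinearMap.id T₂.kcrD : Module.End Base _) t) = T.kcrD (s.sumMap t) := by
    intro t
    induction t using TensorProduct.induction_on with
    | zero => simp only [map_zero]
    | add x y hx hy => simp only [map_add, hx, hy]
    | tmul f g => exact (s.sumMap_d f g).symm
  let τ₁ : T₁.kcrSub →ₗ[Base] T₁.kcrSub := T₁.Kcr.tauMap
  let τ₂ : T₂.kcrSub →ₗ[Base] T₂.kcrSub := T₂.Kcr.tauMap
  have hτ : ∀ t, s.sumMap (TensorProduct.map τ₁ τ₂ t) = T.Kcr.tauMap (s.sumMap t) := by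
    intro t
    induction t using TensorProduct.induction_on with
    | zero =>
      rw [map_zero, map_zero]
      exact (map_zero T.Kcr.tauMap).symm
    | add x y hx hy =>
      rw [map_add, map_add, hx, hy, map_add]
      exact (map_add T.Kcr.tauMap _ _).symm
    | tmul f g =>
      exact (congrArg₂ (fun a b => s.sumMap (a ⊗ₜ b)) (T₁.Kcr_tauMap f) (T₂.Kcr_tauMap g)).trans
        ((s.sumMap_tau hL hR hCL hCR f g).symm.trans (T.Kcr_tauMap _).symm)
  exact borel_equivalent_of_iso (C := T₁.Kcr.tensor T₂.Kcr) (X := T.Kcr) e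
    (fun _ _ ht => s.sumMap_mem ht) hd
    fun t => (congrArg s.sumMap (KomTau.tensor_tauMap _ _ t)).trans (hτ t)

end ConnectedSumData

/-- The half-edges and crossings of the connected sum, split into those of the summands. -/
def LinkDiagram.connectedSumData (D₁ D₂ : LinkDiagram) (a₁ : D₁.Darts) (a₂ : D₂.Darts) :
    ConnectedSumData D₁ D₂ (D₁.connectedSum D₂ a₁ a₂) where
  darts := Equiv.ofBijective (Sum.elim Dart.inL Dart.inR) ⟨by
      rintro (x | x) (y | y) h
      · exact congrArg _ (Dart.inL_injective h)
      · exact absurd h (Dart.inL_ne_inR x y)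
      · exact absurd h.symm (Dart.inL_ne_inR y x)
      · exact congrArg _ (Dart.inR_injective h),
    Dart.sum_cases (fun x => ⟨.inl x, rfl⟩) fun x => ⟨.inr x, rfl⟩⟩
  crossings := Equiv.refl _
  a₁ := a₁
  a₂ := a₂
  e_left := D₁.sumE_left D₂ a₁ a₂
  e_left' := D₁.sumE_left' D₂ a₁ a₂
  e_inl _ := D₁.sumE_inL D₂ a₁ a₂
  e_inr _ := D₁.sumE_inR D₂ a₁ a₂
  crossing_inl _ _ := rfl
  crossing_inr _ _ := rfl
  res_inl v x := by rcases x with ⟨c, i⟩ | ⟨p, i⟩ <;> rfl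
  res_inr v x := by rcases x with ⟨c, i⟩ | ⟨p, i⟩ <;> rfl
  s₁ := 0
  s₂ := D₁.o a₁ + D₂.o a₂ + 1
  o_inl x := by rcases x with ⟨c, i⟩ | ⟨p, i⟩ <;> exact (add_zero _).symm
  o_inr x := by rcases x with ⟨c, i⟩ | ⟨p, i⟩ <;> rfl

end KoszulBorel

end

theorem theorem5 (D₁ D₂ : KoszulBorel.TransvergentDiagram)
    (b₁ : D₁.Basepoint) (b₂ : D₂.Basepoint) :
    KoszulBorel.HomotopyEquivalent (D₁.connectedSum D₂ b₁ b₂).reducedBorel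
      (KoszulBorel.brTensor D₁.reducedBorel D₂.reducedBorel) :=
  have h := (D₁.toLinkDiagram.connectedSumData D₂.toLinkDiagram b₁.1 b₂.1).borel_equivalent
    (T := D₁.connectedSum D₂ b₁ b₂) (D₁.reflect_inL D₂) (D₁.reflect_inR D₂) (fun _ => rfl)
    (fun _ => rfl)
  h.symm.trans (KoszulBorel.borel_tensor_equivalent D₁.Kcr D₂.Kcr)
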